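/- Let $\mathcal D=\{[n2^{-k},(n+1)2^{-k}): n,k\in\mathbb Z\}$ be the standard dyadic grid on $\mathbb R$. For $I\in\mathcal D$ with left and right halves $I_-,I_+$ let $h_I=|I|^{-1/2}(\mathbf 1_{I_+}-\mathbf 1_{I_-})$. For a locally integrable scalar function $f$ on $\mathbb R$ (all functions and sequences being real-valued, or all complex-valued) put $f(I,0)=\int_{\mathbb R} f h_I\,dx$ and $f(I,1)=\langle f\rangle_I=\frac1{|I|}\int_I f\,dx$. Write $b\in BMO^d$ if $b$ is locally integrable and $\sup_{I\in\mathcal D}\frac1{|I|}\int_I|b-\langle b\rangle_I|\,dx<\infty$. Let $m\ge 2$ and let $U_m=\{0,1\}^m\setminus\{(1,\dots,1)\}$. For $\alpha\in U_m$ let $\sigma(\alpha)$ be the number of indices $j$ with $\alpha_j=0$, and for a sequence $\epsilon=\{\epsilon_I\}_{I\in\mathcal D}$ of scalars put $$T_\epsilon^{\alpha}(f_1,\dots,f_m)=\sum_{I\in\mathcal D}\epsilon_I\Big(\prod_{j=1}^m f_j(I,\alpha_j)\Big)h_I^{\sigma(\alpha)},\qquad P^{\alpha}(f_1,\dots,f_m)=\sum_{I\in\mathcal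 D}\Big(\prod_{j=1}^m f_j(I,\alpha_j)\Big)h_I^{\sigma(\alpha)},$$ where the series are understood as limits in measure of their finite partial sums (along the directed set of all finite subsets of $\mathcal D$). For an operator $T$ on $m$-tuples of functions and $1\le i\le m$ put $$[b,T]_i(f_1,\dots,f_m)=b\,T(f_1,\dots,f_m)-T(f_1,\dots,bf_i,\dots,f_m).$$ Such an operator is called bounded from $L^{p_1}(\mathbb R)\times\cdots\times L^{p_m}(\mathbb R)$ to $L^r(\mathbb R)$ if it is defined for all $f_j\in L^{p_j}(\mathbb R)$ (all functions it is applied to are locally integrable and all series converge) and its norm in $L^r$ is at most $C\prod_{j=1}^m\|f_j\|_{p_j}$, with a finite constant $C$ independent of the $f_j$. **Theorem.** Let $m\ge2$, $\alpha\in U_m$, $1\le i\le m$, and $1<p_1,\dots,p_m,r<\infty$ with $\sum_{j=1}^m\frac1{p_j}=\frac1r$. Suppose $b\in L^p(\mathbb R)$ for some $p\in(1,\infty)$. Then the following two statements are equivalent: (a) $b\in BMO^d$; (b) $[b,T_\epsilon^{\alpha}]_i$ is bounded from $L^{p_1}\times\cdots\times L^{p_m}$ to $L^r$ for every bounded sequence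 $\epsilon=\{\epsilon_I\}_{I\in\mathcal D}$. Moreover, $b\in BMO^d$ if and only if $[b,P^{\alpha}]_i$ is bounded from $L^{p_1}\times\cdots\times L^{p_m}$ to $L^r$. -/

import Mathlib

open MeasureTheory Filter
open scoped NNReal ENNReal

noncomputable section

/-- An index for the standard dyadic grid: the pair `(k, n)` of integers stands for the dyadic
interval `[n 2⁻ᵏ, (n + 1) 2⁻ᵏ)`.  Distinct pairs give distinct intervals. -/
@[ext]
structure DyadicInterval where
  /-- the scale `k` -/
  scale : ℤ
  /-- the position `n` -/
  pos : ℤ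

namespace DyadicInterval

/-- The length `|I| = 2⁻ᵏ`. -/
def length (I : DyadicInterval) : ℝ := (2 : ℝ) ^ (-I.scale)

/-- The left endpoint of `I`. -/
def left (I : DyadicInterval) : ℝ := (I.pos : ℝ) * I.length

/-- The interval itself, `[n 2⁻ᵏ, (n + 1) 2⁻ᵏ)`. -/
def toSet (I : DyadicInterval) : Set ℝ :=
  Set.Ico ((I.pos : ℝ) * I.length) (((I.pos : ℝ) + 1) * I.length)

/-- The left half `I₋`. -/
def leftHalf (I : DyadicInterval) : Set ℝ :=
  Set.Ico I.left (I.left + I.length / 2)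

/-- The right half `I₊`. -/
def rightHalf (I : DyadicInterval) : Set ℝ :=
  Set.Ico (I.left + I.length / 2) (I.left + I.length)

/-- The Haar function `h_I = |I|^(-1/2) (1_{I₊} - 1_{I₋})`. -/
def haar (I : DyadicInterval) (x : ℝ) : ℝ :=
  (Real.sqrt I.length)⁻¹ *
    (I.rightHalf.indicator (fun _ => (1 : ℝ)) x - I.leftHalf.indicator (fun _ => (1 : ℝ)) x)

end DyadicInterval

section Operators

variable {𝕜 : Type*} [RCLike 𝕜]

/-- The average `⟨f⟩_I = |I|⁻¹ ∫_I f`. -/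
def dyadicAverage (f : ℝ → 𝕜) (I : DyadicInterval) : 𝕜 :=
  I.length⁻¹ • ∫ x in I.toSet, f x

/-- The Haar coefficient `⟨f, h_I⟩ = ∫ f h_I`. -/
def haarCoeff (f : ℝ → 𝕜) (I : DyadicInterval) : 𝕜 :=
  ∫ x, f x * (I.haar x : 𝕜)

/-- `f(I, 0) = ⟨f, h_I⟩` and `f(I, 1) = ⟨f⟩_I`. -/
def dyadicCoeff (f : ℝ → 𝕜) (I : DyadicInterval) (a : Fin 2) : 𝕜 :=
  if a = 0 then haarCoeff f I else dyadicAverage f I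

/-- `b ∈ BMO^d`: `b` is locally integrable and
`sup_I |I|⁻¹ ∫_I |b - ⟨b⟩_I| < ∞`, the supremum running over all dyadic intervals. -/
def MemDyadicBMO (b : ℝ → 𝕜) : Prop :=
  LocallyIntegrable b volume ∧
    BddAbove (Set.range fun I : DyadicInterval =>
      I.length⁻¹ * ∫ x in I.toSet, ‖b x - dyadicAverage b I‖)

/-- `U_m = {0,1}^m \ {(1, …, 1)}`. -/
def indexSetU (m : ℕ) : Set (Fin m → Fin 2) := {α | α ≠ fun _ => 1}

/-- `σ(α)`, the number of components of `α` equal to `0`. -/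
def sigma0 {m : ℕ} (α : Fin m → Fin 2) : ℕ :=
  (Finset.univ.filter fun j => α j = 0).card

/-- The term `P_I^α(f_1, …, f_m) = (∏_j f_j(I, α_j)) h_I^{σ(α)}`. -/
def paraproductTerm {m : ℕ} (α : Fin m → Fin 2) (f : Fin m → ℝ → 𝕜) (I : DyadicInterval)
    (x : ℝ) : 𝕜 :=
  (∏ j, dyadicCoeff (f j) I (α j)) * (I.haar x : 𝕜) ^ sigma0 α

/-- `g` is the sum of the series `∑_I u_I` of functions on `ℝ`: the sums over finite sets of dyadic
intervals converge to `g` in measure (unconditionally: the limit is along all finite sets).  This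
determines `g` up to equality almost everywhere. -/
def HasDyadicSum (u : DyadicInterval → ℝ → 𝕜) (g : ℝ → 𝕜) : Prop :=
  AEStronglyMeasurable g volume ∧
    TendstoInMeasure volume (fun (F : Finset DyadicInterval) (x : ℝ) => ∑ I ∈ F, u I x) atTop g

/-- The sum of a series of functions indexed by the dyadic intervals, defined if the series
converges. -/
def dyadicSum (u : DyadicInterval → ℝ → 𝕜) : Part (ℝ → 𝕜) :=
  ⟨∃ g, HasDyadicSum u g, fun h => h.choose⟩

/-- An operator taking `m` functions on `ℝ` to a function on `ℝ`, with a domain of definition. -/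
abbrev PartialOperator (𝕜 : Type*) (m : ℕ) := (Fin m → ℝ → 𝕜) →. (ℝ → 𝕜)

/-- The paraproduct `P^α(f_1, …, f_m) = ∑_I (∏_j f_j(I, α_j)) h_I^{σ(α)}`, defined if the `f_j`
are locally integrable (so that all the coefficients make sense) and the series converges. -/
def paraproduct {m : ℕ} (α : Fin m → Fin 2) : PartialOperator 𝕜 m := fun f =>
  Part.assert (∀ j, LocallyIntegrable (f j) volume) fun _ =>
    dyadicSum fun I x => paraproductTerm α f I x

/-- The Haar multiplier `T_ε^α(f_1, …, f_m) = ∑_I ε_I (∏_j f_j(I, α_j)) h_I^{σ(α)}`, defined under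
the same conditions. -/
def haarMultiplier {m : ℕ} (ε : DyadicInterval → 𝕜) (α : Fin m → Fin 2) :
    PartialOperator 𝕜 m := fun f =>
  Part.assert (∀ j, LocallyIntegrable (f j) volume) fun _ =>
    dyadicSum fun I x => ε I * paraproductTerm α f I x

/-- The commutator in the `i`-th variable,
`[b, T]_i(f_1, …, f_m) = b T(f_1, …, f_m) - T(f_1, …, b f_i, …, f_m)`,
defined if both terms are. -/
def dyadicCommutator {m : ℕ} (b : ℝ → 𝕜) (T : PartialOperator 𝕜 m) (i : Fin m) :
    PartialOperator 𝕜 m := fun f =>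
  (T f).bind fun u =>
    (T (Function.update f i fun x => b x * f i x)).map fun v => fun x => b x * u x - v x

/-- `T` is bounded from `L^{p_1} × ⋯ × L^{p_m}` to `L^r`: it is defined on all of
`L^{p_1} × ⋯ × L^{p_m}`, takes values in `L^r`, and
`‖T(f_1, …, f_m)‖_r ≤ C ∏_j ‖f_j‖_{p_j}` with `C` independent of the `f_j`. -/
def IsBoundedOperator {m : ℕ} (T : PartialOperator 𝕜 m) (p : Fin m → ℝ) (r : ℝ) : Prop :=
  ∃ C : ℝ≥0, ∀ f : Fin m → ℝ → 𝕜,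
    (∀ j, MemLp (f j) (ENNReal.ofReal (p j)) volume) →
      ∃ g ∈ T f, MemLp g (ENNReal.ofReal r) volume ∧
        eLpNorm g (ENNReal.ofReal r) volume ≤
          C * ∏ j, eLpNorm (f j) (ENNReal.ofReal (p j)) volume

end Operators

end

noncomputable section

open scoped Topology

namespace DyadicInterval

section

/-! ### Geometry of the dyadic grid -/

/-! Replacing `h_I` by `sgn`, that is `1_{I₊} - 1_{I₋}`, and the coefficients by averages of `± f`
(`ncoef`) removes every power of `|I|` from the terms (`paraproductTerm_eq`).

Sufficiency. Pair a finite partial sum of the commutator with `g` in the dual space. In the term of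
`I` the function `b` multiplies `g` in one summand and `f_i` in the other; subtracting `⟨b⟩_I` from
`b` in both changes nothing, since the two corrections cancel. There remain two forms `∑ |I| ∏
|coefficient|` in `m + 1` functions, each with one function multiplied by `b - ⟨b⟩_I`. At least two
slots carry a Haar coefficient: either `σ(α) ≥ 2`, or `σ(α) = 1` and `g` is paired with `h_I` itself
(`exists_two_zeros`).

Such forms are bounded by a stopping-time argument (`tsum_volume_mul_prod_le`). Below each `Q`, off
stopping intervals covering at most half of `Q`, two Haar slots have square sums bounded by `|Q|`
times the squared mean of the function, and the other slots are bounded by their means.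
Cauchy–Schwarz bounds the unstopped part by `|Q|` times a product of means, which is charged to the
unstopped half of `Q`. These charges live on disjoint sets, so the whole form is at most the
integral of a product of maximal functions, and Hölder with the maximal theorem finishes. For the
slot with `b - ⟨b⟩_I`, the John–Nirenberg inequality bounds the averages by `L^s` means of `f`,
where `s > 1` may be as close to `1` as needed; the square sums follow on freezing `⟨b⟩_I` at
`⟨b⟩_Q` (`sqControlled_ncoef_sub_mul`).

The operators must also be defined. The series converge unconditionally in `L^r`: outside a large
finite set of intervals, a function in a Haar slot can be replaced by the small remainder of its
Haar expansion (`exists_hasDyadicSum`). A `b` in `BMO^d ∩ L^q` lies in `L^t` for large integers `t`,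
so `b f_i` is in some `L^x` with `x > 1` and the second series converges too. The uniform bounds
pass to the limit by Fatou along a subsequence.

Necessity uses only `ε = 1`, with tests `sgn_Q` and `1_Q = sgn_Q²`. If some `k ≠ i` has `α_k = 0`,
orthogonality in slot `k` leaves only the term `I = Q`, and the commutator has modulus `|b - ⟨b⟩_Q|`
on `Q`. If `i` is the only Haar slot, put `sgn_Q` in slot `i` and in one other slot, and `1_Q`
elsewhere: the first series vanishes, and on each half `J` of `Q` the second is the Haar expansion
of `b - ⟨b⟩_J`. Either way the `L^r` bound controls the mean oscillation. -/

theorem length_pos (I : DyadicInterval) : 0 < I.length := zpow_pos two_pos _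

/-- The floor form turns nesting and disjointness of dyadic intervals into integer arithmetic. -/
theorem mem_toSet_iff (I : DyadicInterval) (x : ℝ) :
    x ∈ I.toSet ↔ ⌊x * (2 : ℝ) ^ I.scale⌋ = I.pos := by
  have h : (0 : ℝ) < 2 ^ I.scale := zpow_pos two_pos _
  rw [Int.floor_eq_iff, toSet, length, zpow_neg, Set.mem_Ico, ← div_eq_mul_inv, ← div_eq_mul_inv,
    div_le_iff₀ h, lt_div_iff₀ h]

/-- The dyadic interval of scale `k` that contains `x`. -/
def containing (k : ℤ) (x : ℝ) : DyadicInterval := ⟨k, ⌊x * (2 : ℝ) ^ k⌋⟩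

@[simp] theorem scale_containing (k : ℤ) (x : ℝ) : (containing k x).scale = k := rfl

theorem mem_containing (k : ℤ) (x : ℝ) : x ∈ (containing k x).toSet := by
  rw [mem_toSet_iff]; rfl

theorem mem_iff_containing_eq {I : DyadicInterval} {x : ℝ} :
    x ∈ I.toSet ↔ containing I.scale x = I := by
  rw [mem_toSet_iff]
  constructor
  · intro h; ext; · rfl
    exact h
  · intro h; exact congrArg pos h

theorem subset_of_mem {I J : DyadicInterval} {x : ℝ} (hI : x ∈ I.toSet) (hJ : x ∈ J.toSet)
    (h : J.scale ≤ I.scale) : I.toSet ⊆ J.toSet := by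
  obtain ⟨d, hd⟩ := Int.le.dest h
  -- The coarse position is an integer quotient of the fine one, hence constant on `I`.
  have key : ∀ y : ℝ, ⌊y * (2 : ℝ) ^ J.scale⌋ = ⌊y * (2 : ℝ) ^ I.scale⌋ / ((2 ^ d : ℕ) : ℤ) := by
    intro y
    rw [← Int.floor_div_natCast]
    congr 1
    rw [← hd, zpow_add₀ two_ne_zero]
    push_cast
    field_simp
    simp
  intro y hy
  rw [mem_toSet_iff] at *
  rw [key, hy, ← hI, ← key, hJ]

theorem disjoint_or_subset {I J : DyadicInterval} (h : J.scale ≤ I.scale) :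
    Disjoint I.toSet J.toSet ∨ I.toSet ⊆ J.toSet := by
  by_cases hd : Disjoint I.toSet J.toSet
  · exact Or.inl hd
  · obtain ⟨x, hI, hJ⟩ := Set.not_disjoint_iff.1 hd
    exact Or.inr (subset_of_mem hI hJ h)

theorem toSet_nonempty (I : DyadicInterval) : I.toSet.Nonempty := by
  refine ⟨(I.pos : ℝ) * I.length, le_refl _, ?_⟩
  nlinarith [I.length_pos]

@[measurability]
theorem measurableSet_toSet (I : DyadicInterval) : MeasurableSet I.toSet := measurableSet_Ico

theorem volume_toSet (I : DyadicInterval) : volume I.toSet = ENNReal.ofReal I.length := by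
  rw [toSet, Real.volume_Ico]; congr 1; ring

theorem volume_ne_zero (I : DyadicInterval) : volume I.toSet ≠ 0 := by
  rw [volume_toSet]; simpa using I.length_pos

theorem volume_ne_top (I : DyadicInterval) : volume I.toSet ≠ ∞ := by
  rw [volume_toSet]; simp

theorem length_le_iff {I J : DyadicInterval} : I.length ≤ J.length ↔ J.scale ≤ I.scale := by
  rw [length, length, zpow_le_zpow_iff_right₀ one_lt_two]; omega

theorem scale_le_of_subset {I J : DyadicInterval} (h : I.toSet ⊆ J.toSet) :
    J.scale ≤ I.scale := by
  have := measure_mono (μ := volume) h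
  rw [volume_toSet, volume_toSet, ENNReal.ofReal_le_ofReal_iff J.length_pos.le] at this
  exact length_le_iff.1 this

theorem eq_of_mem {I J : DyadicInterval} {x : ℝ} (hI : x ∈ I.toSet) (hJ : x ∈ J.toSet)
    (h : I.scale = J.scale) : I = J := by
  rw [mem_iff_containing_eq] at hI hJ
  rw [← hI, ← hJ, h]

theorem eq_of_subset {I J : DyadicInterval} (h : I.toSet ⊆ J.toSet) (hs : I.scale ≤ J.scale) :
    I = J := by
  obtain ⟨x, hx⟩ := I.toSet_nonempty
  exact eq_of_mem hx (h hx) (le_antisymm hs (scale_le_of_subset h))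

instance : Countable DyadicInterval :=
  Function.Injective.countable (f := fun I : DyadicInterval => (I.scale, I.pos))
    fun I J h => by cases I; cases J; simp_all

/-- The left half of `I` as a dyadic interval. -/
def lchild (I : DyadicInterval) : DyadicInterval := ⟨I.scale + 1, 2 * I.pos⟩

/-- The right half of `I` as a dyadic interval. -/
def rchild (I : DyadicInterval) : DyadicInterval := ⟨I.scale + 1, 2 * I.pos + 1⟩

@[simp] theorem scale_lchild (I : DyadicInterval) : I.lchild.scale = I.scale + 1 := rfl

@[simp] theorem scale_rchild (I : DyadicInterval) : I.rchild.scale = I.scale + 1 := rfl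

theorem length_of_scale_eq {I J : DyadicInterval} (h : J.scale = I.scale + 1) :
    J.length = I.length / 2 := by
  rw [length, length, h, neg_add, zpow_add₀ two_ne_zero]; norm_num; ring

theorem toSet_lchild (I : DyadicInterval) : I.lchild.toSet = I.leftHalf := by
  have h := length_of_scale_eq (scale_lchild I)
  rw [toSet, leftHalf, left, h]
  simp only [lchild]
  push_cast
  congr 1 <;> ring

theorem toSet_rchild (I : DyadicInterval) : I.rchild.toSet = I.rightHalf := by
  have h := length_of_scale_eq (scale_rchild I)
  rw [toSet, rightHalf, left, h]
  simp only [rchild]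
  push_cast
  congr 1 <;> ring

theorem toSet_eq_union (I : DyadicInterval) : I.toSet = I.lchild.toSet ∪ I.rchild.toSet := by
  have := I.length_pos
  rw [toSet_lchild, toSet_rchild, leftHalf, rightHalf, Set.Ico_union_Ico_eq_Ico, toSet, left]
  · congr 1; ring
  · linarith
  · linarith

theorem disjoint_children (I : DyadicInterval) : Disjoint I.lchild.toSet I.rchild.toSet := by
  rw [toSet_lchild, toSet_rchild, leftHalf, rightHalf, Set.disjoint_left]
  rintro x ⟨_, h1⟩ ⟨h2, _⟩
  linarith

theorem lchild_subset (I : DyadicInterval) : I.lchild.toSet ⊆ I.toSet := by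
  rw [toSet_eq_union I]; exact Set.subset_union_left

theorem rchild_subset (I : DyadicInterval) : I.rchild.toSet ⊆ I.toSet := by
  rw [toSet_eq_union I]; exact Set.subset_union_right

theorem subset_child {I J : DyadicInterval} (h : J.toSet ⊆ I.toSet) (hne : J ≠ I) :
    J.toSet ⊆ I.lchild.toSet ∨ J.toSet ⊆ I.rchild.toSet := by
  obtain ⟨x, hx⟩ := J.toSet_nonempty
  have hs : I.scale + 1 ≤ J.scale := by
    by_contra hlt
    exact hne (eq_of_subset h (by omega))
  have := h hx
  rw [toSet_eq_union] at this
  rcases this with h1 | h1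
  · exact Or.inl (subset_of_mem hx h1 hs)
  · exact Or.inr (subset_of_mem hx h1 hs)

theorem volume_of_scale_eq {I J : DyadicInterval} (h : J.scale = I.scale + 1) :
    volume I.toSet = 2 * volume J.toSet := by
  rw [volume_toSet, volume_toSet, length_of_scale_eq h, ← ENNReal.ofReal_ofNat 2,
    ← ENNReal.ofReal_mul (by norm_num)]
  congr 1; ring

/-- The dyadic interval of twice the length containing `I`. -/
def parent (I : DyadicInterval) : DyadicInterval := ⟨I.scale - 1, I.pos / 2⟩

theorem scale_parent (I : DyadicInterval) : I.scale = I.parent.scale + 1 := by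
  simp [parent]

theorem eq_child_parent (I : DyadicInterval) : I = I.parent.lchild ∨ I = I.parent.rchild := by
  rcases Int.emod_two_eq_zero_or_one I.pos with h | h
  · left; ext <;> simp [parent, lchild]; omega
  · right; ext <;> simp [parent, rchild]; omega

theorem subset_parent (I : DyadicInterval) : I.toSet ⊆ I.parent.toSet := by
  rcases I.eq_child_parent with h | h
  · exact (congrArg toSet h).trans_subset (lchild_subset _)
  · exact (congrArg toSet h).trans_subset (rchild_subset _)

/-! ### Maximal intervals of a family -/

/-- The union of a family of dyadic intervals. -/
def shadow (B : Set DyadicInterval) : Set ℝ := ⋃ J ∈ B, J.toSet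

/-- The maximal members of a family of dyadic intervals. -/
def tops (B : Set DyadicInterval) : Set DyadicInterval :=
  {J | J ∈ B ∧ ∀ J' ∈ B, J.toSet ⊆ J'.toSet → J' = J}

theorem mem_shadow {B : Set DyadicInterval} {x : ℝ} :
    x ∈ shadow B ↔ ∃ J ∈ B, x ∈ J.toSet := by simp [shadow]

theorem measurableSet_shadow (B : Set DyadicInterval) : MeasurableSet (shadow B) :=
  MeasurableSet.biUnion B.to_countable fun J _ => J.measurableSet_toSet

/-- The lower bound on scales stops ascending chains; without it a family may have no maximal
members. -/
theorem exists_mem_tops {B : Set DyadicInterval} {k : ℤ} (hB : ∀ J ∈ B, k ≤ J.scale)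
    {J : DyadicInterval} (hJ : J ∈ B) : ∃ P ∈ tops B, J.toSet ⊆ P.toSet := by
  obtain ⟨s, ⟨P, hP, hJP, rfl⟩, hmin⟩ := Int.exists_least_of_bdd
    (P := fun s => ∃ P ∈ B, J.toSet ⊆ P.toSet ∧ P.scale = s)
    ⟨k, by rintro _ ⟨P, hP, _, rfl⟩; exact hB P hP⟩ ⟨J.scale, J, hJ, le_rfl, rfl⟩
  refine ⟨P, ⟨hP, fun J' hJ' h => ?_⟩, hJP⟩
  exact (eq_of_subset h (hmin _ ⟨J', hJ', hJP.trans h, rfl⟩)).symm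

theorem tops_pairwiseDisjoint (B : Set DyadicInterval) :
    (tops B).PairwiseDisjoint toSet := by
  intro I hI J hJ hne
  rcases le_total I.scale J.scale with h | h
  · rcases disjoint_or_subset h with h | h
    · exact h.symm
    · exact absurd (hJ.2 I hI.1 h) hne
  · rcases disjoint_or_subset h with h | h
    · exact h
    · exact absurd (hI.2 J hJ.1 h).symm hne

theorem shadow_eq_biUnion_tops {B : Set DyadicInterval} {k : ℤ} (hB : ∀ J ∈ B, k ≤ J.scale) :
    shadow B = ⋃ J ∈ tops B, J.toSet := by
  apply subset_antisymm
  · intro x hx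
    obtain ⟨J, hJ, hx⟩ := mem_shadow.1 hx
    obtain ⟨P, hP, hs⟩ := exists_mem_tops hB hJ
    exact Set.mem_biUnion hP (hs hx)
  · exact Set.biUnion_subset_biUnion_left fun J hJ => hJ.1

theorem lintegral_shadow {B : Set DyadicInterval} {k : ℤ} (hB : ∀ J ∈ B, k ≤ J.scale)
    (G : ℝ → ℝ≥0∞) :
    ∫⁻ x in shadow B, G x = ∑' P : tops B, ∫⁻ x in P.1.toSet, G x := by
  rw [shadow_eq_biUnion_tops hB,
    lintegral_biUnion (tops B).to_countable (fun J _ => J.measurableSet_toSet)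
      (tops_pairwiseDisjoint B)]

theorem volume_shadow {B : Set DyadicInterval} {k : ℤ} (hB : ∀ J ∈ B, k ≤ J.scale) :
    volume (shadow B) = ∑' P : tops B, volume P.1.toSet := by
  simpa using lintegral_shadow hB 1

/-- The maximal intervals are disjoint and cover the same set, so the hypothesis can be summed over
them with no loss. -/
theorem weak_type {B : Set DyadicInterval} {k : ℤ} (hB : ∀ J ∈ B, k ≤ J.scale) {φ : ℝ → ℝ≥0∞}
    {c : ℝ≥0∞} (h : ∀ J ∈ B, c * volume J.toSet ≤ ∫⁻ x in J.toSet, φ x) :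
    c * volume (shadow B) ≤ ∫⁻ x in shadow B, φ x := by
  rw [volume_shadow hB, lintegral_shadow hB, ← ENNReal.tsum_mul_left]
  exact ENNReal.tsum_le_tsum fun P => h P.1 P.2.1

/-! ### Averages of nonnegative functions -/

/-- The average of a nonnegative function over a dyadic interval. -/
def lavg (φ : ℝ → ℝ≥0∞) (I : DyadicInterval) : ℝ≥0∞ :=
  (∫⁻ x in I.toSet, φ x) / volume I.toSet

theorem volume_mul_lavg (φ : ℝ → ℝ≥0∞) (I : DyadicInterval) :
    volume I.toSet * lavg φ I = ∫⁻ x in I.toSet, φ x :=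
  ENNReal.mul_div_cancel I.volume_ne_zero I.volume_ne_top

theorem lavg_le_iff {φ : ℝ → ℝ≥0∞} {I : DyadicInterval} {c : ℝ≥0∞} :
    lavg φ I ≤ c ↔ ∫⁻ x in I.toSet, φ x ≤ c * volume I.toSet :=
  ENNReal.div_le_iff I.volume_ne_zero I.volume_ne_top

theorem lavg_mono {φ ψ : ℝ → ℝ≥0∞} (h : φ ≤ ψ) (I : DyadicInterval) : lavg φ I ≤ lavg ψ I :=
  ENNReal.div_le_div_right (lintegral_mono h) _

theorem lavg_const (c : ℝ≥0∞) (I : DyadicInterval) : lavg (fun _ => c) I = c := by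
  rw [lavg, lintegral_const, Measure.restrict_apply_univ,
    ENNReal.mul_div_cancel_right I.volume_ne_zero I.volume_ne_top]

theorem lavg_le_two_mul {φ : ℝ → ℝ≥0∞} {I J : DyadicInterval} (h : J.scale = I.scale + 1)
    (hs : J.toSet ⊆ I.toSet) : lavg φ J ≤ 2 * lavg φ I := by
  rw [lavg_le_iff, mul_assoc, mul_comm, mul_assoc, mul_comm _ 2, ← volume_of_scale_eq h, mul_comm,
    volume_mul_lavg]
  exact lintegral_mono_set hs

/-- The source of all stopping families: by the weak-type estimate inside `Q`, intervals whose
average exceeds `N` times the level of `Q` cover only a fraction `1 / N` of it. -/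
theorem volume_shadow_le_of_lavg {φ : ℝ → ℝ≥0∞} {Q : DyadicInterval} {c N : ℝ≥0∞}
    (hN0 : N ≠ 0) (hN : N ≠ ∞) (hQ : lavg φ Q ≤ c) {B : Set DyadicInterval}
    (hBQ : ∀ J ∈ B, J.toSet ⊆ Q.toSet) (hB : ∀ J ∈ B, N * c < lavg φ J) :
    volume (shadow B) ≤ volume Q.toSet / N := by
  rcases B.eq_empty_or_nonempty with rfl | ⟨J, hJ⟩
  · simp [shadow]
  have hsub : shadow B ⊆ Q.toSet := by
    intro x hx
    obtain ⟨J, hJ, hx⟩ := mem_shadow.1 hx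
    exact hBQ J hJ hx
  have hc : c ≠ ∞ := by
    rintro rfl
    have := hB J hJ
    simp [ENNReal.mul_top hN0] at this
  have hc0 : c ≠ 0 := by
    rintro rfl
    have h1 : ∫⁻ x in J.toSet, φ x = 0 := by
      have := (lavg_le_iff.1 hQ).trans_eq (zero_mul _)
      exact le_antisymm ((lintegral_mono_set (hBQ J hJ)).trans this) bot_le
    have := hB J hJ
    simp [lavg, h1] at this
  have h1 : N * c * volume (shadow B) ≤ ∫⁻ x in shadow B, φ x := by
    refine weak_type (k := Q.scale) (fun J hJ => scale_le_of_subset (hBQ J hJ)) fun J hJ => ?_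
    rw [← volume_mul_lavg, mul_comm]
    gcongr
    exact (hB J hJ).le
  have h2 : N * c * volume (shadow B) ≤ c * volume Q.toSet :=
    h1.trans ((lintegral_mono_set hsub).trans (lavg_le_iff.1 hQ))
  rw [ENNReal.le_div_iff_mul_le (Or.inl hN0) (Or.inl hN)]
  rw [mul_comm N, mul_assoc, ENNReal.mul_le_mul_iff_right hc0 hc] at h2
  rwa [mul_comm]

/-! ### Lebesgue differentiation -/

theorem toSet_ae_eq_closedBall (I : DyadicInterval) :
    I.toSet =ᵐ[volume] Metric.closedBall (((I.pos : ℝ) + 1 / 2) * I.length) (I.length / 2) := by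
  rw [Real.closedBall_eq_Icc, toSet]
  have h1 : ((I.pos : ℝ) + 1 / 2) * I.length - I.length / 2 = I.pos * I.length := by ring
  have h2 : ((I.pos : ℝ) + 1 / 2) * I.length + I.length / 2 = (I.pos + 1) * I.length := by ring
  rw [h1, h2]
  exact Ico_ae_eq_Icc

/-- Up to an endpoint a dyadic interval is a ball about its midpoint, and the differentiation
theorem for doubling measures allows balls that contain `x` without being centred there. -/
theorem ae_tendsto_dyadicAverage {𝕜 : Type*} [RCLike 𝕜] {f : ℝ → 𝕜}
    (hf : LocallyIntegrable f volume) :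
    ∀ᵐ x, Tendsto (fun n : ℕ => dyadicAverage f (containing n x)) atTop (𝓝 (f x)) := by
  filter_upwards [IsUnifLocDoublingMeasure.ae_tendsto_average volume hf 1] with x hx
  have hlen : ∀ n : ℕ, (containing n x).length = (1 / 2 : ℝ) ^ n := by
    intro n; simp [length]
  have := hx (l := atTop) (fun n : ℕ => (((containing n x).pos : ℝ) + 1 / 2) *
    (containing n x).length) (fun n : ℕ => (containing n x).length / 2) ?_ ?_
  · refine this.congr fun n => ?_
    rw [dyadicAverage, setAverage_eq, Measure.real]
    rw [← setIntegral_congr_set (toSet_ae_eq_closedBall (containing n x)),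
      ← measure_congr (toSet_ae_eq_closedBall (containing n x)), volume_toSet,
      ENNReal.toReal_ofReal (length_pos _).le]
  · rw [tendsto_nhdsWithin_iff]
    constructor
    · simp_rw [hlen]
      have := (tendsto_pow_atTop_nhds_zero_of_lt_one (r := (1 / 2 : ℝ)) (by norm_num)
        (by norm_num)).div_const 2
      simpa using this
    · exact Eventually.of_forall fun n => half_pos (length_pos _)
  · refine Eventually.of_forall fun n => ?_
    have hx := mem_containing n x
    rw [toSet, Set.mem_Ico] at hx
    rw [Real.closedBall_eq_Icc]
    constructor <;> linarith [hx.1, hx.2]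

theorem dyadicAverage_enorm_le {𝕜 : Type*} [RCLike 𝕜] (f : ℝ → 𝕜) (I : DyadicInterval) :
    ‖dyadicAverage f I‖ₑ ≤ lavg (fun x => ‖f x‖ₑ) I := by
  rw [dyadicAverage, lavg, volume_toSet, enorm_smul, ENNReal.div_eq_inv_mul,
    ← ENNReal.ofReal_inv_of_pos I.length_pos, Real.enorm_of_nonneg (inv_pos.2 I.length_pos).le]
  gcongr
  exact enorm_integral_le_lintegral_enorm _

theorem lavg_eq_of_nonneg {f : ℝ → ℝ} (hf : ∀ x, 0 ≤ f x) {I : DyadicInterval}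
    (hi : IntegrableOn f I.toSet volume) :
    lavg (fun x => ‖f x‖ₑ) I = ENNReal.ofReal (dyadicAverage f I) := by
  rw [lavg, dyadicAverage, volume_toSet, ← ofReal_integral_norm_eq_lintegral_enorm hi,
    ← ENNReal.ofReal_div_of_pos I.length_pos]
  congr 1
  simp only [Real.norm_of_nonneg (hf _), smul_eq_mul]
  ring

theorem _root_.MeasureTheory.LocallyIntegrable.integrableOn_toSet {E : Type*}
    [NormedAddCommGroup E] {f : ℝ → E} (hf : LocallyIntegrable f volume) (I : DyadicInterval) :
    IntegrableOn f I.toSet volume :=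
  (hf.integrableOn_isCompact (isCompact_Icc (a := (I.pos : ℝ) * I.length)
    (b := ((I.pos : ℝ) + 1) * I.length))).mono_set Set.Ico_subset_Icc_self

theorem ae_tendsto_lavg {𝕜 : Type*} [RCLike 𝕜] {f : ℝ → 𝕜}
    (hf : LocallyIntegrable f volume) :
    ∀ᵐ x, Tendsto (fun n : ℕ => lavg (fun y => ‖f y‖ₑ) (containing n x)) atTop (𝓝 ‖f x‖ₑ) := by
  have hf' : LocallyIntegrable (fun x => ‖f x‖) volume :=
    fun x => (hf x).norm
  filter_upwards [ae_tendsto_dyadicAverage hf'] with x hx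
  have h1 : ∀ n : ℕ, lavg (fun y => ‖f y‖ₑ) (containing n x) =
      ENNReal.ofReal (dyadicAverage (fun y => ‖f y‖) (containing n x)) := by
    intro n
    rw [← lavg_eq_of_nonneg (fun _ => norm_nonneg _) (hf'.integrableOn_toSet _)]
    simp
  simp_rw [h1]
  rw [← ofReal_norm]
  exact (ENNReal.continuous_ofReal.tendsto _).comp hx

/-- A function whose averages over all small dyadic intervals at almost every point of a set are at
most `c` is at most `c` almost everywhere on this set. -/
theorem ae_enorm_le_of_lavg_le {𝕜 : Type*} [RCLike 𝕜] {f : ℝ → 𝕜}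
    (hf : LocallyIntegrable f volume) {c : ℝ≥0∞} {S : Set ℝ}
    (h : ∀ x ∈ S, ∃ k : ℤ, ∀ I : DyadicInterval, k ≤ I.scale → x ∈ I.toSet →
      lavg (fun y => ‖f y‖ₑ) I ≤ c) :
    ∀ᵐ x, x ∈ S → ‖f x‖ₑ ≤ c := by
  filter_upwards [ae_tendsto_lavg hf] with x hx hxS
  obtain ⟨k, hk⟩ := h x hxS
  refine le_of_tendsto hx ?_
  filter_upwards [eventually_ge_atTop k.toNat] with n hn
  exact hk _ (by simp; omega) (mem_containing _ _)

end

section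

/-! ### Sums over dyadic intervals controlled by a stopping rule -/

theorem ne_of_volume_shadow_le {Q : DyadicInterval} {B : Set DyadicInterval}
    (h : volume (shadow B) ≤ volume Q.toSet / 2) : Q ∉ B := by
  intro hQ
  have h1 : volume Q.toSet ≤ volume (shadow B) :=
    measure_mono fun x hx => mem_shadow.2 ⟨Q, hQ, hx⟩
  have := ENNReal.half_lt_self Q.volume_ne_zero Q.volume_ne_top
  exact absurd (h1.trans h) (not_le.2 this)

/-- `A` is summed over the intervals below `Q` that are not stopped. -/
def StoppingBound (A : DyadicInterval → ℝ≥0∞) (G : ℝ → ℝ≥0∞) (C : ℝ≥0∞) (Q : DyadicInterval) :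
    Prop :=
  ∃ B : Set DyadicInterval, (∀ J ∈ B, J.toSet ⊆ Q.toSet) ∧
    volume (shadow B) ≤ volume Q.toSet / 2 ∧
    ∃ c : ℝ≥0∞, (∀ x ∈ Q.toSet, c ≤ G x) ∧ ∀ t : Finset DyadicInterval,
      (∀ I ∈ t, I.toSet ⊆ Q.toSet ∧ ∀ J ∈ B, ¬ I.toSet ⊆ J.toSet) →
        ∑ I ∈ t, A I ≤ C * (volume Q.toSet * c)

/-- At least half of `Q` survives the removal of `S`, and `G ≥ c` there; this is the charge made to
the unstopped part. -/
theorem volume_mul_le_lintegral_diff {Q : DyadicInterval} {S : Set ℝ} {G : ℝ → ℝ≥0∞} {c : ℝ≥0∞}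
    (hS : MeasurableSet S) (h : volume S ≤ volume Q.toSet / 2) (hc : ∀ x ∈ Q.toSet, c ≤ G x) :
    volume Q.toSet * c ≤ 2 * ∫⁻ x in Q.toSet \ S, G x := by
  have h1 : volume Q.toSet ≤ 2 * volume (Q.toSet \ S) := by
    have h2 : volume Q.toSet / 2 ≤ volume (Q.toSet \ S) := by
      calc volume Q.toSet / 2 = volume Q.toSet - volume Q.toSet / 2 :=
            (ENNReal.sub_half Q.volume_ne_top).symm
        _ ≤ volume Q.toSet - volume S := tsub_le_tsub_left h _
        _ ≤ _ := le_measure_sdiff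
    calc volume Q.toSet = 2 * (volume Q.toSet / 2) := by
          rw [mul_comm]; exact (ENNReal.div_mul_cancel two_ne_zero ENNReal.ofNat_ne_top).symm
      _ ≤ _ := by gcongr
  calc volume Q.toSet * c ≤ 2 * volume (Q.toSet \ S) * c := by gcongr
    _ = 2 * ∫⁻ _ in Q.toSet \ S, c := by
        rw [setLIntegral_const, mul_assoc, mul_comm c]
    _ ≤ _ := by
        gcongr 2 * ?_
        exact setLIntegral_mono' (Q.measurableSet_toSet.diff hS) fun x hx => hc x hx.1

/-- Induction on the number `n` of generations. Unstopped intervals are charged to `Q` minus the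
shadow, stopped ones to the maximal stopping intervals; these regions are disjoint, so the constant
does not grow with `n`. -/
theorem sum_le_of_stoppingBound_of_scale_lt {A : DyadicInterval → ℝ≥0∞} {G : ℝ → ℝ≥0∞} {C : ℝ≥0∞}
    (h : ∀ Q, StoppingBound A G C Q) (n : ℕ) : ∀ (Q : DyadicInterval) (t : Finset DyadicInterval),
      (∀ I ∈ t, I.toSet ⊆ Q.toSet ∧ I.scale < Q.scale + n) →
        ∑ I ∈ t, A I ≤ 2 * C * ∫⁻ x in Q.toSet, G x := by
  classical
  induction n with
  | zero =>
    intro Q t ht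
    have : t = ∅ := Finset.eq_empty_of_forall_notMem fun I hI => by
      have := ht I hI
      have := scale_le_of_subset this.1
      simp at *; omega
    simp [this]
  | succ n ih =>
    intro Q t ht
    obtain ⟨B, hBQ, hBvol, c, hc, hA⟩ := h Q
    have hBs : ∀ J ∈ B, Q.scale ≤ J.scale := fun J hJ => scale_le_of_subset (hBQ J hJ)
    have hQB := ne_of_volume_shadow_le hBvol
    rw [← Finset.sum_filter_add_sum_filter_not t (fun I => ∀ J ∈ B, ¬ I.toSet ⊆ J.toSet)]
    have h1 : ∑ I ∈ t with (∀ J ∈ B, ¬ I.toSet ⊆ J.toSet), A I ≤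
        2 * C * ∫⁻ x in Q.toSet \ shadow B, G x := by
      refine (hA _ fun I hI => ?_).trans ?_
      · rw [Finset.mem_filter] at hI
        exact ⟨(ht I hI.1).1, hI.2⟩
      · rw [mul_comm 2 C, mul_assoc]
        exact mul_le_mul_right
          (volume_mul_le_lintegral_diff (measurableSet_shadow B) hBvol hc) C
    have h2 : ∑ I ∈ t with ¬ (∀ J ∈ B, ¬ I.toSet ⊆ J.toSet), A I ≤
        2 * C * ∫⁻ x in shadow B, G x := by
      rw [lintegral_shadow hBs, ← ENNReal.tsum_mul_left]
      calc ∑ I ∈ t with ¬ (∀ J ∈ B, ¬ I.toSet ⊆ J.toSet), A I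
          ≤ ∑ I ∈ t with ¬ (∀ J ∈ B, ¬ I.toSet ⊆ J.toSet),
              ∑' P : tops B, if I.toSet ⊆ P.1.toSet then A I else 0 := by
            refine Finset.sum_le_sum fun I hI => ?_
            simp only [Finset.mem_filter, not_forall, not_not] at hI
            obtain ⟨_, J, hJ, hIJ⟩ := hI
            obtain ⟨P, hP, hJP⟩ := exists_mem_tops hBs hJ
            refine le_trans ?_ (ENNReal.le_tsum ⟨P, hP⟩)
            rw [if_pos (hIJ.trans hJP)]
        _ = ∑' P : tops B, ∑ I ∈ t with ¬ (∀ J ∈ B, ¬ I.toSet ⊆ J.toSet),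
              if I.toSet ⊆ P.1.toSet then A I else 0 :=
            (Summable.tsum_finsetSum fun _ _ => ENNReal.summable).symm
        _ ≤ _ := by
            refine ENNReal.tsum_le_tsum fun P => ?_
            rw [← Finset.sum_filter]
            refine ih P.1 _ fun I hI => ?_
            simp only [Finset.mem_filter] at hI
            -- `Q` itself is not stopped, its stopping family being too small, so a generation is
            -- gained.
            have hlt : Q.scale < P.1.scale := by
              by_contra hle
              have := eq_of_subset (hBQ P.1 P.2.1) (not_lt.1 hle)
              exact hQB (this ▸ P.2.1)
            have := (ht I hI.1.1).2
            refine ⟨hI.2, ?_⟩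
            push_cast at this
            omega
    have hsub : shadow B ⊆ Q.toSet := fun x hx => by
      obtain ⟨J, hJ, hx⟩ := mem_shadow.1 hx
      exact hBQ J hJ hx
    calc _ ≤ (2 * C * ∫⁻ x in Q.toSet \ shadow B, G x) + 2 * C * ∫⁻ x in shadow B, G x :=
          add_le_add h1 h2
      _ = 2 * C * ∫⁻ x in Q.toSet, G x := by
          rw [← mul_add, add_comm]
          congr 1
          have := lintegral_inter_add_sdiff (μ := volume) G Q.toSet (measurableSet_shadow B)
          rwa [Set.inter_eq_right.2 hsub] at this

/-- Two intervals are needed: `0` is an endpoint at every scale, so no dyadic interval reaches both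
sides of it. -/
theorem eventually_subset_top (I : DyadicInterval) :
    ∀ᶠ K : ℕ in atTop, I.toSet ⊆ (⟨-K, 0⟩ : DyadicInterval).toSet ∨
      I.toSet ⊆ (⟨-K, -1⟩ : DyadicInterval).toSet := by
  obtain ⟨x, hx⟩ := I.toSet_nonempty
  have h1 : ∀ᶠ K : ℕ in atTop, |x| < (2 : ℝ) ^ K :=
    (tendsto_pow_atTop_atTop_of_one_lt one_lt_two).eventually_gt_atTop _
  filter_upwards [h1, eventually_ge_atTop (-I.scale).toNat] with K hK hs
  have hK' := abs_lt.1 hK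
  have hpos : (0 : ℝ) < 2 ^ K := by positivity
  rcases le_or_gt 0 x with h0 | h0
  · left
    refine subset_of_mem hx ?_ (by simp; omega)
    rw [mem_toSet_iff, Int.floor_eq_iff]
    simp only [zpow_neg, zpow_natCast, Int.cast_zero, zero_add, ← div_eq_mul_inv]
    exact ⟨by positivity, by rw [div_lt_one hpos]; exact hK'.2⟩
  · right
    refine subset_of_mem hx ?_ (by simp; omega)
    rw [mem_toSet_iff, Int.floor_eq_iff]
    simp only [zpow_neg, zpow_natCast, ← div_eq_mul_inv]
    push_cast
    refine ⟨?_, ?_⟩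
    · rw [le_div_iff₀ hpos]; linarith
    · rw [div_lt_iff₀ hpos]; linarith

theorem tsum_le_of_stoppingBound {A : DyadicInterval → ℝ≥0∞} {G : ℝ → ℝ≥0∞} {C : ℝ≥0∞}
    (h : ∀ Q, StoppingBound A G C Q) : ∑' I, A I ≤ 2 * C * ∫⁻ x, G x := by
  classical
  rw [ENNReal.tsum_eq_iSup_sum]
  refine iSup_le fun t => ?_
  have hev : ∀ᶠ K : ℕ in atTop, ∀ I ∈ t, I.toSet ⊆ (⟨-K, 0⟩ : DyadicInterval).toSet ∨
      I.toSet ⊆ (⟨-K, -1⟩ : DyadicInterval).toSet :=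
    (Filter.eventually_all_finset t).2 fun I _ => I.eventually_subset_top
  obtain ⟨K, hK⟩ := hev.exists
  obtain ⟨n, hn⟩ : ∃ n : ℕ, ∀ I ∈ t, I.scale < -K + n := by
    have : ∀ᶠ n : ℕ in atTop, ∀ I ∈ t, I.scale < -K + n := by
      refine (Filter.eventually_all_finset t).2 fun I _ => ?_
      filter_upwards [eventually_gt_atTop (I.scale + K).toNat] with n hn
      omega
    exact this.exists
  set P : DyadicInterval := ⟨-K, 0⟩
  set M : DyadicInterval := ⟨-K, -1⟩
  rw [← Finset.sum_filter_add_sum_filter_not t (fun I => I.toSet ⊆ P.toSet)]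
  have h1 := sum_le_of_stoppingBound_of_scale_lt h n P (t.filter fun I => I.toSet ⊆ P.toSet)
    fun I hI => by
      rw [Finset.mem_filter] at hI
      exact ⟨hI.2, hn I hI.1⟩
  have h2 := sum_le_of_stoppingBound_of_scale_lt h n M (t.filter fun I => ¬ I.toSet ⊆ P.toSet)
    fun I hI => by
      rw [Finset.mem_filter] at hI
      exact ⟨(hK I hI.1).resolve_left hI.2, hn I hI.1⟩
  have hd : Disjoint P.toSet M.toSet := by
    rw [Set.disjoint_left]
    intro x hx hx'
    have := congrArg pos (eq_of_mem hx hx' rfl)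
    simp [P, M] at this
  calc _ ≤ _ := add_le_add h1 h2
    _ = 2 * C * ∫⁻ x in P.toSet ∪ M.toSet, G x := by
      rw [← mul_add, lintegral_union M.measurableSet_toSet hd]
    _ ≤ _ := by gcongr; exact Measure.restrict_le_self

/-! ### The dyadic maximal function -/

/-- The dyadic maximal function. -/
def maximal (φ : ℝ → ℝ≥0∞) (x : ℝ) : ℝ≥0∞ :=
  ⨆ I : DyadicInterval, I.toSet.indicator (fun _ => lavg φ I) x

theorem measurable_maximal (φ : ℝ → ℝ≥0∞) : Measurable (maximal φ) :=
  Measurable.iSup fun I => measurable_const.indicator I.measurableSet_toSet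

theorem lavg_le_maximal (φ : ℝ → ℝ≥0∞) {I : DyadicInterval} {x : ℝ} (hx : x ∈ I.toSet) :
    lavg φ I ≤ maximal φ x :=
  le_iSup_of_le I (by rw [Set.indicator_of_mem hx])

theorem setOf_lt_maximal (φ : ℝ → ℝ≥0∞) (c : ℝ≥0∞) :
    {x | c < maximal φ x} = shadow {I | c < lavg φ I} := by
  ext x
  simp only [maximal, Set.mem_ofPred_eq, lt_iSup_iff, mem_shadow]
  refine exists_congr fun I => ?_
  by_cases hx : x ∈ I.toSet <;> simp [hx]

theorem mul_volume_lt_maximal_le (φ : ℝ → ℝ≥0∞) (c : ℝ≥0∞) :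
    c * volume {x | c < maximal φ x} ≤ ∫⁻ x, φ x := by
  -- Scales are truncated so that maximal intervals exist; continuity of the measure removes the
  -- truncation.
  set B : ℕ → Set DyadicInterval := fun k => {I | c < lavg φ I ∧ -(k : ℤ) ≤ I.scale}
  have h1 : {x | c < maximal φ x} = ⋃ k, shadow (B k) := by
    rw [setOf_lt_maximal]
    ext x
    simp only [Set.mem_iUnion, mem_shadow, B, Set.mem_ofPred_eq]
    constructor
    · rintro ⟨I, hI, hx⟩
      exact ⟨(-I.scale).toNat, I, ⟨hI, by omega⟩, hx⟩
    · rintro ⟨k, I, hI, hx⟩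
      exact ⟨I, hI.1, hx⟩
  have hmono : Monotone fun k => shadow (B k) := by
    intro k l hkl x hx
    obtain ⟨J, hJ, hx⟩ := mem_shadow.1 hx
    exact mem_shadow.2 ⟨J, ⟨hJ.1, by have := hJ.2; omega⟩, hx⟩
  rw [h1, hmono.measure_iUnion, ENNReal.mul_iSup]
  refine iSup_le fun k => (weak_type (k := -k) (fun J hJ => hJ.2) fun J hJ => ?_).trans
    (setLIntegral_le_lintegral _ _)
  rw [← volume_mul_lavg, mul_comm]
  gcongr
  exact hJ.1.le

theorem maximal_le_add (φ : ℝ → ℝ≥0∞) (c : ℝ≥0∞) (x : ℝ) :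
    maximal φ x ≤ maximal ({y | c < φ y}.indicator φ) x + c := by
  refine iSup_le fun I => ?_
  by_cases hx : x ∈ I.toSet
  · rw [Set.indicator_of_mem hx]
    refine le_trans ?_ (add_le_add (lavg_le_maximal _ hx) le_rfl)
    have h1 : φ ≤ fun y => {y | c < φ y}.indicator φ y + c := by
      intro y
      by_cases hy : c < φ y
      · exact (Set.indicator_of_mem (s := {y | c < φ y}) hy φ).ge.trans le_self_add
      · exact (not_lt.1 hy).trans le_add_self
    refine (lavg_mono h1 I).trans_eq ?_
    rw [lavg, lintegral_add_right _ measurable_const, ENNReal.add_div]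
    exact congrArg _ (lavg_const c I)
  · rw [Set.indicator_of_notMem hx]; exact bot_le

/-- The part of `φ` below height `c` contributes at most `c` to the maximal function, so only the
part above `c` pays for the level `2c`. -/
theorem mul_volume_two_mul_lt_maximal_le {φ : ℝ → ℝ≥0∞} {c : ℝ≥0∞} (hc : c ≠ ∞) :
    c * volume {x | 2 * c < maximal φ x} ≤ ∫⁻ x, {y | c < φ y}.indicator φ x := by
  refine le_trans ?_ (mul_volume_lt_maximal_le _ c)
  refine mul_le_mul_right (measure_mono fun x hx => ?_) c
  simp only [Set.mem_ofPred_eq] at hx ⊢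
  have := hx.trans_le (maximal_le_add φ c x)
  rw [two_mul] at this
  exact (ENNReal.add_lt_add_iff_right hc).1 this

/-- A geometric series running down from the largest power of two below `y`. -/
theorem tsum_zpow_rpow_le {p : ℝ} (hp : 0 < p) (y : ℝ≥0∞) :
    ∑' k : ℤ, (if (2 : ℝ≥0∞) ^ k < y then ((2 : ℝ≥0∞) ^ k) ^ p else 0) ≤
      (1 - (2 : ℝ≥0∞)⁻¹ ^ p)⁻¹ * y ^ p := by
  rcases eq_or_ne y 0 with rfl | h0
  · simp
  rcases eq_or_ne y ∞ with rfl | htop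
  · rw [ENNReal.top_rpow_of_pos hp, ENNReal.mul_top]
    · exact le_top
    · simp
  obtain ⟨n, hn1, hn2⟩ := ENNReal.exists_mem_Ioc_zpow h0 htop ENNReal.one_lt_two (by simp)
  have hinj : Function.Injective fun d : ℕ => n - (d : ℤ) := by
    intro a b h; simp at h; omega
  rw [← hinj.tsum_eq]
  · calc ∑' d : ℕ, (if (2 : ℝ≥0∞) ^ (n - (d : ℤ)) < y then ((2 : ℝ≥0∞) ^ (n - (d : ℤ))) ^ p else 0)
        ≤ ∑' d : ℕ, ((2 : ℝ≥0∞)⁻¹ ^ p) ^ d * y ^ p := by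
          refine ENNReal.tsum_le_tsum fun d => ?_
          split_ifs
          · rw [ENNReal.zpow_sub two_ne_zero ENNReal.ofNat_ne_top,
              ENNReal.mul_rpow_of_nonneg _ _ hp.le, mul_comm]
            gcongr
            rw [zpow_natCast, ENNReal.inv_pow, ← ENNReal.rpow_natCast, ← ENNReal.rpow_natCast,
              ← ENNReal.rpow_mul, ← ENNReal.rpow_mul, mul_comm]
          · exact bot_le
      _ = _ := by rw [ENNReal.tsum_mul_right, ENNReal.tsum_geometric]
  · intro k hk
    simp only [Function.mem_support, ne_eq, ite_eq_right_iff, not_forall] at hk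
    have := hk.1.trans_le hn2
    have hkn : k < n + 1 := by
      by_contra h
      exact absurd this (not_lt.2 (ENNReal.zpow_le_of_le ENNReal.one_lt_two.le (not_lt.1 h)))
    exact ⟨(n - k).toNat, by simp; omega⟩

/-- When `2 ^ n < y ≤ 2 ^ (n + 1)` the single term `k = n - 1` suffices; for `y = ∞` infinitely many
terms are at least `1`. -/
theorem rpow_le_tsum_zpow {p : ℝ} (hp : 0 < p) (y : ℝ≥0∞) :
    y ^ p ≤ ∑' k : ℤ, (if 2 * (2 : ℝ≥0∞) ^ k < y then (4 * (2 : ℝ≥0∞) ^ k) ^ p else 0) := by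
  have hz : ∀ k : ℤ, 2 * (2 : ℝ≥0∞) ^ k = 2 ^ (k + 1) := fun k => by
    rw [ENNReal.zpow_add two_ne_zero ENNReal.ofNat_ne_top, zpow_one, mul_comm]
  have hz4 : ∀ k : ℤ, 4 * (2 : ℝ≥0∞) ^ k = 2 ^ (k + 1 + 1) := fun k => by
    rw [← hz, ← hz, ← mul_assoc]; norm_num
  have key : ∀ k : ℤ, 2 * (2 : ℝ≥0∞) ^ k < y → (4 * (2 : ℝ≥0∞) ^ k) ^ p ≤
      ∑' k : ℤ, (if 2 * (2 : ℝ≥0∞) ^ k < y then (4 * (2 : ℝ≥0∞) ^ k) ^ p else 0) := by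
    intro k hk
    refine le_trans ?_ (ENNReal.le_tsum k)
    rw [if_pos hk]
  rcases eq_or_ne y 0 with rfl | h0
  · simp [ENNReal.zero_rpow_of_pos hp]
  rcases eq_or_ne y ∞ with rfl | htop
  · rw [ENNReal.top_rpow_of_pos hp]
    refine (ENNReal.tsum_const_eq_top_of_ne_zero (α := ℕ) one_ne_zero).symm.le.trans ?_
    have hinj : Function.Injective fun d : ℕ => (d : ℤ) := Nat.cast_injective
    refine le_trans ?_ (ENNReal.tsum_comp_le_tsum_of_injective hinj _)
    refine ENNReal.tsum_le_tsum fun d => ?_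
    have h2 : (2 : ℝ≥0∞) * 2 ^ (d : ℤ) < ∞ := by
      rw [hz]; exact ENNReal.zpow_lt_top two_ne_zero (by simp) _
    rw [if_pos h2]
    refine ENNReal.one_le_rpow ?_ hp
    rw [zpow_natCast]
    calc (1 : ℝ≥0∞) ≤ 4 * 1 := by norm_num
      _ ≤ _ := by gcongr; exact one_le_pow₀ one_le_two
  obtain ⟨n, hn1, hn2⟩ := ENNReal.exists_mem_Ioc_zpow h0 htop ENNReal.one_lt_two (by simp)
  refine le_trans ?_ (key (n - 1) ?_)
  · rw [hz4]; gcongr; simpa using hn2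
  · rw [hz]; simpa using hn1

/-- The constant in the maximal inequality. -/
def maximalConst (p : ℝ) : ℝ≥0∞ := 4 ^ p * (1 - (2 : ℝ≥0∞)⁻¹ ^ (p - 1))⁻¹

theorem maximalConst_ne_top {p : ℝ} (hp : 1 < p) : maximalConst p ≠ ∞ := by
  refine ENNReal.mul_ne_top (ENNReal.rpow_ne_top_of_nonneg (by linarith) (by simp)) ?_
  rw [ENNReal.inv_ne_top, ← pos_iff_ne_zero, tsub_pos_iff_lt]
  exact ENNReal.rpow_lt_one (by simp) (by linarith)

/-- Marcinkiewicz interpolation over the heights `2 ^ k`: the level set of `2 · 2 ^ k` is paid for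
by `φ` above `2 ^ k`, and summing `(2 ^ k) ^ (p - 1)` over `2 ^ k < φ` gives a multiple of `φ ^ (p -
1)`, a convergent sum because `p > 1`. -/
theorem lintegral_maximal_rpow_le {φ : ℝ → ℝ≥0∞} (hφ : AEMeasurable φ volume) {p : ℝ}
    (hp : 1 < p) : ∫⁻ x, maximal φ x ^ p ≤ maximalConst p * ∫⁻ x, φ x ^ p := by
  have hp0 : 0 < p := by linarith
  have hlam : ∀ k : ℤ, (2 : ℝ≥0∞) ^ k ≠ ∞ := fun k =>
    (ENNReal.zpow_lt_top two_ne_zero (by simp) _).ne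
  have hlam0 : ∀ k : ℤ, (2 : ℝ≥0∞) ^ k ≠ 0 := fun k =>
    (ENNReal.zpow_pos two_ne_zero (by simp) _).ne'
  have hset : ∀ k : ℤ, MeasurableSet {x | 2 * (2 : ℝ≥0∞) ^ k < maximal φ x} := fun k =>
    measurableSet_lt measurable_const (measurable_maximal φ)
  calc ∫⁻ x, maximal φ x ^ p
      ≤ ∫⁻ x, ∑' k : ℤ, {x | 2 * (2 : ℝ≥0∞) ^ k < maximal φ x}.indicator
          (fun _ => (4 * (2 : ℝ≥0∞) ^ k) ^ p) x :=
        lintegral_mono fun x => by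
          refine (rpow_le_tsum_zpow hp0 _).trans_eq ?_
          simp [Set.indicator_apply]
    _ = ∑' k : ℤ, (4 * (2 : ℝ≥0∞) ^ k) ^ p * volume {x | 2 * (2 : ℝ≥0∞) ^ k < maximal φ x} := by
        rw [lintegral_tsum fun k => (measurable_const.indicator (hset k)).aemeasurable]
        exact tsum_congr fun k => lintegral_indicator_const (hset k) _
    _ ≤ ∑' k : ℤ, ∫⁻ x, 4 ^ p * ({y | (2 : ℝ≥0∞) ^ k < φ y}.indicator φ x *
          ((2 : ℝ≥0∞) ^ k) ^ (p - 1)) := by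
        refine ENNReal.tsum_le_tsum fun k => ?_
        rw [lintegral_const_mul' _ _ (ENNReal.rpow_ne_top_of_nonneg hp0.le (by simp)),
          lintegral_mul_const' _ _ (ENNReal.rpow_ne_top_of_nonneg (by linarith) (hlam k)),
          ENNReal.mul_rpow_of_nonneg _ _ hp0.le, mul_assoc]
        refine mul_le_mul_right ?_ _
        have : ((2 : ℝ≥0∞) ^ k) ^ p = ((2 : ℝ≥0∞) ^ k) ^ (p - 1) * (2 : ℝ≥0∞) ^ k := by
          conv_rhs => rw [← ENNReal.rpow_one ((2 : ℝ≥0∞) ^ k), ← ENNReal.rpow_mul, one_mul]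
          rw [← ENNReal.rpow_add _ _ (hlam0 k) (hlam k)]
          congr 1; ring
        rw [this, mul_assoc, mul_comm]
        exact mul_le_mul_left (mul_volume_two_mul_lt_maximal_le (hlam k)) _
    _ = ∫⁻ x, ∑' k : ℤ, 4 ^ p * ({y | (2 : ℝ≥0∞) ^ k < φ y}.indicator φ x *
          ((2 : ℝ≥0∞) ^ k) ^ (p - 1)) := by
        rw [lintegral_tsum]
        intro k
        refine ((hφ.indicator₀ ?_).mul_const _).const_mul _
        exact nullMeasurableSet_lt aemeasurable_const hφ
    _ ≤ ∫⁻ x, maximalConst p * φ x ^ p := by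
        refine lintegral_mono fun x => ?_
        simp only
        rw [ENNReal.tsum_mul_left, maximalConst, mul_assoc]
        gcongr
        have h1 : ∀ k : ℤ, {y | (2 : ℝ≥0∞) ^ k < φ y}.indicator φ x *
            ((2 : ℝ≥0∞) ^ k) ^ (p - 1) =
            φ x * (if (2 : ℝ≥0∞) ^ k < φ x then ((2 : ℝ≥0∞) ^ k) ^ (p - 1) else 0) := by
          intro k
          by_cases h : (2 : ℝ≥0∞) ^ k < φ x <;> simp [h]
        simp_rw [h1]
        rw [ENNReal.tsum_mul_left]
        refine (mul_le_mul_right (tsum_zpow_rpow_le (by linarith) _) _).trans_eq ?_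
        rw [mul_left_comm]
        congr 1
        rcases eq_or_ne (φ x) ∞ with h | h
        · rw [h, ENNReal.top_rpow_of_pos hp0, ENNReal.top_rpow_of_pos (by linarith)]; simp
        rcases eq_or_ne (φ x) 0 with h0 | h0
        · rw [h0, ENNReal.zero_rpow_of_pos hp0]; simp
        conv_lhs => rw [← ENNReal.rpow_one (φ x), ← ENNReal.rpow_mul, one_mul]
        rw [← ENNReal.rpow_add _ _ h0 h]
        congr 1; ring
    _ = _ := lintegral_const_mul' _ _ (maximalConst_ne_top hp)

/-- The `L^s` average of a nonnegative function. -/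
def smean (s : ℝ) (φ : ℝ → ℝ≥0∞) (I : DyadicInterval) : ℝ≥0∞ :=
  lavg (fun x => φ x ^ s) I ^ (1 / s)

/-- The dyadic maximal function with `L^s` averages. -/
def smaximal (s : ℝ) (φ : ℝ → ℝ≥0∞) (x : ℝ) : ℝ≥0∞ :=
  maximal (fun x => φ x ^ s) x ^ (1 / s)

theorem measurable_smaximal (s : ℝ) (φ : ℝ → ℝ≥0∞) : Measurable (smaximal s φ) :=
  (measurable_maximal _).pow_const _

theorem smean_le_smaximal {s : ℝ} (hs : 0 < s) (φ : ℝ → ℝ≥0∞) {I : DyadicInterval} {x : ℝ}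
    (hx : x ∈ I.toSet) : smean s φ I ≤ smaximal s φ x :=
  ENNReal.rpow_le_rpow (lavg_le_maximal _ hx) (by positivity)

/-- The maximal theorem applied to `φ ^ s` with exponent `p / s > 1`. -/
theorem lintegral_smaximal_rpow_le {φ : ℝ → ℝ≥0∞} (hφ : AEMeasurable φ volume) {s p : ℝ}
    (hs : 0 < s) (hp : s < p) :
    ∫⁻ x, smaximal s φ x ^ p ≤ maximalConst (p / s) * ∫⁻ x, φ x ^ p := by
  have := lintegral_maximal_rpow_le (hφ.pow_const s) ((one_lt_div hs).2 hp)
  simp_rw [← ENNReal.rpow_mul, mul_div_cancel₀ p hs.ne'] at this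
  simp_rw [smaximal, ← ENNReal.rpow_mul]
  rwa [one_div, ← div_eq_inv_mul]

theorem lavg_le_smean {s : ℝ} (hs : 1 ≤ s) {φ : ℝ → ℝ≥0∞} (hφ : AEMeasurable φ volume)
    (I : DyadicInterval) : lavg φ I ≤ smean s φ I := by
  rcases hs.eq_or_lt with rfl | hs
  · simp [smean]
  have hs0 : 0 < s := by linarith
  have hpq := Real.HolderConjugate.conjExponent hs
  have h := ENNReal.lintegral_mul_le_Lp_mul_Lq (volume.restrict I.toSet) hpq hφ.restrict
    (aemeasurable_const (b := (1 : ℝ≥0∞)))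
  simp only [Pi.mul_apply, mul_one, ENNReal.one_rpow, lintegral_const,
    Measure.restrict_apply_univ, one_mul] at h
  rw [lavg_le_iff, smean, lavg, ENNReal.div_rpow_of_nonneg _ _ (by positivity)]
  refine h.trans_eq ?_
  rw [ENNReal.div_eq_inv_mul, mul_comm (_⁻¹), mul_assoc]
  congr 1
  have h1 : (1 : ℝ) / s.conjExponent = 1 - 1 / s := by
    have := hpq.inv_add_inv_eq_one
    rw [one_div, one_div]; linarith
  rw [h1, ENNReal.rpow_sub _ _ I.volume_ne_zero I.volume_ne_top, ENNReal.rpow_one,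
    ENNReal.div_eq_inv_mul]

/-! ### Multilinear forms -/

/-- `a` is bounded by `C c(Q)` below `Q`, off a set of measure at most `|Q| / N`. -/
def SupControlled (N C : ℝ≥0∞) (a c : DyadicInterval → ℝ≥0∞) : Prop :=
  ∀ Q : DyadicInterval, ∃ B : Set DyadicInterval, (∀ J ∈ B, J.toSet ⊆ Q.toSet) ∧
    volume (shadow B) ≤ volume Q.toSet / N ∧
    ∀ I : DyadicInterval, I.toSet ⊆ Q.toSet → (∀ J ∈ B, ¬ I.toSet ⊆ J.toSet) → a I ≤ C * c Q

/-- The square function of `a` is bounded in `L²` by `C c(Q)` below `Q`, off a set of measure at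
most `|Q| / N`. -/
def SqControlled (N C : ℝ≥0∞) (a c : DyadicInterval → ℝ≥0∞) : Prop :=
  ∀ Q : DyadicInterval, ∃ B : Set DyadicInterval, (∀ J ∈ B, J.toSet ⊆ Q.toSet) ∧
    volume (shadow B) ≤ volume Q.toSet / N ∧
    ∀ t : Finset DyadicInterval,
      (∀ I ∈ t, I.toSet ⊆ Q.toSet ∧ ∀ J ∈ B, ¬ I.toSet ⊆ J.toSet) →
        ∑ I ∈ t, volume I.toSet * a I ^ 2 ≤ volume Q.toSet * (C * c Q) ^ 2

/-- Cauchy–Schwarz, with half of the weight given to each factor. -/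
theorem sum_mul_mul_le {ι : Type*} (t : Finset ι) {w a b : ι → ℝ≥0∞} {W A B : ℝ≥0∞}
    (ha : ∑ i ∈ t, w i * a i ^ 2 ≤ W * A ^ 2) (hb : ∑ i ∈ t, w i * b i ^ 2 ≤ W * B ^ 2) :
    ∑ i ∈ t, w i * (a i * b i) ≤ W * (A * B) := by
  have hsq : ∀ x : ℝ≥0∞, x ^ (1 / 2 : ℝ) * x ^ (1 / 2 : ℝ) = x := fun x => by
    rw [← ENNReal.rpow_add_of_nonneg _ _ (by norm_num) (by norm_num)]; norm_num
  have hcs := ENNReal.inner_le_Lp_mul_Lq t (fun i => w i ^ (1 / 2 : ℝ) * a i)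
    (fun i => w i ^ (1 / 2 : ℝ) * b i) (p := 2) (q := 2) (Real.HolderConjugate.two_two)
  have e : ∀ x y : ℝ≥0∞, (x ^ (1 / 2 : ℝ) * y) ^ (2 : ℝ) = x * y ^ 2 := fun x y => by
    rw [ENNReal.rpow_two, mul_pow, sq (x ^ (1 / 2 : ℝ)), hsq]
  simp_rw [e] at hcs
  have e2 : ∀ x y : ℝ≥0∞, (x * y ^ 2) ^ (1 / 2 : ℝ) = x ^ (1 / 2 : ℝ) * y := fun x y => by
    rw [ENNReal.mul_rpow_of_nonneg _ _ (by norm_num), ← ENNReal.rpow_natCast, ← ENNReal.rpow_mul]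
    norm_num
  calc ∑ i ∈ t, w i * (a i * b i)
      = ∑ i ∈ t, w i ^ (1 / 2 : ℝ) * a i * (w i ^ (1 / 2 : ℝ) * b i) :=
        Finset.sum_congr rfl fun i _ => by rw [mul_mul_mul_comm, hsq]
    _ ≤ _ := hcs
    _ ≤ (W * A ^ 2) ^ (1 / 2 : ℝ) * (W * B ^ 2) ^ (1 / 2 : ℝ) := by gcongr
    _ = W * (A * B) := by rw [e2, e2, mul_mul_mul_comm, hsq]

/-- The core estimate. Each slot brings its own stopping family of measure at most `|Q| / (2 card
ι)`, so their union stays below `|Q| / 2`; on the unstopped intervals Cauchy–Schwarz handles slots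
`k` and `l`, and the others come out as constants. -/
theorem tsum_volume_mul_prod_le {ι : Type*} [Fintype ι] {a c : ι → DyadicInterval → ℝ≥0∞}
    {M : ι → ℝ → ℝ≥0∞} {C : ℝ≥0∞} {k l : ι} (hkl : k ≠ l)
    (hk : SqControlled (2 * Fintype.card ι) C (a k) (c k))
    (hl : SqControlled (2 * Fintype.card ι) C (a l) (c l))
    (hsup : ∀ j, j ≠ k → j ≠ l → SupControlled (2 * Fintype.card ι) C (a j) (c j))
    (hM : ∀ j, ∀ Q : DyadicInterval, ∀ x ∈ Q.toSet, c j Q ≤ M j x) :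
    ∑' I : DyadicInterval, volume I.toSet * ∏ j, a j I ≤
      2 * C ^ Fintype.card ι * ∫⁻ x, ∏ j, M j x := by
  classical
  refine tsum_le_of_stoppingBound fun Q => ?_
  have hex : ∀ j, ∃ B : Set DyadicInterval, (∀ J ∈ B, J.toSet ⊆ Q.toSet) ∧
      volume (shadow B) ≤ volume Q.toSet / (2 * Fintype.card ι) ∧
      (j ≠ k → j ≠ l → ∀ I : DyadicInterval, I.toSet ⊆ Q.toSet →
        (∀ J ∈ B, ¬ I.toSet ⊆ J.toSet) → a j I ≤ C * c j Q) ∧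
      (j = k ∨ j = l → ∀ t : Finset DyadicInterval,
        (∀ I ∈ t, I.toSet ⊆ Q.toSet ∧ ∀ J ∈ B, ¬ I.toSet ⊆ J.toSet) →
          ∑ I ∈ t, volume I.toSet * a j I ^ 2 ≤ volume Q.toSet * (C * c j Q) ^ 2) := by
    intro j
    by_cases h : j = k ∨ j = l
    · have hj : SqControlled (2 * Fintype.card ι) C (a j) (c j) := by
        rcases h with rfl | rfl
        · exact hk
        · exact hl
      obtain ⟨B, h1, h2, h3⟩ := hj Q
      exact ⟨B, h1, h2, fun h4 h5 => absurd h (by tauto), fun _ => h3⟩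
    · push Not at h
      obtain ⟨B, h1, h2, h3⟩ := hsup j h.1 h.2 Q
      exact ⟨B, h1, h2, fun _ _ => h3, fun h4 => absurd h4 (by tauto)⟩
  choose B hBQ hBv hBsup hBsq using hex
  refine ⟨⋃ j, B j, ?_, ?_, ∏ j, c j Q, ?_, ?_⟩
  · intro J hJ
    obtain ⟨j, hj⟩ := Set.mem_iUnion.1 hJ
    exact hBQ j J hj
  · have h1 : shadow (⋃ j, B j) = ⋃ j, shadow (B j) := by
      ext x; simp only [mem_shadow, Set.mem_iUnion]; tauto
    rw [h1]
    refine (measure_iUnion_fintype_le _ _).trans ((Finset.sum_le_sum fun j _ => hBv j).trans_eq ?_)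
    have hcard : (Fintype.card ι : ℝ≥0∞) ≠ 0 := by
      have : Nonempty ι := ⟨k⟩
      simp
    rw [Finset.sum_const, Finset.card_univ, nsmul_eq_mul, ENNReal.div_eq_inv_mul,
      ENNReal.mul_inv (by simp) (by simp), ← mul_assoc, mul_left_comm,
      ENNReal.mul_inv_cancel hcard (by simp), mul_one, ENNReal.div_eq_inv_mul]
  · intro x hx
    exact Finset.prod_le_prod' fun j _ => hM j Q x hx
  · intro t ht
    have hns : ∀ j, ∀ I ∈ t, I.toSet ⊆ Q.toSet ∧ ∀ J ∈ B j, ¬ I.toSet ⊆ J.toSet :=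
      fun j I hI => ⟨(ht I hI).1, fun J hJ => (ht I hI).2 J (Set.mem_iUnion.2 ⟨j, hJ⟩)⟩
    have hlmem : l ∈ Finset.univ.erase k := by simp [hkl.symm]
    have hsplit : ∀ f : ι → ℝ≥0∞,
        ∏ j, f j = f k * f l * ∏ j ∈ (Finset.univ.erase k).erase l, f j := fun f => by
      rw [← Finset.mul_prod_erase _ _ (Finset.mem_univ k), ← Finset.mul_prod_erase _ _ hlmem,
        mul_assoc]
    have hE : ∀ I ∈ t, ∏ j ∈ (Finset.univ.erase k).erase l, a j I ≤
        ∏ j ∈ (Finset.univ.erase k).erase l, C * c j Q := by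
      intro I hI
      refine Finset.prod_le_prod' fun j hj => ?_
      simp only [Finset.mem_erase, Finset.mem_univ, and_true] at hj
      exact hBsup j hj.2 hj.1 I (hns j I hI).1 (hns j I hI).2
    calc ∑ I ∈ t, volume I.toSet * ∏ j, a j I
        ≤ ∑ I ∈ t, volume I.toSet * (a k I * a l I) *
            ∏ j ∈ (Finset.univ.erase k).erase l, C * c j Q := by
          refine Finset.sum_le_sum fun I hI => ?_
          rw [hsplit, ← mul_assoc]
          exact mul_le_mul_right (hE I hI) _
      _ ≤ volume Q.toSet * (C * c k Q * (C * c l Q)) *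
            ∏ j ∈ (Finset.univ.erase k).erase l, C * c j Q := by
          rw [← Finset.sum_mul]
          gcongr
          exact sum_mul_mul_le t (hBsq k (Or.inl rfl) t (hns k)) (hBsq l (Or.inr rfl) t (hns l))
      _ = C ^ Fintype.card ι * (volume Q.toSet * ∏ j, c j Q) := by
          rw [mul_assoc, ← hsplit fun j => C * c j Q, Finset.prod_mul_distrib, Finset.prod_const,
            Finset.card_univ, mul_left_comm]

theorem lintegral_prod_smaximal_le {ι : Type*} [Fintype ι] {s : ℝ} (hs : 0 < s) {p : ι → ℝ}
    (hp : ∀ j, s < p j) (hsum : ∑ j, 1 / p j = 1) {φ : ι → ℝ → ℝ≥0∞}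
    (hφ : ∀ j, AEMeasurable (φ j) volume) :
    ∫⁻ x, ∏ j, smaximal s (φ j) x ≤
      (∏ j, maximalConst (p j / s) ^ (1 / p j)) * ∏ j, (∫⁻ x, φ j x ^ p j) ^ (1 / p j) := by
  have hp0 : ∀ j, 0 < p j := fun j => hs.trans (hp j)
  calc ∫⁻ x, ∏ j, smaximal s (φ j) x
      = ∫⁻ x, ∏ j, (smaximal s (φ j) x ^ p j) ^ (1 / p j) := by
        refine lintegral_congr fun x => Finset.prod_congr rfl fun j _ => ?_
        rw [← ENNReal.rpow_mul, mul_one_div_cancel (hp0 j).ne', ENNReal.rpow_one]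
    _ ≤ ∏ j, (∫⁻ x, smaximal s (φ j) x ^ p j) ^ (1 / p j) :=
        ENNReal.lintegral_prod_norm_pow_le Finset.univ
          (fun j _ => ((measurable_smaximal s (φ j)).pow_const _).aemeasurable) hsum
          fun j _ => by have := hp0 j; positivity
    _ ≤ ∏ j, maximalConst (p j / s) ^ (1 / p j) * (∫⁻ x, φ j x ^ p j) ^ (1 / p j) := by
        refine Finset.prod_le_prod' fun j _ => ?_
        rw [← ENNReal.mul_rpow_of_nonneg _ _ (by have := hp0 j; positivity)]
        exact ENNReal.rpow_le_rpow (lintegral_smaximal_rpow_le (hφ j) hs (hp j))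
          (by have := hp0 j; positivity)
    _ = _ := Finset.prod_mul_distrib

end

section

variable {𝕜 : Type*} [RCLike 𝕜]

/-! ### Normalised coefficients -/

/-- The function `1_{I₊} - 1_{I₋}`. -/
def sgn (I : DyadicInterval) (x : ℝ) : ℝ :=
  I.rightHalf.indicator (fun _ => (1 : ℝ)) x - I.leftHalf.indicator (fun _ => (1 : ℝ)) x

theorem haar_eq (I : DyadicInterval) (x : ℝ) : I.haar x = (Real.sqrt I.length)⁻¹ * I.sgn x := rfl

theorem sgn_of_mem_lchild {I : DyadicInterval} {x : ℝ} (hx : x ∈ I.lchild.toSet) :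
    I.sgn x = -1 := by
  have h := Set.disjoint_left.1 I.disjoint_children hx
  rw [toSet_rchild] at h
  rw [toSet_lchild] at hx
  simp [sgn, hx, h]

theorem sgn_of_mem_rchild {I : DyadicInterval} {x : ℝ} (hx : x ∈ I.rchild.toSet) :
    I.sgn x = 1 := by
  have h := Set.disjoint_right.1 I.disjoint_children hx
  rw [toSet_lchild] at h
  rw [toSet_rchild] at hx
  simp [sgn, hx, h]

theorem sgn_of_notMem {I : DyadicInterval} {x : ℝ} (hx : x ∉ I.toSet) : I.sgn x = 0 := by
  have h1 : x ∉ I.leftHalf := fun h => hx (I.lchild_subset (I.toSet_lchild ▸ h))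
  have h2 : x ∉ I.rightHalf := fun h => hx (I.rchild_subset (I.toSet_rchild ▸ h))
  simp [sgn, h1, h2]

theorem mem_child {I : DyadicInterval} {x : ℝ} (hx : x ∈ I.toSet) :
    x ∈ I.lchild.toSet ∨ x ∈ I.rchild.toSet := by rwa [toSet_eq_union] at hx

theorem sgn_sq_of_mem {I : DyadicInterval} {x : ℝ} (hx : x ∈ I.toSet) : I.sgn x ^ 2 = 1 := by
  rcases mem_child hx with h | h
  · rw [sgn_of_mem_lchild h]; norm_num
  · rw [sgn_of_mem_rchild h]; norm_num

theorem abs_sgn_of_mem {I : DyadicInterval} {x : ℝ} (hx : x ∈ I.toSet) : |I.sgn x| = 1 := by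
  rcases mem_child hx with h | h
  · rw [sgn_of_mem_lchild h]; norm_num
  · rw [sgn_of_mem_rchild h]; norm_num

theorem abs_sgn_le (I : DyadicInterval) (x : ℝ) : |I.sgn x| ≤ 1 := by
  by_cases hx : x ∈ I.toSet
  · exact (abs_sgn_of_mem hx).le
  · simp [sgn_of_notMem hx]

theorem measurable_sgn (I : DyadicInterval) : Measurable I.sgn :=
  (measurable_const.indicator measurableSet_Ico).sub (measurable_const.indicator measurableSet_Ico)

/-- The coefficients `f(I, a)` normalised so that they are averages of `± f`. -/
def ncoef (f : ℝ → 𝕜) (I : DyadicInterval) (a : Fin 2) : 𝕜 :=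
  if a = 0 then dyadicAverage (fun x => f x * (I.sgn x : 𝕜)) I else dyadicAverage f I

theorem ncoef_zero (f : ℝ → 𝕜) (I : DyadicInterval) :
    ncoef f I 0 = dyadicAverage (fun x => f x * (I.sgn x : 𝕜)) I := if_pos rfl

theorem ncoef_one (f : ℝ → 𝕜) (I : DyadicInterval) : ncoef f I 1 = dyadicAverage f I :=
  if_neg (by decide)

theorem length_smul_dyadicAverage (f : ℝ → 𝕜) (I : DyadicInterval) :
    I.length • dyadicAverage f I = ∫ x in I.toSet, f x := by
  rw [dyadicAverage, smul_smul, mul_inv_cancel₀ I.length_pos.ne', one_smul]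

theorem integral_mul_sgn (f : ℝ → 𝕜) (I : DyadicInterval) :
    ∫ x, f x * (I.sgn x : 𝕜) = I.length • ncoef f I 0 := by
  rw [ncoef_zero, length_smul_dyadicAverage]
  refine (setIntegral_eq_integral_of_forall_compl_eq_zero fun x hx => ?_).symm
  simp [sgn_of_notMem hx]

theorem dyadicCoeff_eq (f : ℝ → 𝕜) (I : DyadicInterval) (a : Fin 2) :
    dyadicCoeff f I a = (if a = 0 then (Real.sqrt I.length : 𝕜) else 1) * ncoef f I a := by
  by_cases h : a = 0
  · subst h
    rw [dyadicCoeff, if_pos rfl, if_pos rfl, haarCoeff]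
    have h1 : ∀ x, f x * (I.haar x : 𝕜) =
        ((Real.sqrt I.length)⁻¹ : ℝ) • (f x * (I.sgn x : 𝕜)) := fun x => by
      rw [haar_eq, RCLike.real_smul_eq_coe_mul]; push_cast; ring
    simp_rw [h1]
    rw [integral_smul, integral_mul_sgn, smul_smul, RCLike.real_smul_eq_coe_mul]
    congr 2
    have := Real.sqrt_pos.2 I.length_pos
    rw [inv_mul_eq_div, Real.div_sqrt]
  · have : a = 1 := by omega
    subst this
    simp [dyadicCoeff, ncoef]

/-- Each of the `σ(α)` Haar coefficients has a factor `√|I|`, which cancels the normalisation of one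
factor of `h_I ^ σ(α)`. -/
theorem paraproductTerm_eq {m : ℕ} (α : Fin m → Fin 2) (f : Fin m → ℝ → 𝕜) (I : DyadicInterval)
    (x : ℝ) : paraproductTerm α f I x =
      (∏ j, ncoef (f j) I (α j)) * (I.sgn x : 𝕜) ^ sigma0 α := by
  rw [paraproductTerm]
  simp_rw [dyadicCoeff_eq]
  rw [Finset.prod_mul_distrib, haar_eq, Finset.prod_ite, Finset.prod_const, Finset.prod_const_one,
    mul_one]
  have h0 : (Real.sqrt I.length : 𝕜) ≠ 0 := by
    exact_mod_cast (Real.sqrt_pos.2 I.length_pos).ne'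
  change (Real.sqrt I.length : 𝕜) ^ sigma0 α * _ * _ = _
  push_cast
  rw [mul_pow, inv_pow]
  field_simp

theorem _root_.MeasureTheory.LocallyIntegrable.mul_sgn {f : ℝ → 𝕜}
    (hf : LocallyIntegrable f volume) (I : DyadicInterval) :
    LocallyIntegrable (fun x => f x * (I.sgn x : 𝕜)) volume := by
  refine hf.mono ?_ (Eventually.of_forall fun x => ?_)
  · exact hf.aestronglyMeasurable.mul
      (RCLike.continuous_ofReal.measurable.comp I.measurable_sgn).aestronglyMeasurable
  · rw [norm_mul, RCLike.norm_ofReal]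
    exact mul_le_of_le_one_right (norm_nonneg _) (I.abs_sgn_le x)

theorem ncoef_enorm_le (f : ℝ → 𝕜) (I : DyadicInterval) (a : Fin 2) :
    ‖ncoef f I a‖ₑ ≤ lavg (fun x => ‖f x‖ₑ) I := by
  rw [ncoef]
  split_ifs
  · refine (dyadicAverage_enorm_le _ I).trans (lavg_mono (fun x => ?_) I)
    rw [enorm_le_iff_norm_le, norm_mul, RCLike.norm_ofReal]
    exact mul_le_of_le_one_right (norm_nonneg _) (I.abs_sgn_le x)
  · exact dyadicAverage_enorm_le _ I

theorem dyadicAverage_sub {f g : ℝ → 𝕜} (hf : LocallyIntegrable f volume)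
    (hg : LocallyIntegrable g volume) (I : DyadicInterval) :
    dyadicAverage (fun x => f x - g x) I = dyadicAverage f I - dyadicAverage g I := by
  rw [dyadicAverage, integral_sub (hf.integrableOn_toSet I) (hg.integrableOn_toSet I), smul_sub]
  rfl

theorem dyadicAverage_const_mul (c : 𝕜) (f : ℝ → 𝕜) (I : DyadicInterval) :
    dyadicAverage (fun x => c * f x) I = c * dyadicAverage f I := by
  rw [dyadicAverage, integral_const_mul, dyadicAverage, mul_smul_comm]

theorem dyadicAverage_const (c : 𝕜) (I : DyadicInterval) :
    dyadicAverage (fun _ => c) I = c := by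
  rw [dyadicAverage, setIntegral_const, Measure.real, volume_toSet,
    ENNReal.toReal_ofReal I.length_pos.le, smul_smul, inv_mul_cancel₀ I.length_pos.ne', one_smul]

theorem ncoef_sub {f g : ℝ → 𝕜} (hf : LocallyIntegrable f volume)
    (hg : LocallyIntegrable g volume) (I : DyadicInterval) (a : Fin 2) :
    ncoef (fun x => f x - g x) I a = ncoef f I a - ncoef g I a := by
  simp only [ncoef, sub_mul]
  split_ifs
  · exact dyadicAverage_sub (hf.mul_sgn I) (hg.mul_sgn I) I
  · exact dyadicAverage_sub hf hg I

theorem ncoef_const_mul (c : 𝕜) (f : ℝ → 𝕜) (I : DyadicInterval) (a : Fin 2) :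
    ncoef (fun x => c * f x) I a = c * ncoef f I a := by
  simp only [ncoef, mul_assoc]
  split_ifs <;> exact dyadicAverage_const_mul c _ I

theorem dyadicAverage_congr {f g : ℝ → 𝕜} {I : DyadicInterval} (h : ∀ x ∈ I.toSet, f x = g x) :
    dyadicAverage f I = dyadicAverage g I := by
  rw [dyadicAverage, dyadicAverage, setIntegral_congr_fun I.measurableSet_toSet h]

theorem ncoef_congr {f g : ℝ → 𝕜} {I : DyadicInterval} (h : ∀ x ∈ I.toSet, f x = g x)
    (a : Fin 2) : ncoef f I a = ncoef g I a := by
  simp only [ncoef]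
  split_ifs
  · exact dyadicAverage_congr fun x hx => by rw [h x hx]
  · exact dyadicAverage_congr h

theorem integral_toSet_eq_add {f : ℝ → 𝕜} (hf : LocallyIntegrable f volume) (I : DyadicInterval) :
    ∫ x in I.toSet, f x = (∫ x in I.lchild.toSet, f x) + ∫ x in I.rchild.toSet, f x := by
  rw [toSet_eq_union I, setIntegral_union I.disjoint_children (measurableSet_toSet _)
    (hf.integrableOn_toSet _) (hf.integrableOn_toSet _)]

theorem dyadicAverage_eq_children {f : ℝ → 𝕜} (hf : LocallyIntegrable f volume)
    (I : DyadicInterval) :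
    dyadicAverage f I = (2 : ℝ)⁻¹ • (dyadicAverage f I.rchild + dyadicAverage f I.lchild) := by
  have hl := length_of_scale_eq I.scale_lchild
  have hr := length_of_scale_eq I.scale_rchild
  rw [dyadicAverage, dyadicAverage, dyadicAverage, hl, hr, integral_toSet_eq_add hf, ← smul_add,
    smul_smul, add_comm]
  congr 1
  field_simp

theorem ncoef_zero_eq_children {f : ℝ → 𝕜} (hf : LocallyIntegrable f volume)
    (I : DyadicInterval) :
    ncoef f I 0 = (2 : ℝ)⁻¹ • (dyadicAverage f I.rchild - dyadicAverage f I.lchild) := by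
  rw [ncoef_zero, dyadicAverage_eq_children (hf.mul_sgn I), sub_eq_add_neg]
  congr 2
  · exact dyadicAverage_congr fun x hx => by simp [sgn_of_mem_rchild hx]
  · rw [← neg_one_mul, ← dyadicAverage_const_mul]
    exact dyadicAverage_congr fun x hx => by simp [sgn_of_mem_lchild hx]

/-- The parallelogram law for the two child averages: a one-step Pythagorean identity that
telescopes down the tree. -/
theorem length_mul_sq_ncoef_add {f : ℝ → 𝕜} (hf : LocallyIntegrable f volume)
    (I : DyadicInterval) :
    I.length * ‖ncoef f I 0‖ ^ 2 + I.length * ‖dyadicAverage f I‖ ^ 2 =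
      I.lchild.length * ‖dyadicAverage f I.lchild‖ ^ 2 +
        I.rchild.length * ‖dyadicAverage f I.rchild‖ ^ 2 := by
  have hp := parallelogram_law_with_norm 𝕜 (dyadicAverage f I.rchild) (dyadicAverage f I.lchild)
  rw [ncoef_zero_eq_children hf, dyadicAverage_eq_children hf I,
    length_of_scale_eq I.scale_lchild, length_of_scale_eq I.scale_rchild, norm_smul, norm_smul,
    Real.norm_of_nonneg (by norm_num)]
  linear_combination (I.length / 4) * hp

/-! ### Square sums below a stopping rule -/

/-- A localised Bessel inequality, obtained by iterating the identity for one interval and its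
children. The branch ends inside a stopping interval, where `t` has no members; keeping the term
`|Q| |⟨f⟩_Q|²` on the left makes the induction close. -/
theorem sum_sq_ncoef_le {f : ℝ → 𝕜} (hf : LocallyIntegrable f volume) {R : DyadicInterval}
    {B : Set DyadicInterval} {c : ℝ}
    (hc : ∀ I : DyadicInterval, I.toSet ⊆ R.toSet → (∀ J ∈ B, ¬ I.toSet ⊆ J.toSet) →
      ‖dyadicAverage f I.lchild‖ ≤ c ∧ ‖dyadicAverage f I.rchild‖ ≤ c) (n : ℕ) :
    ∀ (Q : DyadicInterval) (t : Finset DyadicInterval), Q.toSet ⊆ R.toSet →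
      (∀ I ∈ t, I.toSet ⊆ Q.toSet ∧ I.scale < Q.scale + n ∧ ∀ J ∈ B, ¬ I.toSet ⊆ J.toSet) →
      ‖dyadicAverage f Q‖ ≤ c →
      ∑ I ∈ t, I.length * ‖ncoef f I 0‖ ^ 2 + Q.length * ‖dyadicAverage f Q‖ ^ 2 ≤
        Q.length * c ^ 2 := by
  classical
  have hempty : ∀ Q : DyadicInterval, ‖dyadicAverage f Q‖ ≤ c →
      ∑ I ∈ (∅ : Finset DyadicInterval), I.length * ‖ncoef f I 0‖ ^ 2 +
        Q.length * ‖dyadicAverage f Q‖ ^ 2 ≤ Q.length * c ^ 2 := by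
    intro Q hQ
    rw [Finset.sum_empty, zero_add]
    have := Q.length_pos
    gcongr
  induction n with
  | zero =>
    intro Q t _ ht hQc
    have : t = ∅ := Finset.eq_empty_of_forall_notMem fun I hI => by
      have := ht I hI
      have := scale_le_of_subset this.1
      simp at *; omega
    rw [this]
    exact hempty Q hQc
  | succ n ih =>
    intro Q t hQR ht hQc
    by_cases hQB : ∀ J ∈ B, ¬ Q.toSet ⊆ J.toSet
    · obtain ⟨hl, hr⟩ := hc Q hQR hQB
      have h1 := ih Q.lchild (t.filter fun I => I.toSet ⊆ Q.lchild.toSet)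
        (Q.lchild_subset.trans hQR) (fun I hI => by
          rw [Finset.mem_filter] at hI
          have := ht I hI.1
          refine ⟨hI.2, ?_, this.2.2⟩
          have := this.2.1
          push_cast at this
          simp only [scale_lchild]; omega) hl
      have h2 := ih Q.rchild (t.filter fun I => I.toSet ⊆ Q.rchild.toSet)
        (Q.rchild_subset.trans hQR) (fun I hI => by
          rw [Finset.mem_filter] at hI
          have := ht I hI.1
          refine ⟨hI.2, ?_, this.2.2⟩
          have := this.2.1
          push_cast at this
          simp only [scale_rchild]; omega) hr
      have h3 : ∑ I ∈ t, I.length * ‖ncoef f I 0‖ ^ 2 ≤ Q.length * ‖ncoef f Q 0‖ ^ 2 +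
          (∑ I ∈ t.filter (fun I => I.toSet ⊆ Q.lchild.toSet), I.length * ‖ncoef f I 0‖ ^ 2 +
            ∑ I ∈ t.filter (fun I => I.toSet ⊆ Q.rchild.toSet), I.length * ‖ncoef f I 0‖ ^ 2) := by
        have hsub : t ⊆ insert Q (t.filter (fun I => I.toSet ⊆ Q.lchild.toSet) ∪
            t.filter (fun I => I.toSet ⊆ Q.rchild.toSet)) := by
          intro I hI
          rw [Finset.mem_insert, Finset.mem_union, Finset.mem_filter, Finset.mem_filter]
          by_cases h : I = Q
          · exact Or.inl h
          · rcases subset_child (ht I hI).1 h with h | h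
            · exact Or.inr (Or.inl ⟨hI, h⟩)
            · exact Or.inr (Or.inr ⟨hI, h⟩)
        have hpos : ∀ I : DyadicInterval, 0 ≤ I.length * ‖ncoef f I 0‖ ^ 2 := fun I => by
          have := I.length_pos; positivity
        refine (Finset.sum_le_sum_of_subset_of_nonneg hsub fun I _ _ => hpos I).trans ?_
        have hu : ∑ I ∈ t.filter (fun I => I.toSet ⊆ Q.lchild.toSet) ∪
            t.filter (fun I => I.toSet ⊆ Q.rchild.toSet), I.length * ‖ncoef f I 0‖ ^ 2 ≤
            ∑ I ∈ t.filter (fun I => I.toSet ⊆ Q.lchild.toSet), I.length * ‖ncoef f I 0‖ ^ 2 +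
            ∑ I ∈ t.filter (fun I => I.toSet ⊆ Q.rchild.toSet), I.length * ‖ncoef f I 0‖ ^ 2 := by
          rw [← Finset.sum_union_inter]
          exact le_add_of_nonneg_right (Finset.sum_nonneg fun I _ => hpos I)
        by_cases hQ : Q ∈ t.filter (fun I => I.toSet ⊆ Q.lchild.toSet) ∪
            t.filter (fun I => I.toSet ⊆ Q.rchild.toSet)
        · rw [Finset.insert_eq_of_mem hQ]
          exact hu.trans (le_add_of_nonneg_left (hpos Q))
        · rw [Finset.sum_insert hQ]
          gcongr
      have h4 := length_mul_sq_ncoef_add hf Q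
      have h5 : Q.lchild.length * c ^ 2 + Q.rchild.length * c ^ 2 = Q.length * c ^ 2 := by
        rw [length_of_scale_eq Q.scale_lchild, length_of_scale_eq Q.scale_rchild]; ring
      linarith
    · push Not at hQB
      obtain ⟨J, hJ, hQJ⟩ := hQB
      have : t = ∅ := Finset.eq_empty_of_forall_notMem fun I hI =>
        (ht I hI).2.2 J hJ ((ht I hI).1.trans hQJ)
      rw [this]
      exact hempty Q hQc

theorem sum_sq_enorm_ncoef_le {f : ℝ → 𝕜} (hf : LocallyIntegrable f volume) {Q : DyadicInterval}
    {B : Set DyadicInterval} {c : ℝ≥0∞}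
    (hc : ∀ I, I.toSet ⊆ Q.toSet → (∀ J ∈ B, ¬ I.toSet ⊆ J.toSet) →
      lavg (fun x => ‖f x‖ₑ) I ≤ c) {t : Finset DyadicInterval}
    (ht : ∀ I ∈ t, I.toSet ⊆ Q.toSet ∧ ∀ J ∈ B, ¬ I.toSet ⊆ J.toSet) :
    ∑ I ∈ t, volume I.toSet * ‖ncoef f I 0‖ₑ ^ 2 ≤ volume Q.toSet * (2 * c) ^ 2 := by
  -- A member of `t` shows that `Q` lies in no stopping interval, so the average over `Q` is
  -- controlled too.
  rcases t.eq_empty_or_nonempty with rfl | ⟨I₀, hI₀⟩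
  · simp
  rcases eq_or_ne c ∞ with rfl | hctop
  · simp [ENNReal.mul_top, Q.volume_ne_zero]
  lift c to ℝ≥0 using hctop
  have hQB : ∀ J ∈ B, ¬ Q.toSet ⊆ J.toSet := fun J hJ h =>
    (ht I₀ hI₀).2 J hJ ((ht I₀ hI₀).1.trans h)
  have hnorm : ∀ I : DyadicInterval, lavg (fun x => ‖f x‖ₑ) I ≤ 2 * c →
      ‖dyadicAverage f I‖ ≤ 2 * (c : ℝ) := by
    intro I hI
    have := (dyadicAverage_enorm_le f I).trans hI
    rw [enorm_eq_nnnorm] at this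
    exact_mod_cast this
  obtain ⟨n, hn⟩ : ∃ n : ℕ, ∀ I ∈ t, I.scale < Q.scale + n := by
    have : ∀ᶠ n : ℕ in atTop, ∀ I ∈ t, I.scale < Q.scale + n := by
      refine (Filter.eventually_all_finset t).2 fun I _ => ?_
      filter_upwards [eventually_gt_atTop (I.scale - Q.scale).toNat] with n hn
      omega
    exact this.exists
  -- The level is doubled because a child may be stopped while its parent is not, and passing to a
  -- child at most doubles an average.
  have h := sum_sq_ncoef_le hf (R := Q) (B := B) (c := 2 * (c : ℝ)) (fun I hIQ hIB =>
    ⟨hnorm _ ((lavg_le_two_mul I.scale_lchild I.lchild_subset).trans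
      (mul_le_mul_right (hc I hIQ hIB) 2)),
    hnorm _ ((lavg_le_two_mul I.scale_rchild I.rchild_subset).trans
      (mul_le_mul_right (hc I hIQ hIB) 2))⟩) n Q t le_rfl
    (fun I hI => ⟨(ht I hI).1, hn I hI, (ht I hI).2⟩)
    (hnorm _ ((hc Q le_rfl hQB).trans (by rw [two_mul]; exact le_self_add)))
  have h' : ∑ I ∈ t, I.length * ‖ncoef f I 0‖ ^ 2 ≤ Q.length * (2 * (c : ℝ)) ^ 2 := by
    refine le_trans (le_add_of_nonneg_right ?_) h
    have := Q.length_pos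
    positivity
  have h'' := ENNReal.ofReal_le_ofReal h'
  rw [ENNReal.ofReal_sum_of_nonneg (fun I _ => by have := I.length_pos; positivity),
    ENNReal.ofReal_mul Q.length_pos.le] at h''
  refine le_trans (Finset.sum_le_sum fun I _ => ?_) (h''.trans_eq ?_)
  · rw [ENNReal.ofReal_mul I.length_pos.le, volume_toSet, ENNReal.ofReal_pow (norm_nonneg _),
      ofReal_norm]
  · rw [volume_toSet, ENNReal.ofReal_pow (by positivity), ENNReal.ofReal_mul (by norm_num)]
    simp

/-- Stop where the average of `φ ^ s` exceeds `N` times its average on `Q`; the loss `N ^ (1 / s)`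
is at most `N` since `s ≥ 1`. -/
theorem SupControlled.of_le_smean {a : DyadicInterval → ℝ≥0∞} {φ : ℝ → ℝ≥0∞} {s : ℝ}
    (hs : 1 ≤ s) {K N : ℝ≥0∞} (hN : 1 ≤ N) (hN' : N ≠ ∞) (h : ∀ I, a I ≤ K * smean s φ I) :
    SupControlled N (N * K) a (smean s φ) := by
  have hs0 : 0 < s := by linarith
  intro Q
  refine ⟨{J | J.toSet ⊆ Q.toSet ∧ N * lavg (fun x => φ x ^ s) Q < lavg (fun x => φ x ^ s) J},
    fun J hJ => hJ.1, volume_shadow_le_of_lavg (one_pos.trans_le hN).ne' hN' le_rfl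
      (fun J hJ => hJ.1) fun J hJ => hJ.2, fun I hIQ hI => (h I).trans ?_⟩
  rw [mul_comm N, mul_assoc]
  gcongr
  have h1 : lavg (fun x => φ x ^ s) I ≤ N * lavg (fun x => φ x ^ s) Q := by
    by_contra hlt
    exact hI I ⟨hIQ, not_le.1 hlt⟩ le_rfl
  calc smean s φ I ≤ (N * lavg (fun x => φ x ^ s) Q) ^ (1 / s) :=
        ENNReal.rpow_le_rpow h1 (by positivity)
    _ = N ^ (1 / s) * smean s φ Q := ENNReal.mul_rpow_of_nonneg _ _ (by positivity)
    _ ≤ N ^ (1 : ℝ) * smean s φ Q := by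
        gcongr
        rw [div_le_one hs0]; exact hs
    _ = _ := by rw [ENNReal.rpow_one]

theorem sqControlled_ncoef {f : ℝ → 𝕜} (hf : LocallyIntegrable f volume) {s : ℝ} (hs : 1 ≤ s)
    {N : ℝ≥0∞} (hN : 1 ≤ N) (hN' : N ≠ ∞) :
    SqControlled N (2 * N) (fun I => ‖ncoef f I 0‖ₑ) (smean s fun x => ‖f x‖ₑ) := by
  intro Q
  refine ⟨{J | J.toSet ⊆ Q.toSet ∧ N * smean s (fun x => ‖f x‖ₑ) Q < lavg (fun x => ‖f x‖ₑ) J},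
    fun J hJ => hJ.1, volume_shadow_le_of_lavg (one_pos.trans_le hN).ne' hN'
      (lavg_le_smean hs hf.aestronglyMeasurable.enorm Q) (fun J hJ => hJ.1) fun J hJ => hJ.2,
    fun t ht => ?_⟩
  rw [mul_assoc]
  refine sum_sq_enorm_ncoef_le hf (fun I hIQ hI => ?_) ht
  by_contra hlt
  exact hI I ⟨hIQ, not_le.1 hlt⟩ le_rfl

/-! ### Coefficients of `(b - ⟨b⟩_I) f` -/

theorem locallyIntegrable_sub_const {b : ℝ → 𝕜} (hb : LocallyIntegrable b volume) (c : 𝕜) :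
    LocallyIntegrable (fun x => b x - c) volume :=
  hb.sub (locallyIntegrable_const c)

theorem locallyIntegrable_sub_const_mul {b f : ℝ → 𝕜} (hf : LocallyIntegrable f volume)
    (hbf : LocallyIntegrable (fun x => b x * f x) volume) (c : 𝕜) :
    LocallyIntegrable (fun x => (b x - c) * f x) volume := by
  simp_rw [sub_mul]
  exact hbf.sub (hf.smul c)

theorem dyadicAverage_sub_enorm_le {b : ℝ → 𝕜} (hb : LocallyIntegrable b volume)
    (I : DyadicInterval) (c : 𝕜) :
    ‖dyadicAverage b I - c‖ₑ ≤ lavg (fun x => ‖b x - c‖ₑ) I := by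
  rw [← dyadicAverage_const c I, ← dyadicAverage_sub hb (locallyIntegrable_const c),
    dyadicAverage_const c I]
  exact dyadicAverage_enorm_le _ I

theorem supControlled_ncoef_sub_mul {b f : ℝ → 𝕜} {s : ℝ} (hs : 1 ≤ s) {K N : ℝ≥0∞}
    (hN : 1 ≤ N) (hN' : N ≠ ∞)
    (hbf : ∀ I, lavg (fun x => ‖(b x - dyadicAverage b I) * f x‖ₑ) I ≤
      K * smean s (fun x => ‖f x‖ₑ) I) (a : Fin 2) :
    SupControlled N (N * K) (fun I => ‖ncoef (fun x => (b x - dyadicAverage b I) * f x) I a‖ₑ)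
      (smean s fun x => ‖f x‖ₑ) :=
  SupControlled.of_le_smean hs hN hN' fun I => (ncoef_enorm_le _ I a).trans (hbf I)

/-- The subtracted average varies with `I`, so Bessel does not apply directly. Below `Q` write `b -
⟨b⟩_I = (b - ⟨b⟩_Q) - (⟨b⟩_I - ⟨b⟩_Q)`: the first part gives the fixed function `F`, the second a
bounded multiple of the Haar coefficient of `f`. Large averages of `F`, of `f` and of `b - ⟨b⟩_Q`
are stopped, each with threshold factor `3N`, so that together they cover at most `|Q| / N`. -/
theorem sqControlled_ncoef_sub_mul {b f : ℝ → 𝕜} (hb : LocallyIntegrable b volume)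
    (hf : LocallyIntegrable f volume) (hbf' : LocallyIntegrable (fun x => b x * f x) volume)
    {s : ℝ} (hs : 1 ≤ s) {K L N : ℝ≥0∞} (hN : 1 ≤ N) (hN' : N ≠ ∞)
    (hbK : ∀ I, lavg (fun x => ‖b x - dyadicAverage b I‖ₑ) I ≤ L)
    (hbf : ∀ I, lavg (fun x => ‖(b x - dyadicAverage b I) * f x‖ₑ) I ≤
      K * smean s (fun x => ‖f x‖ₑ) I) :
    SqControlled N (2 * (2 * (3 * N * K) + 3 * N * L * (2 * (3 * N))))
      (fun I => ‖ncoef (fun x => (b x - dyadicAverage b I) * f x) I 0‖ₑ)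
      (smean s fun x => ‖f x‖ₑ) := by
  intro Q
  set c := smean s (fun x => ‖f x‖ₑ) Q with hcdef
  set F : ℝ → 𝕜 := fun x => (b x - dyadicAverage b Q) * f x with hF
  have hFloc : LocallyIntegrable F volume := locallyIntegrable_sub_const_mul hf hbf' _
  have hN3 : (3 * N : ℝ≥0∞) ≠ ∞ := ENNReal.mul_ne_top (by simp) hN'
  have hN30 : (3 * N : ℝ≥0∞) ≠ 0 := mul_ne_zero (by simp) (one_pos.trans_le hN).ne'
  set B : Set DyadicInterval := {J | J.toSet ⊆ Q.toSet ∧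
    (3 * N * (K * c) < lavg (fun x => ‖F x‖ₑ) J)} with hB
  set B' : Set DyadicInterval := {J | J.toSet ⊆ Q.toSet ∧
    (3 * N * c < lavg (fun x => ‖f x‖ₑ) J)} with hB'
  set B'' : Set DyadicInterval := {J | J.toSet ⊆ Q.toSet ∧
    (3 * N * L < lavg (fun x => ‖b x - dyadicAverage b Q‖ₑ) J)} with hB''
  have hv : volume (shadow B) ≤ volume Q.toSet / (3 * N) :=
    volume_shadow_le_of_lavg hN30 hN3 (hbf Q) (fun J hJ => hJ.1) fun J hJ => hJ.2
  have hv' : volume (shadow B') ≤ volume Q.toSet / (3 * N) :=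
    volume_shadow_le_of_lavg hN30 hN3 (lavg_le_smean hs hf.aestronglyMeasurable.enorm Q)
      (fun J hJ => hJ.1) fun J hJ => hJ.2
  have hv'' : volume (shadow B'') ≤ volume Q.toSet / (3 * N) :=
    volume_shadow_le_of_lavg hN30 hN3 (hbK Q) (fun J hJ => hJ.1) fun J hJ => hJ.2
  refine ⟨B ∪ B' ∪ B'', ?_, ?_, fun t ht => ?_⟩
  · rintro J ((hJ | hJ) | hJ) <;> exact hJ.1
  · have h1 : shadow (B ∪ B' ∪ B'') = shadow B ∪ shadow B' ∪ shadow B'' := by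
      simp only [shadow, Set.biUnion_union]
    rw [h1]
    refine (measure_union_le _ _).trans ((add_le_add ((measure_union_le _ _).trans
      (add_le_add hv hv')) hv'').trans_eq ?_)
    rw [ENNReal.div_eq_inv_mul, ENNReal.mul_inv (by simp) (by simp), ENNReal.div_eq_inv_mul]
    have h3 : (3 : ℝ≥0∞) * 3⁻¹ = 1 := ENNReal.mul_inv_cancel (by simp) (by simp)
    calc _ = (3 * 3⁻¹) * (N⁻¹ * volume Q.toSet) := by ring
      _ = _ := by rw [h3, one_mul]
  · have hF1 := sum_sq_enorm_ncoef_le hFloc (Q := Q) (B := B ∪ B' ∪ B'') (c := 3 * N * (K * c))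
      (fun I hIQ hI => by
        by_contra hlt
        exact hI I (Or.inl (Or.inl ⟨hIQ, not_le.1 hlt⟩)) le_rfl) ht
    have hf1 := sum_sq_enorm_ncoef_le hf (Q := Q) (B := B ∪ B' ∪ B'') (c := 3 * N * c)
      (fun I hIQ hI => by
        by_contra hlt
        exact hI I (Or.inl (Or.inr ⟨hIQ, not_le.1 hlt⟩)) le_rfl) ht
    have hsq : ∀ x y : ℝ≥0∞, (x + y) ^ 2 ≤ 4 * (x ^ 2 + y ^ 2) := by
      intro x y
      rcases le_total x y with h | h
      · calc (x + y) ^ 2 ≤ (y + y) ^ 2 := by gcongr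
          _ = 4 * y ^ 2 := by ring
          _ ≤ _ := by gcongr; exact le_add_self
      · calc (x + y) ^ 2 ≤ (x + x) ^ 2 := by gcongr
          _ = 4 * x ^ 2 := by ring
          _ ≤ _ := by gcongr; exact le_self_add
    have hterm : ∀ I ∈ t, volume I.toSet *
        ‖ncoef (fun x => (b x - dyadicAverage b I) * f x) I 0‖ₑ ^ 2 ≤
        4 * (volume I.toSet * ‖ncoef F I 0‖ₑ ^ 2 +
          (3 * N * L) ^ 2 * (volume I.toSet * ‖ncoef f I 0‖ₑ ^ 2)) := by
      intro I hI
      have e1 : ncoef (fun x => (b x - dyadicAverage b I) * f x) I 0 =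
          ncoef F I 0 - (dyadicAverage b I - dyadicAverage b Q) * ncoef f I 0 := by
        rw [← ncoef_const_mul, ← ncoef_sub hFloc (g := fun x => (dyadicAverage b I - dyadicAverage b Q) * f x)
            (hf.smul (dyadicAverage b I - dyadicAverage b Q))]
        congr 1
        ext x
        simp only [hF]; ring
      have e2 : ‖dyadicAverage b I - dyadicAverage b Q‖ₑ ≤ 3 * N * L := by
        refine (dyadicAverage_sub_enorm_le hb I _).trans ?_
        by_contra hlt
        exact (ht I hI).2 I (Or.inr ⟨(ht I hI).1, not_le.1 hlt⟩) le_rfl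
      have e3 : ‖ncoef (fun x => (b x - dyadicAverage b I) * f x) I 0‖ₑ ≤
          ‖ncoef F I 0‖ₑ + 3 * N * L * ‖ncoef f I 0‖ₑ := by
        rw [e1]
        refine enorm_sub_le.trans (add_le_add le_rfl ?_)
        rw [enorm_mul]
        gcongr
      calc _ ≤ volume I.toSet * (4 * (‖ncoef F I 0‖ₑ ^ 2 + (3 * N * L * ‖ncoef f I 0‖ₑ) ^ 2)) := by
            gcongr
            exact (pow_le_pow_left' e3 2).trans (hsq _ _)
        _ = _ := by ring
    calc _ ≤ ∑ I ∈ t, 4 * (volume I.toSet * ‖ncoef F I 0‖ₑ ^ 2 +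
          (3 * N * L) ^ 2 * (volume I.toSet * ‖ncoef f I 0‖ₑ ^ 2)) := Finset.sum_le_sum hterm
      _ = 4 * (∑ I ∈ t, volume I.toSet * ‖ncoef F I 0‖ₑ ^ 2 +
          (3 * N * L) ^ 2 * ∑ I ∈ t, volume I.toSet * ‖ncoef f I 0‖ₑ ^ 2) := by
          rw [← Finset.mul_sum, Finset.sum_add_distrib, Finset.mul_sum]
      _ ≤ 4 * (volume Q.toSet * (2 * (3 * N * (K * c))) ^ 2 +
          (3 * N * L) ^ 2 * (volume Q.toSet * (2 * (3 * N * c)) ^ 2)) := by gcongr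
      _ = volume Q.toSet * ((2 * c) ^ 2 *
          ((2 * (3 * N * K)) ^ 2 + (3 * N * L * (2 * (3 * N))) ^ 2)) := by ring
      _ ≤ volume Q.toSet * ((2 * c) ^ 2 *
          (2 * (3 * N * K) + 3 * N * L * (2 * (3 * N))) ^ 2) := by
          gcongr
          rw [add_sq]
          calc _ ≤ _ + 2 * (2 * (3 * N * K)) * (3 * N * L * (2 * (3 * N))) := le_self_add
            _ = _ := by ring
      _ = _ := by ring

end

section

variable {𝕜 : Type*} [RCLike 𝕜]

/-! ### The John–Nirenberg inequality -/

theorem parent_subset {P Q : DyadicInterval} (h : P.toSet ⊆ Q.toSet) (hne : P ≠ Q) :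
    P.parent.toSet ⊆ Q.toSet := by
  obtain ⟨x, hx⟩ := P.toSet_nonempty
  refine subset_of_mem (P.subset_parent hx) (h hx) ?_
  have h1 : Q.scale < P.scale := by
    by_contra hle
    exact hne (eq_of_subset h (not_lt.1 hle))
  have := P.scale_parent
  omega

/-- Hence a maximal stopping interval overshoots the stopping level by at most a factor of two. -/
theorem parent_notMem_of_mem_tops {B : Set DyadicInterval} {P : DyadicInterval}
    (hP : P ∈ tops B) : P.parent ∉ B := by
  intro h
  have h1 := congrArg scale (hP.2 _ h P.subset_parent)
  have := P.scale_parent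
  omega

/-- Calderón–Zygmund iteration. Stop where the average of `|b - ⟨b⟩_Q|` exceeds `2K`: at most half
of `Q` is stopped, and off it `|b - ⟨b⟩_Q| ≤ 2K` almost everywhere. On a maximal stopping interval
`⟨b⟩` has moved by at most `4K`, so passing there uses up one multiple of `4K` and gains a factor
`1/2` in measure. -/
theorem volume_setOf_lt_le {b : ℝ → 𝕜} (hb : LocallyIntegrable b volume) {K : ℝ≥0∞}
    (hK : K ≠ ∞)
    (hbK : ∀ I, lavg (fun x => ‖b x - dyadicAverage b I‖ₑ) I ≤ K) (n : ℕ) :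
    ∀ Q : DyadicInterval, volume {x | x ∈ Q.toSet ∧ n * (4 * K) < ‖b x - dyadicAverage b Q‖ₑ} ≤
      2⁻¹ ^ n * volume Q.toSet := by
  induction n with
  | zero =>
    intro Q
    rw [pow_zero, one_mul]
    exact measure_mono fun x hx => hx.1
  | succ n ih =>
    intro Q
    set f : ℝ → 𝕜 := fun x => b x - dyadicAverage b Q with hf
    have hfloc : LocallyIntegrable f volume := locallyIntegrable_sub_const hb _
    set B : Set DyadicInterval := {J | J.toSet ⊆ Q.toSet ∧ 2 * K < lavg (fun x => ‖f x‖ₑ) J}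
    have hBs : ∀ J ∈ B, Q.scale ≤ J.scale := fun J hJ => scale_le_of_subset hJ.1
    have hv : volume (shadow B) ≤ volume Q.toSet / 2 :=
      volume_shadow_le_of_lavg two_ne_zero ENNReal.ofNat_ne_top (hbK Q) (fun J hJ => hJ.1)
        fun J hJ => hJ.2
    have hQB := ne_of_volume_shadow_le hv
    have hoff : ∀ᵐ x, x ∈ Q.toSet \ shadow B → ‖f x‖ₑ ≤ 2 * K := by
      refine ae_enorm_le_of_lavg_le hfloc fun x hx => ⟨Q.scale, fun I hI hxI => ?_⟩
      by_contra hlt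
      exact hx.2 (mem_shadow.2 ⟨I, ⟨subset_of_mem hxI hx.1 hI, not_le.1 hlt⟩, hxI⟩)
    have hK4 : (4 * K : ℝ≥0∞) ≠ ∞ := ENNReal.mul_ne_top (by simp) hK
    have htop : ∀ P ∈ tops B, ‖dyadicAverage b P - dyadicAverage b Q‖ₑ ≤ 4 * K := by
      intro P hP
      refine (dyadicAverage_sub_enorm_le hb P _).trans
        ((lavg_le_two_mul P.scale_parent P.subset_parent).trans ?_)
      have hne : P ≠ Q := fun h => hQB (h ▸ hP.1)
      have h1 : lavg (fun x => ‖f x‖ₑ) P.parent ≤ 2 * K := by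
        by_contra hlt
        exact parent_notMem_of_mem_tops hP ⟨parent_subset hP.1.1 hne, not_le.1 hlt⟩
      calc _ ≤ 2 * (2 * K) := mul_le_mul_right h1 2
        _ = 4 * K := by ring
    have hsub :
        {x | x ∈ Q.toSet ∧ ((n + 1 : ℕ) : ℝ≥0∞) * (4 * K) < ‖b x - dyadicAverage b Q‖ₑ} ≤ᵐ[volume]
        ⋃ P ∈ tops B, {x | x ∈ P.toSet ∧ n * (4 * K) < ‖b x - dyadicAverage b P‖ₑ} := by
      filter_upwards [hoff] with x hx
      rintro ⟨hxQ, hlt⟩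
      by_cases hxs : x ∈ shadow B
      · rw [shadow_eq_biUnion_tops hBs] at hxs
        obtain ⟨P, hP, hxP⟩ := Set.mem_iUnion₂.1 hxs
        refine Set.mem_iUnion₂.2 ⟨P, hP, hxP, ?_⟩
        have h1 : ‖b x - dyadicAverage b Q‖ₑ ≤ ‖b x - dyadicAverage b P‖ₑ + 4 * K := by
          calc _ = ‖(b x - dyadicAverage b P) + (dyadicAverage b P - dyadicAverage b Q)‖ₑ := by
                congr 1; ring
            _ ≤ _ := (enorm_add_le _ _).trans (add_le_add le_rfl (htop P hP))
        have h2 := hlt.trans_le h1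
        rw [Nat.cast_add, Nat.cast_one, add_mul, one_mul] at h2
        exact (ENNReal.add_lt_add_iff_right hK4).1 h2
      · exfalso
        have h1 := hlt.trans_le (hx ⟨hxQ, hxs⟩)
        refine absurd h1 (not_lt.2 ?_)
        rw [Nat.cast_add, Nat.cast_one, add_mul, one_mul]
        calc 2 * K ≤ 4 * K := by gcongr; norm_num
          _ ≤ _ := le_add_self
    calc _ ≤ _ := measure_mono_ae hsub
      _ ≤ ∑' P : tops B, volume {x | x ∈ P.1.toSet ∧ n * (4 * K) < ‖b x - dyadicAverage b P.1‖ₑ} :=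
          measure_biUnion_le volume (tops B).to_countable _
      _ ≤ ∑' P : tops B, 2⁻¹ ^ n * volume P.1.toSet := ENNReal.tsum_le_tsum fun P => ih P.1
      _ = 2⁻¹ ^ n * volume (shadow B) := by rw [ENNReal.tsum_mul_left, volume_shadow hBs]
      _ ≤ 2⁻¹ ^ n * (volume Q.toSet / 2) := by gcongr
      _ = _ := by rw [pow_succ, ENNReal.div_eq_inv_mul, mul_assoc]

/-- The constant in the John–Nirenberg inequality. -/
def jnConst (K : ℝ≥0∞) (t : ℕ) : ℝ≥0∞ := ∑' n : ℕ, ((n + 1 : ℕ) * (4 * K)) ^ t * 2⁻¹ ^ n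

theorem jnConst_ne_top {K : ℝ≥0∞} (hK : K ≠ ∞) (t : ℕ) : jnConst K t ≠ ∞ := by
  lift K to ℝ≥0 using hK
  have h1 : ∀ n : ℕ, (((n + 1 : ℕ) : ℝ≥0∞) * (4 * K)) ^ t * 2⁻¹ ^ n =
      ((((n + 1 : ℕ) * (4 * K)) ^ t * 2⁻¹ ^ n : ℝ≥0) : ℝ≥0∞) := by
    intro n
    push_cast
    simp
  rw [jnConst]
  simp_rw [h1]
  rw [ENNReal.tsum_coe_ne_top_iff_summable, ← NNReal.summable_coe]
  have h2 := summable_pow_mul_geometric_of_norm_lt_one t (r := (2⁻¹ : ℝ))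
    (by rw [Real.norm_of_nonneg] <;> norm_num)
  have h3 := ((summable_nat_add_iff 1).2 h2).mul_left (2 * (4 * (K : ℝ)) ^ t)
  refine h3.congr fun n => ?_
  push_cast
  rw [pow_succ (2⁻¹ : ℝ), mul_pow _ (4 * (K : ℝ))]
  ring

/-- The term with `n L < y ≤ (n + 1) L` is enough. -/
theorem pow_le_tsum_indicator {L y : ℝ≥0∞} (hL : L ≠ 0) (hy : y ≠ ∞) {t : ℕ} (ht : t ≠ 0) :
    y ^ t ≤ ∑' n : ℕ, (if n * L < y then ((n + 1 : ℕ) * L) ^ t else 0) := by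
  classical
  rcases eq_or_ne y 0 with rfl | hy0
  · simp [ht]
  have hex : ∃ n : ℕ, y ≤ (n + 1 : ℕ) * L := by
    obtain ⟨n, hn⟩ := ENNReal.exists_nat_mul_gt hL hy
    refine ⟨n, hn.le.trans ?_⟩
    gcongr
    omega
  have hlt : (Nat.find hex) * L < y := by
    rcases Nat.eq_zero_or_eq_succ_pred (Nat.find hex) with h | h
    · rw [h]; simpa using hy0.bot_lt
    · have := Nat.find_min hex (m := (Nat.find hex).pred) (by omega)
      rw [not_le] at this
      rw [h]
      exact this
  refine le_trans ?_ (ENNReal.le_tsum (Nat.find hex))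
  rw [if_pos hlt]
  exact pow_le_pow_left' (Nat.find_spec hex) t

theorem lintegral_pow_le_jnConst {b : ℝ → 𝕜} (hb : LocallyIntegrable b volume) {K : ℝ≥0∞}
    (hK0 : K ≠ 0) (hK : K ≠ ∞)
    (hbK : ∀ I, lavg (fun x => ‖b x - dyadicAverage b I‖ₑ) I ≤ K) {t : ℕ} (ht : t ≠ 0)
    (Q : DyadicInterval) :
    ∫⁻ x in Q.toSet, ‖b x - dyadicAverage b Q‖ₑ ^ t ≤ jnConst K t * volume Q.toSet := by
  have hm : AEMeasurable (fun x => ‖b x - dyadicAverage b Q‖ₑ) volume :=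
    (hb.aestronglyMeasurable.sub aestronglyMeasurable_const).enorm
  have hnull : ∀ n : ℕ, NullMeasurableSet {x | (n : ℝ≥0∞) * (4 * K) < ‖b x - dyadicAverage b Q‖ₑ}
      (volume.restrict Q.toSet) := fun n =>
    (nullMeasurableSet_lt aemeasurable_const hm).mono_ac Measure.absolutelyContinuous_restrict
  calc ∫⁻ x in Q.toSet, ‖b x - dyadicAverage b Q‖ₑ ^ t
      ≤ ∫⁻ x in Q.toSet, ∑' n : ℕ, {x | (n : ℝ≥0∞) * (4 * K) < ‖b x - dyadicAverage b Q‖ₑ}.indicator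
          (fun _ => (((n + 1 : ℕ) : ℝ≥0∞) * (4 * K)) ^ t) x := by
        refine lintegral_mono fun x => (pow_le_tsum_indicator (L := 4 * K)
          (mul_ne_zero (by simp) hK0) enorm_ne_top ht).trans_eq ?_
        simp [Set.indicator_apply]
    _ = ∑' n : ℕ, (((n + 1 : ℕ) : ℝ≥0∞) * (4 * K)) ^ t *
          (volume.restrict Q.toSet) {x | (n : ℝ≥0∞) * (4 * K) < ‖b x - dyadicAverage b Q‖ₑ} := by
        rw [lintegral_tsum fun n => aemeasurable_const.indicator₀ (hnull n)]
        exact tsum_congr fun n => lintegral_indicator_const₀ (hnull n) _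
    _ ≤ ∑' n : ℕ, (((n + 1 : ℕ) : ℝ≥0∞) * (4 * K)) ^ t * (2⁻¹ ^ n * volume Q.toSet) := by
        refine ENNReal.tsum_le_tsum fun n => mul_le_mul_right ?_ _
        rw [Measure.restrict_apply' Q.measurableSet_toSet]
        refine (measure_mono fun x hx => ?_).trans (volume_setOf_lt_le hb hK hbK n Q)
        exact ⟨hx.2, hx.1⟩
    _ = _ := by
        rw [jnConst, ← ENNReal.tsum_mul_right]
        exact tsum_congr fun n => (mul_assoc _ _ _).symm

/-- Hölder's inequality for averages. -/
theorem lavg_mul_le_smean_mul {p q : ℝ} (hpq : p.HolderConjugate q) {φ ψ : ℝ → ℝ≥0∞}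
    (hφ : AEMeasurable φ volume) (hψ : AEMeasurable ψ volume) (I : DyadicInterval) :
    lavg (fun x => φ x * ψ x) I ≤ smean p φ I * smean q ψ I := by
  have h := ENNReal.lintegral_mul_le_Lp_mul_Lq (volume.restrict I.toSet) hpq hφ.restrict
    hψ.restrict
  have hp := hpq.pos
  have hq := hpq.symm.pos
  rw [lavg_le_iff, smean, lavg, smean, lavg, ENNReal.div_rpow_of_nonneg _ _ (by positivity),
    ENNReal.div_rpow_of_nonneg _ _ (by positivity)]
  refine h.trans_eq ?_
  have h1 : volume I.toSet = volume I.toSet ^ (1 / p) * volume I.toSet ^ (1 / q) := by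
    rw [← ENNReal.rpow_add_of_nonneg _ _ (by positivity) (by positivity), one_div, one_div,
      hpq.inv_add_inv_eq_one, ENNReal.rpow_one]
  have h2 : ∀ r : ℝ, volume I.toSet ^ r ≠ 0 := fun r =>
    (ENNReal.rpow_pos I.volume_ne_zero.bot_lt I.volume_ne_top).ne'
  have h3 : ∀ r : ℝ, 0 ≤ r → volume I.toSet ^ r ≠ ∞ := fun r hr =>
    ENNReal.rpow_ne_top_of_nonneg hr I.volume_ne_top
  have key : ∀ a b u v w : ℝ≥0∞, u ≠ 0 → u ≠ ∞ → v ≠ 0 → v ≠ ∞ → w = u * v →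
      a * b = a / u * (b / v) * w := by
    rintro a b u v w hu hu' hv hv' rfl
    rw [mul_mul_mul_comm, ENNReal.div_mul_cancel hu hu', ENNReal.div_mul_cancel hv hv']
  exact key _ _ _ _ _ (h2 _) (h3 _ (by positivity)) (h2 _) (h3 _ (by positivity)) h1

/-- Hölder with John–Nirenberg: multiplication by `b - ⟨b⟩_I` costs only the passage from averages
to `L^s` means. -/
theorem lavg_sub_mul_le {b f : ℝ → 𝕜} (hb : LocallyIntegrable b volume)
    (hf : AEStronglyMeasurable f volume) {K : ℝ≥0∞} (hK0 : K ≠ 0) (hK : K ≠ ∞)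
    (hbK : ∀ I, lavg (fun x => ‖b x - dyadicAverage b I‖ₑ) I ≤ K) {t : ℕ} {s : ℝ}
    (hts : (t : ℝ).HolderConjugate s) (I : DyadicInterval) :
    lavg (fun x => ‖(b x - dyadicAverage b I) * f x‖ₑ) I ≤
      jnConst K t ^ (1 / (t : ℝ)) * smean s (fun x => ‖f x‖ₑ) I := by
  have h1 := lavg_mul_le_smean_mul hts
    (hb.aestronglyMeasurable.sub (aestronglyMeasurable_const (b := dyadicAverage b I))).enorm
    hf.enorm I
  simp_rw [enorm_mul]
  refine h1.trans ?_
  gcongr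
  refine ENNReal.rpow_le_rpow ?_ (by positivity)
  rw [lavg_le_iff]
  simp only [Pi.sub_apply, ENNReal.rpow_natCast]
  exact lintegral_pow_le_jnConst hb hK0 hK hbK (by have := hts.pos; norm_cast at this; omega) I

/-- A function of bounded dyadic mean oscillation in `L^q` belongs to `L^t` for `t ≥ q`. -/
theorem memLp_of_memLp_of_oscillation {b : ℝ → 𝕜} {q : ℝ} (hq : 1 ≤ q)
    (hbq : MemLp b (ENNReal.ofReal q) volume) {K : ℝ≥0∞} (hK0 : K ≠ 0) (hK : K ≠ ∞)
    (hbK : ∀ I, lavg (fun x => ‖b x - dyadicAverage b I‖ₑ) I ≤ K) {t : ℕ} (ht : q ≤ t) :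
    MemLp b t volume := by
  have hq0 : 0 < q := by linarith
  have ht0 : t ≠ 0 := by rintro rfl; simp at ht; linarith
  have hb : LocallyIntegrable b volume :=
    hbq.locallyIntegrable (by rw [← ENNReal.ofReal_one]; exact ENNReal.ofReal_le_ofReal hq)
  have hfin : ∫⁻ x, ‖b x‖ₑ ^ q < ∞ := by
    have := lintegral_rpow_enorm_lt_top_of_eLpNorm_lt_top (by simpa using hq0) (by simp) hbq.2
    rwa [ENNReal.toReal_ofReal hq0.le] at this
  set φ : ℝ → ℝ≥0∞ := fun x => ‖b x‖ₑ ^ q with hφ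
  -- Calderón–Zygmund decomposition of `|b| ^ q` at height `1`. Off the shadow `|b| ≤ 1`, so `|b| ^
  -- t ≤ |b| ^ q`; on the maximal intervals the average of `b` is at most `2` and John–Nirenberg
  -- controls the rest.
  set B : Set DyadicInterval := {J | 1 < lavg φ J}
  have hvol : ∀ J ∈ B, volume J.toSet ≤ ∫⁻ x, φ x := by
    intro J hJ
    have : 1 * volume J.toSet ≤ lavg φ J * volume J.toSet := by gcongr; exact le_of_lt hJ
    rw [one_mul, mul_comm, volume_mul_lavg] at this
    exact this.trans (setLIntegral_le_lintegral _ _)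
  -- Members of `B` have length at most `∫ |b| ^ q < ∞`, so maximal ones exist.
  obtain ⟨k, hk⟩ : ∃ k : ℤ, ∀ J ∈ B, k ≤ J.scale := by
    have hev : ∀ᶠ n : ℕ in atTop, (∫⁻ x, φ x).toReal < (2 : ℝ) ^ n :=
      (tendsto_pow_atTop_atTop_of_one_lt one_lt_two).eventually_gt_atTop _
    obtain ⟨n, hn⟩ := hev.exists
    refine ⟨-n, fun J hJ => ?_⟩
    by_contra hlt
    have h1 : (2 : ℝ) ^ n ≤ J.length := by
      rw [length, ← zpow_natCast]
      exact zpow_le_zpow_right₀ one_le_two (by omega)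
    have h2 : J.length ≤ (∫⁻ x, φ x).toReal := by
      rw [← ENNReal.ofReal_le_iff_le_toReal hfin.ne, ← volume_toSet]
      exact hvol J hJ
    linarith
  have hvs : volume (shadow B) ≤ ∫⁻ x, φ x := by
    have := weak_type (B := B) (φ := φ) (c := 1) hk fun J hJ => by
      rw [← volume_mul_lavg, mul_comm]
      exact mul_le_mul_right (le_of_lt hJ) _
    rw [one_mul] at this
    exact this.trans (setLIntegral_le_lintegral _ _)
  have hoff : ∀ᵐ x, x ∈ (shadow B)ᶜ → ‖b x‖ₑ ≤ 1 := by
    refine ae_enorm_le_of_lavg_le hb fun x hx => ⟨0, fun I _ hxI => ?_⟩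
    have h1 : lavg φ I ≤ 1 := by
      by_contra hlt
      exact hx (mem_shadow.2 ⟨I, not_le.1 hlt, hxI⟩)
    refine (lavg_le_smean hq hb.aestronglyMeasurable.enorm I).trans ?_
    exact (ENNReal.rpow_le_rpow h1 (by positivity)).trans_eq (ENNReal.one_rpow _)
  have htop : ∀ P : tops B, ∫⁻ x in P.1.toSet, ‖b x‖ₑ ^ t ≤
      2 ^ t * (jnConst K t + 2 ^ t) * volume P.1.toSet := by
    rintro ⟨P, hP⟩
    have h1 : lavg φ P ≤ 2 := by
      refine (lavg_le_two_mul P.scale_parent P.subset_parent).trans ?_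
      have : lavg φ P.parent ≤ 1 := not_lt.1 (parent_notMem_of_mem_tops hP)
      calc _ ≤ 2 * (1 : ℝ≥0∞) := mul_le_mul_right this 2
        _ = 2 := mul_one 2
    have h2 : ‖dyadicAverage b P‖ₑ ≤ 2 := by
      refine (dyadicAverage_enorm_le b P).trans
        ((lavg_le_smean hq hb.aestronglyMeasurable.enorm P).trans ?_)
      calc smean q (fun x => ‖b x‖ₑ) P ≤ 2 ^ (1 / q) := ENNReal.rpow_le_rpow h1 (by positivity)
        _ ≤ 2 ^ (1 : ℝ) := ENNReal.rpow_le_rpow_of_exponent_le one_le_two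
            (by rw [div_le_one hq0]; exact hq)
        _ = 2 := ENNReal.rpow_one _
    have hpow : ∀ x y : ℝ≥0∞, (x + y) ^ t ≤ 2 ^ t * (x ^ t + y ^ t) := by
      intro x y
      rcases le_total x y with h | h
      · calc (x + y) ^ t ≤ (2 * y) ^ t := by gcongr; rw [two_mul]; gcongr
          _ = 2 ^ t * y ^ t := mul_pow _ _ _
          _ ≤ _ := by gcongr; exact le_add_self
      · calc (x + y) ^ t ≤ (2 * x) ^ t := by gcongr; rw [two_mul]; gcongr
          _ = 2 ^ t * x ^ t := mul_pow _ _ _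
          _ ≤ _ := by gcongr; exact le_self_add
    calc ∫⁻ x in P.toSet, ‖b x‖ₑ ^ t
        ≤ ∫⁻ x in P.toSet, 2 ^ t * (‖b x - dyadicAverage b P‖ₑ ^ t + 2 ^ t) := by
          refine lintegral_mono fun x => le_trans (pow_le_pow_left' ?_ t) (hpow _ _)
          calc ‖b x‖ₑ = ‖(b x - dyadicAverage b P) + dyadicAverage b P‖ₑ := by
                rw [sub_add_cancel]
            _ ≤ _ := (enorm_add_le _ _).trans (add_le_add le_rfl h2)
      _ = 2 ^ t *
          ((∫⁻ x in P.toSet, ‖b x - dyadicAverage b P‖ₑ ^ t) + 2 ^ t * volume P.toSet) := by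
          rw [lintegral_const_mul' _ _ (by simp), lintegral_add_right _ measurable_const,
            setLIntegral_const]
      _ ≤ 2 ^ t * (jnConst K t * volume P.toSet + 2 ^ t * volume P.toSet) := by
          gcongr
          exact lintegral_pow_le_jnConst hb hK0 hK hbK ht0 P
      _ = _ := by ring
  have hfin' : ∫⁻ x, ‖b x‖ₑ ^ t < ∞ := by
    rw [← lintegral_add_compl _ (measurableSet_shadow B)]
    refine ENNReal.add_lt_top.2 ⟨?_, ?_⟩
    · rw [lintegral_shadow hk]
      refine (ENNReal.tsum_le_tsum htop).trans_lt ?_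
      rw [ENNReal.tsum_mul_left, ← volume_shadow hk]
      refine ENNReal.mul_lt_top (ENNReal.mul_lt_top (by simp) ?_) (hvs.trans_lt hfin)
      exact ENNReal.add_lt_top.2 ⟨(jnConst_ne_top hK t).lt_top, by simp⟩
    · refine lt_of_le_of_lt ?_ hfin
      refine le_trans (setLIntegral_mono_ae' (measurableSet_shadow B).compl ?_)
        (setLIntegral_le_lintegral _ _)
      filter_upwards [hoff] with x hx hxB
      rw [← ENNReal.rpow_natCast]
      exact ENNReal.rpow_le_rpow_of_exponent_ge (hx hxB) ht
  refine ⟨hb.aestronglyMeasurable, ?_⟩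
  rw [eLpNorm_lt_top_iff_lintegral_rpow_enorm_lt_top (by exact_mod_cast ht0) (by simp)]
  simpa using hfin'

end

section

variable {𝕜 : Type*} [RCLike 𝕜]

/-! ### Partial sums of Haar expansions -/

instance : DecidableEq DyadicInterval := Classical.decEq _

/-- The dyadic subintervals of `Q` of the first `d` generations, starting with `Q` itself. -/
def tree : ℕ → DyadicInterval → Finset DyadicInterval
  | 0, _ => ∅
  | d + 1, Q => insert Q (tree d Q.lchild ∪ tree d Q.rchild)

theorem mem_tree {d : ℕ} : ∀ {Q I : DyadicInterval},
    I ∈ tree d Q ↔ I.toSet ⊆ Q.toSet ∧ I.scale < Q.scale + d := by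
  induction d with
  | zero =>
    intro Q I
    refine ⟨fun h => by simp [tree] at h, fun h => ?_⟩
    have := scale_le_of_subset h.1
    have := h.2
    simp at this; omega
  | succ d ih =>
    intro Q I
    rw [tree, Finset.mem_insert, Finset.mem_union, ih, ih, scale_lchild, scale_rchild]
    push_cast
    constructor
    · rintro (rfl | h | h)
      · exact ⟨le_rfl, by omega⟩
      · exact ⟨h.1.trans Q.lchild_subset, by omega⟩
      · exact ⟨h.1.trans Q.rchild_subset, by omega⟩
    · rintro ⟨h, hs⟩
      by_cases hIQ : I = Q
      · exact Or.inl hIQ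
      · rcases subset_child h hIQ with h1 | h1
        · exact Or.inr (Or.inl ⟨h1, by omega⟩)
        · exact Or.inr (Or.inr ⟨h1, by omega⟩)

/-- The Haar component of `f` on `I`. -/
def haarPart (f : ℝ → 𝕜) (I : DyadicInterval) (x : ℝ) : 𝕜 := ncoef f I 0 * (I.sgn x : 𝕜)

theorem haarPart_of_notMem (f : ℝ → 𝕜) {I : DyadicInterval} {x : ℝ} (hx : x ∉ I.toSet) :
    haarPart f I x = 0 := by simp [haarPart, sgn_of_notMem hx]

theorem haarPart_of_mem_lchild {f : ℝ → 𝕜} (hf : LocallyIntegrable f volume) {I : DyadicInterval}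
    {x : ℝ} (hx : x ∈ I.lchild.toSet) :
    haarPart f I x = dyadicAverage f I.lchild - dyadicAverage f I := by
  rw [haarPart, sgn_of_mem_lchild hx, ncoef_zero_eq_children hf, dyadicAverage_eq_children hf I]
  simp only [RCLike.real_smul_eq_coe_mul]
  push_cast
  ring

theorem haarPart_of_mem_rchild {f : ℝ → 𝕜} (hf : LocallyIntegrable f volume) {I : DyadicInterval}
    {x : ℝ} (hx : x ∈ I.rchild.toSet) :
    haarPart f I x = dyadicAverage f I.rchild - dyadicAverage f I := by
  rw [haarPart, sgn_of_mem_rchild hx, ncoef_zero_eq_children hf, dyadicAverage_eq_children hf I]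
  simp only [RCLike.real_smul_eq_coe_mul]
  push_cast
  ring

theorem sum_tree_haarPart_of_notMem (f : ℝ → 𝕜) {Q : DyadicInterval} {x : ℝ} (hx : x ∉ Q.toSet)
    (d : ℕ) : ∑ I ∈ tree d Q, haarPart f I x = 0 :=
  Finset.sum_eq_zero fun _ hI => haarPart_of_notMem f fun h => hx ((mem_tree.1 hI).1 h)

/-- The Haar components are martingale differences, so their sum telescopes along the intervals
containing `x`. -/
theorem sum_tree_haarPart {f : ℝ → 𝕜} (hf : LocallyIntegrable f volume) {x : ℝ} (d : ℕ) :
    ∀ {Q : DyadicInterval}, x ∈ Q.toSet → ∑ I ∈ tree d Q, haarPart f I x =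
      dyadicAverage f (containing (Q.scale + d) x) - dyadicAverage f Q := by
  induction d with
  | zero =>
    intro Q hx
    have : containing (Q.scale + (0 : ℕ)) x = Q := by
      simpa using mem_iff_containing_eq.1 hx
    rw [this, sub_self]; rfl
  | succ d ih =>
    intro Q hx
    have hQ : Q ∉ tree d Q.lchild ∪ tree d Q.rchild := by
      rw [Finset.mem_union, mem_tree, mem_tree]
      rintro (h | h) <;>
      · have := scale_le_of_subset h.1
        simp at this
    have hd : Disjoint (tree d Q.lchild) (tree d Q.rchild) := by
      rw [Finset.disjoint_left]
      intro I h1 h2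
      obtain ⟨y, hy⟩ := I.toSet_nonempty
      exact Set.disjoint_left.1 Q.disjoint_children ((mem_tree.1 h1).1 hy) ((mem_tree.1 h2).1 hy)
    rw [tree, Finset.sum_insert hQ, Finset.sum_union hd]
    have hs : Q.scale + ((d + 1 : ℕ) : ℤ) = Q.scale + 1 + d := by push_cast; ring
    rw [hs]
    rcases mem_child hx with h | h
    · rw [sum_tree_haarPart_of_notMem f (Set.disjoint_left.1 Q.disjoint_children h), ih h,
        haarPart_of_mem_lchild hf h, scale_lchild]
      ring
    · rw [sum_tree_haarPart_of_notMem f (Set.disjoint_right.1 Q.disjoint_children h), ih h,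
        haarPart_of_mem_rchild hf h, scale_rchild]
      ring

/-- An exhaustion of the dyadic grid by finite sets. -/
def box (n : ℕ) : Finset DyadicInterval := tree (2 * n) ⟨-n, 0⟩ ∪ tree (2 * n) ⟨-n, -1⟩

theorem mem_box {n : ℕ} {I : DyadicInterval} : I ∈ box n ↔
    (I.toSet ⊆ (⟨-n, 0⟩ : DyadicInterval).toSet ∨ I.toSet ⊆ (⟨-n, -1⟩ : DyadicInterval).toSet) ∧
      I.scale < n := by
  rw [box, Finset.mem_union, mem_tree, mem_tree]
  push_cast
  have : (-n + 2 * n : ℤ) = n := by ring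
  simp only [this]
  tauto

theorem eventually_mem_box (I : DyadicInterval) : ∀ᶠ n : ℕ in atTop, I ∈ box n := by
  filter_upwards [I.eventually_subset_top, eventually_gt_atTop I.scale.toNat] with n h1 h2
  exact mem_box.2 ⟨h1, by omega⟩

theorem tendsto_box : Tendsto box atTop atTop := by
  rw [tendsto_atTop]
  intro t
  filter_upwards [(Filter.eventually_all_finset t).2 fun I _ => I.eventually_mem_box] with n hn
  exact hn

theorem disjoint_tops (n : ℕ) : Disjoint (⟨-n, 0⟩ : DyadicInterval).toSet
    (⟨-n, -1⟩ : DyadicInterval).toSet := by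
  rw [Set.disjoint_left]
  intro x hx hx'
  have := congrArg pos (eq_of_mem hx hx' rfl)
  simp at this

theorem sum_box_haarPart {f : ℝ → 𝕜} (hf : LocallyIntegrable f volume) (x : ℝ) (n : ℕ) :
    ∑ I ∈ box n, haarPart f I x = dyadicAverage f (containing n x) -
        dyadicAverage f (containing (-n) x) ∨
    ((x ∉ (⟨-n, 0⟩ : DyadicInterval).toSet ∧ x ∉ (⟨-n, -1⟩ : DyadicInterval).toSet) ∧
      ∑ I ∈ box n, haarPart f I x = 0) := by
  have hd : Disjoint (tree (2 * n) ⟨-n, 0⟩) (tree (2 * n) ⟨-n, -1⟩) := by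
    rw [Finset.disjoint_left]
    intro I h1 h2
    obtain ⟨y, hy⟩ := I.toSet_nonempty
    exact Set.disjoint_left.1 (disjoint_tops n) ((mem_tree.1 h1).1 hy) ((mem_tree.1 h2).1 hy)
  have hsum : ∑ I ∈ box n, haarPart f I x = ∑ I ∈ tree (2 * n) ⟨-n, 0⟩, haarPart f I x +
      ∑ I ∈ tree (2 * n) ⟨-n, -1⟩, haarPart f I x := by
    rw [box, ← Finset.sum_union hd]
  have hs : (-n + (2 * n : ℕ) : ℤ) = n := by push_cast; ring
  rw [hsum]
  by_cases h1 : x ∈ (⟨-n, 0⟩ : DyadicInterval).toSet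
  · left
    rw [sum_tree_haarPart hf _ h1, sum_tree_haarPart_of_notMem f
      (Set.disjoint_left.1 (disjoint_tops n) h1), add_zero]
    have := mem_iff_containing_eq.1 h1
    simp only at this ⊢
    rw [hs, this]
  · by_cases h2 : x ∈ (⟨-n, -1⟩ : DyadicInterval).toSet
    · left
      rw [sum_tree_haarPart hf _ h2, sum_tree_haarPart_of_notMem f h1, zero_add]
      have := mem_iff_containing_eq.1 h2
      simp only at this ⊢
      rw [hs, this]
    · right
      refine ⟨⟨h1, h2⟩, ?_⟩
      rw [sum_tree_haarPart_of_notMem f h1, sum_tree_haarPart_of_notMem f h2, add_zero]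

/-- Orthogonality of the Haar system: of two distinct nested intervals the smaller lies in one half
of the larger, where the larger sign function is constant while the smaller one has mean zero. -/
theorem ncoef_sgn_of_ne {I J : DyadicInterval} (h : I ≠ J) :
    ncoef (fun x => (J.sgn x : 𝕜)) I 0 = 0 := by
  have hloc : LocallyIntegrable (fun x => (J.sgn x : 𝕜)) volume := by
    have := (locallyIntegrable_const (μ := volume) (X := ℝ) (1 : 𝕜)).mul_sgn J
    simpa using this
  by_cases hd : Disjoint I.toSet J.toSet
  · rw [ncoef_congr (g := fun _ => (0 : 𝕜) * 0)]
    · rw [ncoef_const_mul, zero_mul]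
    · intro x hx
      simp [sgn_of_notMem (Set.disjoint_left.1 hd hx)]
  have hzero : ∀ Q : DyadicInterval, J.toSet ⊆ Q.toSet →
      dyadicAverage (fun x => (J.sgn x : 𝕜)) Q = 0 := by
    intro Q hQ
    have h1 : ∫ x in Q.toSet, (J.sgn x : 𝕜) = ∫ x, (J.sgn x : 𝕜) :=
      setIntegral_eq_integral_of_forall_compl_eq_zero fun x hx => by
        simp [sgn_of_notMem fun h => hx (hQ h)]
    have h2 := integral_mul_sgn (fun _ => (1 : 𝕜)) J
    rw [ncoef_zero_eq_children (locallyIntegrable_const _), dyadicAverage_const,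
      dyadicAverage_const, sub_self, smul_zero, smul_zero] at h2
    simp only [one_mul] at h2
    rw [dyadicAverage, h1, h2, smul_zero]
  have hzero' : ∀ Q : DyadicInterval, Disjoint Q.toSet J.toSet →
      dyadicAverage (fun x => (J.sgn x : 𝕜)) Q = 0 := by
    intro Q hQ
    rw [dyadicAverage_congr (g := fun _ => (0 : 𝕜)), dyadicAverage_const]
    intro x hx
    simp [sgn_of_notMem (Set.disjoint_left.1 hQ hx)]
  rw [ncoef_zero_eq_children hloc]
  rcases le_total I.scale J.scale with hs | hs
  · have hJI : J.toSet ⊆ I.toSet := (disjoint_or_subset hs).resolve_left fun h => hd h.symm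
    rcases subset_child hJI h.symm with h1 | h1
    · rw [hzero _ h1, hzero' _ (I.disjoint_children.symm.mono_right h1), sub_zero, smul_zero]
    · rw [hzero _ h1, hzero' _ (I.disjoint_children.mono_right h1), sub_zero, smul_zero]
  · have hIJ : I.toSet ⊆ J.toSet := (disjoint_or_subset hs).resolve_left hd
    have hconst : ∃ c : 𝕜, ∀ x ∈ I.toSet, (J.sgn x : 𝕜) = c := by
      rcases subset_child hIJ h with h1 | h1
      · exact ⟨_, fun x hx => by rw [sgn_of_mem_lchild (h1 hx)]⟩
      · exact ⟨_, fun x hx => by rw [sgn_of_mem_rchild (h1 hx)]⟩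
    obtain ⟨c, hc⟩ := hconst
    rw [dyadicAverage_congr (g := fun _ => c) fun x hx => hc x (I.rchild_subset hx),
      dyadicAverage_congr (I := I.lchild) (g := fun _ => c) fun x hx => hc x (I.lchild_subset hx),
      dyadicAverage_const, dyadicAverage_const, sub_self, smul_zero]

theorem locallyIntegrable_sgn (I : DyadicInterval) :
    LocallyIntegrable (fun x => (I.sgn x : 𝕜)) volume := by
  have := (locallyIntegrable_const (μ := volume) (X := ℝ) (1 : 𝕜)).mul_sgn I
  simpa using this

theorem locallyIntegrable_haarPart (f : ℝ → 𝕜) (I : DyadicInterval) :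
    LocallyIntegrable (haarPart f I) volume :=
  (locallyIntegrable_sgn I).smul (ncoef f I 0)

theorem ncoef_sum_haarPart_of_notMem (f : ℝ → 𝕜) {F : Finset DyadicInterval} {I : DyadicInterval}
    (hI : I ∉ F) : ncoef (fun x => ∑ J ∈ F, haarPart f J x) I 0 = 0 := by
  induction F using Finset.induction_on with
  | empty =>
    simp only [Finset.sum_empty]
    rw [show (fun _ : ℝ => (0 : 𝕜)) = fun _ => (0 : 𝕜) * 0 by simp, ncoef_const_mul, zero_mul]
  | insert J F hJ ih =>
    rw [Finset.mem_insert, not_or] at hI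
    have h1 : (fun x => ∑ K ∈ insert J F, haarPart f K x) =
        fun x => (∑ K ∈ F, haarPart f K x) - (-ncoef f J 0) * (J.sgn x : 𝕜) := by
      ext x
      rw [Finset.sum_insert hJ, haarPart]
      ring
    rw [h1, ncoef_sub _ (g := fun x => (-ncoef f J 0) * (J.sgn x : 𝕜)), ih hI.2, ncoef_const_mul,
      ncoef_sgn_of_ne hI.1, mul_zero, sub_zero]
    · exact (locallyIntegrable_sgn J).smul (-ncoef f J 0)
    · exact locallyIntegrable_finsetSum F fun K _ => locallyIntegrable_haarPart f K

theorem ncoef_sub_sum_haarPart {f : ℝ → 𝕜} (hf : LocallyIntegrable f volume)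
    {F : Finset DyadicInterval} {I : DyadicInterval} (hI : I ∉ F) :
    ncoef (fun x => f x - ∑ J ∈ F, haarPart f J x) I 0 = ncoef f I 0 := by
  rw [ncoef_sub hf (locallyIntegrable_finsetSum F fun K _ => locallyIntegrable_haarPart f K),
    ncoef_sum_haarPart_of_notMem f hI, sub_zero]

/-! ### Convergence of Haar expansions in `L^p`. -/

theorem ae_enorm_le_maximal {f : ℝ → 𝕜} (hf : LocallyIntegrable f volume) :
    ∀ᵐ x, ‖f x‖ₑ ≤ maximal (fun y => ‖f y‖ₑ) x := by
  filter_upwards [ae_tendsto_lavg hf] with x hx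
  exact le_of_tendsto hx (Eventually.of_forall fun n => lavg_le_maximal _ (mem_containing n x))

/-- By Hölder the average over `I` is at most `(‖f‖_p ^ p / |I|) ^ (1 / p)`. -/
theorem tendsto_dyadicAverage_containing_neg {f : ℝ → 𝕜} {p : ℝ} (hp : 1 < p)
    (hf : MemLp f (ENNReal.ofReal p) volume) (x : ℝ) :
    Tendsto (fun n : ℕ => dyadicAverage f (containing (-n) x)) atTop (𝓝 0) := by
  have hp0 : 0 < p := by linarith
  have hfin : ∫⁻ x, ‖f x‖ₑ ^ p < ∞ := by
    have := lintegral_rpow_enorm_lt_top_of_eLpNorm_lt_top (by simpa using hp0) (by simp) hf.2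
    rwa [ENNReal.toReal_ofReal hp0.le] at this
  rw [tendsto_zero_iff_enorm_tendsto_zero]
  have hbound : ∀ n : ℕ, ‖dyadicAverage f (containing (-n) x)‖ₑ ≤
      ((∫⁻ x, ‖f x‖ₑ ^ p) / 2 ^ n) ^ (1 / p) := by
    intro n
    refine (dyadicAverage_enorm_le f _).trans
      ((lavg_le_smean hp.le hf.aestronglyMeasurable.enorm _).trans ?_)
    refine ENNReal.rpow_le_rpow ?_ (by positivity)
    rw [lavg]
    refine ENNReal.div_le_div (setLIntegral_le_lintegral _ _) ?_
    rw [volume_toSet, length, scale_containing, neg_neg, zpow_natCast,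
      ENNReal.ofReal_pow two_pos.le, ENNReal.ofReal_ofNat]
  refine tendsto_of_tendsto_of_tendsto_of_le_of_le tendsto_const_nhds ?_ (fun _ => zero_le)
    hbound
  have h1 : Tendsto (fun n : ℕ => (∫⁻ x, ‖f x‖ₑ ^ p) / 2 ^ n) atTop (𝓝 0) := by
    simp_rw [ENNReal.div_eq_inv_mul, ENNReal.inv_pow]
    have h2 := ENNReal.tendsto_pow_atTop_nhds_zero_of_lt_one (r := 2⁻¹) (by simp)
    have h3 := ENNReal.Tendsto.mul_const (b := ∫⁻ x, ‖f x‖ₑ ^ p) h2 (Or.inr hfin.ne)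
    simpa using h3
  have h4 := h1.ennrpow_const (1 / p)
  rwa [ENNReal.zero_rpow_of_pos (by positivity)] at h4

theorem aestronglyMeasurable_sum_haarPart (f : ℝ → 𝕜) (F : Finset DyadicInterval) :
    AEStronglyMeasurable (fun x => ∑ I ∈ F, haarPart f I x) volume :=
  (locallyIntegrable_finsetSum F fun K _ =>
    locallyIntegrable_haarPart f K).aestronglyMeasurable

/-- Dominated convergence: the remainder involves `f` and at most two of its averages, so three
times the maximal function dominates it, while fine averages tend to `f` and coarse ones to `0`. -/
theorem tendsto_eLpNorm_sub_sum_box {f : ℝ → 𝕜} {p : ℝ} (hp : 1 < p)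
    (hf : MemLp f (ENNReal.ofReal p) volume) :
    Tendsto (fun n => eLpNorm (fun x => f x - ∑ I ∈ box n, haarPart f I x)
      (ENNReal.ofReal p) volume) atTop (𝓝 0) := by
  have hp0 : 0 < p := by linarith
  have hloc : LocallyIntegrable f volume :=
    hf.locallyIntegrable (by rw [← ENNReal.ofReal_one]; exact ENNReal.ofReal_le_ofReal hp.le)
  have hfin : ∫⁻ x, ‖f x‖ₑ ^ p < ∞ := by
    have := lintegral_rpow_enorm_lt_top_of_eLpNorm_lt_top (by simpa using hp0) (by simp) hf.2
    rwa [ENNReal.toReal_ofReal hp0.le] at this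
  have hmax := (lintegral_maximal_rpow_le hf.aestronglyMeasurable.enorm hp).trans_lt
    (ENNReal.mul_lt_top (maximalConst_ne_top hp).lt_top hfin)
  have key : Tendsto (fun n => ∫⁻ x, ‖f x - ∑ I ∈ box n, haarPart f I x‖ₑ ^ p) atTop
      (𝓝 (∫⁻ _ : ℝ, 0)) := by
    refine tendsto_lintegral_of_dominated_convergence'
      (fun x => (3 * maximal (fun y => ‖f y‖ₑ) x) ^ p) (fun n => ?_) (fun n => ?_) ?_ ?_
    · exact ((hf.aestronglyMeasurable.sub
        (aestronglyMeasurable_sum_haarPart f _)).enorm.pow_const p)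
    · filter_upwards [ae_enorm_le_maximal hloc] with x hx
      refine ENNReal.rpow_le_rpow ?_ hp0.le
      have havg : ∀ k : ℤ, ‖dyadicAverage f (containing k x)‖ₑ ≤ maximal (fun y => ‖f y‖ₑ) x :=
        fun k => (dyadicAverage_enorm_le f _).trans (lavg_le_maximal _ (mem_containing k x))
      have h3 : (3 : ℝ≥0∞) * maximal (fun y => ‖f y‖ₑ) x = maximal (fun y => ‖f y‖ₑ) x +
          (maximal (fun y => ‖f y‖ₑ) x + maximal (fun y => ‖f y‖ₑ) x) := by ring
      rw [h3]
      rcases sum_box_haarPart hloc x n with h | ⟨_, h⟩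
      · rw [h]
        exact enorm_sub_le.trans (add_le_add hx (enorm_sub_le.trans
          (add_le_add (havg _) (havg _))))
      · rw [h, sub_zero]
        exact hx.trans le_self_add
    · simp_rw [ENNReal.mul_rpow_of_nonneg _ _ hp0.le]
      rw [lintegral_const_mul' _ _ (ENNReal.rpow_ne_top_of_nonneg hp0.le (by simp))]
      exact (ENNReal.mul_lt_top (ENNReal.rpow_lt_top_of_nonneg hp0.le (by simp)) hmax).ne
    · filter_upwards [ae_tendsto_dyadicAverage hloc] with x hx
      have h1 := hx.sub (tendsto_dyadicAverage_containing_neg hp hf x)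
      rw [sub_zero] at h1
      have h2 : Tendsto (fun n => ∑ I ∈ box n, haarPart f I x) atTop (𝓝 (f x)) := by
        refine h1.congr' ?_
        filter_upwards [(containing 0 x).eventually_subset_top] with n hn
        rcases sum_box_haarPart hloc x n with h | ⟨h, _⟩
        · exact h.symm
        · exfalso
          rcases hn with hn | hn
          · exact h.1 (hn (mem_containing 0 x))
          · exact h.2 (hn (mem_containing 0 x))
      have h3 := (tendsto_const_nhds (x := f x)).sub h2
      rw [sub_self] at h3
      have h4 := (tendsto_zero_iff_enorm_tendsto_zero.1 h3).ennrpow_const p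
      rwa [ENNReal.zero_rpow_of_pos hp0] at h4
  rw [lintegral_zero] at key
  have h5 := key.ennrpow_const (1 / p)
  rw [ENNReal.zero_rpow_of_pos (by positivity)] at h5
  refine h5.congr fun n => ?_
  rw [eLpNorm_eq_lintegral_rpow_enorm_toReal (by simpa using hp0) (by simp),
    ENNReal.toReal_ofReal hp0.le]

end

section

variable {𝕜 : Type*} [RCLike 𝕜]

/-! ### Duality -/

theorem lintegral_rpow_lt_top {f : ℝ → 𝕜} {p : ℝ} (hp : 0 < p)
    (hf : MemLp f (ENNReal.ofReal p) volume) : ∫⁻ x, ‖f x‖ₑ ^ p < ∞ := by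
  have := lintegral_rpow_enorm_lt_top_of_eLpNorm_lt_top (by simpa using hp) (by simp) hf.2
  rwa [ENNReal.toReal_ofReal hp.le] at this

theorem eLpNorm_ofReal_eq (f : ℝ → 𝕜) {p : ℝ} (hp : 0 < p) :
    eLpNorm f (ENNReal.ofReal p) volume = (∫⁻ x, ‖f x‖ₑ ^ p) ^ (1 / p) := by
  rw [eLpNorm_eq_lintegral_rpow_enorm_toReal (by simpa using hp) (by simp),
    ENNReal.toReal_ofReal hp.le]

/-- The extremal test is the conjugate of `h` times `|h| ^ (r - 2)`. That `h` is already in `L^r`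
makes the test admissible and the final division legitimate. -/
theorem eLpNorm_le_of_forall_integral_mul_le {h : ℝ → 𝕜} {r r' : ℝ} (hr : r.HolderConjugate r')
    (hh : MemLp h (ENNReal.ofReal r) volume) {K : ℝ≥0∞}
    (H : ∀ g : ℝ → 𝕜, MemLp g (ENNReal.ofReal r') volume →
      ‖∫ x, h x * g x‖ₑ ≤ K * eLpNorm g (ENNReal.ofReal r') volume) :
    eLpNorm h (ENNReal.ofReal r) volume ≤ K := by
  have hr0 := hr.pos
  have hr1 := hr.lt
  have hr'0 := hr.symm.pos
  have hfin := lintegral_rpow_lt_top hr0 hh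
  set X := ∫⁻ x, ‖h x‖ₑ ^ r with hX
  set g : ℝ → 𝕜 := fun x => (starRingEnd 𝕜) (h x) * ((‖h x‖ ^ (r - 2) : ℝ) : 𝕜) with hg
  have hgm : AEStronglyMeasurable g volume := by
    refine (RCLike.continuous_conj.comp_aestronglyMeasurable hh.1).mul ?_
    refine RCLike.continuous_ofReal.comp_aestronglyMeasurable ?_
    exact (hh.1.norm.aemeasurable.pow_const _).aestronglyMeasurable
  have hnorm : ∀ x, ‖g x‖ = ‖h x‖ ^ (r - 1) := by
    intro x
    rw [hg]
    simp only [norm_mul, RCLike.norm_conj, RCLike.norm_ofReal]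
    rcases eq_or_ne (h x) 0 with h0 | h0
    · rw [h0, norm_zero, zero_mul, Real.zero_rpow (by linarith)]
    · have hpos := norm_pos_iff.2 h0
      rw [abs_of_nonneg (by positivity)]
      conv_lhs => rw [← Real.rpow_one ‖h x‖, ← Real.rpow_mul hpos.le, one_mul]
      rw [← Real.rpow_add hpos]
      congr 1; ring
  have hmul : ∀ x, h x * g x = ((‖h x‖ ^ r : ℝ) : 𝕜) := by
    intro x
    rw [hg]
    simp only
    rw [← mul_assoc, RCLike.mul_conj, ← RCLike.ofReal_pow, ← RCLike.ofReal_mul]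
    congr 1
    rcases eq_or_ne (h x) 0 with h0 | h0
    · rw [h0, norm_zero, Real.zero_rpow hr0.ne']; simp
    · have hpos := norm_pos_iff.2 h0
      rw [← Real.rpow_natCast, ← Real.rpow_add hpos]
      congr 1; push_cast; ring
  have hgX : ∫⁻ x, ‖g x‖ₑ ^ r' = X := by
    refine lintegral_congr fun x => ?_
    rw [← ofReal_norm, hnorm, ← ofReal_norm,
      ENNReal.ofReal_rpow_of_nonneg (by positivity) hr'0.le,
      ENNReal.ofReal_rpow_of_nonneg (by positivity) hr0.le, ← Real.rpow_mul (norm_nonneg _),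
      hr.sub_one_mul_conj]
  have hgLp : MemLp g (ENNReal.ofReal r') volume := by
    refine ⟨hgm, ?_⟩
    rw [eLpNorm_ofReal_eq g hr'0, hgX]
    exact ENNReal.rpow_lt_top_of_nonneg (by positivity) hfin.ne
  have hint : ‖∫ x, h x * g x‖ₑ = X := by
    simp_rw [hmul]
    rw [integral_ofReal, ← ofReal_norm, RCLike.norm_ofReal, abs_of_nonneg
      (integral_nonneg fun x => by positivity), ofReal_integral_eq_lintegral_ofReal]
    · refine lintegral_congr fun x => ?_
      rw [← ofReal_norm, ENNReal.ofReal_rpow_of_nonneg (by positivity) hr0.le]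
    · have := hh.integrable_norm_rpow (by simpa using hr0) (by simp)
      rwa [ENNReal.toReal_ofReal hr0.le] at this
    · exact Eventually.of_forall fun x => by positivity
  have hmain := H g hgLp
  rw [hint, eLpNorm_ofReal_eq g hr'0, hgX] at hmain
  rw [eLpNorm_ofReal_eq h hr0]
  change X ^ (1 / r) ≤ K
  rcases eq_or_ne X 0 with h0 | h0
  · rw [h0, ENNReal.zero_rpow_of_pos (by positivity)]; exact zero_le
  have hY0 : X ^ (1 / r') ≠ 0 := (ENNReal.rpow_pos h0.bot_lt hfin.ne).ne'
  have hYt : X ^ (1 / r') ≠ ∞ := ENNReal.rpow_ne_top_of_nonneg (by positivity) hfin.ne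
  rw [← ENNReal.mul_le_mul_iff_left hY0 hYt, ← ENNReal.rpow_add _ _ h0 hfin.ne, one_div, one_div,
    hr.inv_add_inv_eq_one, ENNReal.rpow_one]
  rwa [one_div] at hmain

/-! ### Powers of the sign functions -/

/-- The type of the coefficient that is paired with `h_I ^ n`. -/
def parity (n : ℕ) : Fin 2 := if Even n then 1 else 0

theorem sgn_pow_of_odd (I : DyadicInterval) {n : ℕ} (hn : Odd n) (x : ℝ) :
    I.sgn x ^ n = I.sgn x := by
  by_cases hx : x ∈ I.toSet
  · obtain ⟨k, rfl⟩ := hn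
    rw [pow_succ, pow_mul, sgn_sq_of_mem hx, one_pow, one_mul]
  · rw [sgn_of_notMem hx, zero_pow hn.pos.ne']

theorem sgn_pow_of_even (I : DyadicInterval) {n : ℕ} (hn : Even n) {x : ℝ} (hx : x ∈ I.toSet) :
    I.sgn x ^ n = 1 := by
  obtain ⟨k, rfl⟩ := hn
  rw [← two_mul, pow_mul, sgn_sq_of_mem hx, one_pow]

theorem sgn_pow_of_notMem {I : DyadicInterval} {n : ℕ} (hn : n ≠ 0) {x : ℝ} (hx : x ∉ I.toSet) :
    I.sgn x ^ n = 0 := by rw [sgn_of_notMem hx, zero_pow hn]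

/-- Even positive powers of `sgn` are `1_I` and odd ones are `sgn`; this fixes the type of the dual
coefficient. -/
theorem integral_mul_sgn_pow (g : ℝ → 𝕜) (I : DyadicInterval) {n : ℕ} (hn : n ≠ 0) :
    ∫ x, g x * (I.sgn x : 𝕜) ^ n = I.length • ncoef g I (parity n) := by
  rw [parity]
  split_ifs with h
  · rw [ncoef_one, length_smul_dyadicAverage, ← setIntegral_eq_integral_of_forall_compl_eq_zero
      (s := I.toSet) (f := fun x => g x * (I.sgn x : 𝕜) ^ n)]
    · refine setIntegral_congr_fun I.measurableSet_toSet fun x hx => ?_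
      rw [← RCLike.ofReal_pow, sgn_pow_of_even I h hx, RCLike.ofReal_one, mul_one]
    · intro x hx
      rw [← RCLike.ofReal_pow, sgn_pow_of_notMem hn hx, RCLike.ofReal_zero, mul_zero]
  · rw [← integral_mul_sgn]
    refine integral_congr_ae (Eventually.of_forall fun x => ?_)
    simp only
    rw [← RCLike.ofReal_pow, sgn_pow_of_odd I (Nat.not_even_iff_odd.1 h)]

theorem aestronglyMeasurable_sgn_pow (I : DyadicInterval) (n : ℕ) :
    AEStronglyMeasurable (fun x => (I.sgn x : 𝕜) ^ n) volume :=
  (locallyIntegrable_sgn (𝕜 := 𝕜) I).aestronglyMeasurable.pow n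

theorem norm_sgn_pow_le (I : DyadicInterval) (n : ℕ) (x : ℝ) : ‖(I.sgn x : 𝕜) ^ n‖ ≤ 1 := by
  rw [norm_pow, RCLike.norm_ofReal]
  exact pow_le_one₀ (abs_nonneg _) (I.abs_sgn_le x)

theorem memLp_mul_sgn_pow {g : ℝ → 𝕜} {p : ℝ≥0∞} {I : DyadicInterval}
    (hg : MemLp g p (volume.restrict I.toSet)) (hgm : AEStronglyMeasurable g volume) {n : ℕ}
    (hn : n ≠ 0) : MemLp (fun x => g x * (I.sgn x : 𝕜) ^ n) p volume := by
  have h1 : MemLp (I.toSet.indicator g) p volume :=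
    (memLp_indicator_iff_restrict I.measurableSet_toSet).2 hg
  have h2 : AEStronglyMeasurable (fun x => g x * (I.sgn x : 𝕜) ^ n) volume :=
    hgm.mul (aestronglyMeasurable_sgn_pow I n)
  refine h1.mono h2 (Eventually.of_forall fun x => ?_)
  by_cases hx : x ∈ I.toSet
  · rw [Set.indicator_of_mem hx, norm_mul]
    exact mul_le_of_le_one_right (norm_nonneg _) (norm_sgn_pow_le I n x)
  · rw [← RCLike.ofReal_pow, sgn_pow_of_notMem hn hx]; simp

theorem integrable_mul_sgn_pow {g : ℝ → 𝕜} (hg : LocallyIntegrable g volume) (I : DyadicInterval)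
    {n : ℕ} (hn : n ≠ 0) : Integrable (fun x => g x * (I.sgn x : 𝕜) ^ n) volume := by
  rw [← memLp_one_iff_integrable]
  exact memLp_mul_sgn_pow (memLp_one_iff_integrable.2 (hg.integrableOn_toSet I))
    hg.aestronglyMeasurable hn

theorem memLp_sgn_pow (p : ℝ≥0∞) (I : DyadicInterval) {n : ℕ} (hn : n ≠ 0) :
    MemLp (fun x => (I.sgn x : 𝕜) ^ n) p volume := by
  have : IsFiniteMeasure (volume.restrict I.toSet) :=
    ⟨by rw [Measure.restrict_apply_univ]; exact I.volume_ne_top.lt_top⟩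
  have h := memLp_mul_sgn_pow (g := fun _ => (1 : 𝕜)) (p := p) (I := I) (memLp_const 1)
    aestronglyMeasurable_const hn
  simpa using h

/-! ### Partial sums of the multiplier series -/

section Sums

variable {m : ℕ}

/-- A finite partial sum of the series of the Haar multiplier. -/
def haarSum (ε : DyadicInterval → 𝕜) (α : Fin m → Fin 2) (f : Fin m → ℝ → 𝕜)
    (F : Finset DyadicInterval) (x : ℝ) : 𝕜 :=
  ∑ I ∈ F, ε I * paraproductTerm α f I x

theorem term_eq (ε : DyadicInterval → 𝕜) (α : Fin m → Fin 2) (f : Fin m → ℝ → 𝕜)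
    (I : DyadicInterval) (x : ℝ) : ε I * paraproductTerm α f I x =
      ε I * (∏ j, ncoef (f j) I (α j)) * (I.sgn x : 𝕜) ^ sigma0 α := by
  rw [paraproductTerm_eq, mul_assoc]

theorem memLp_term (ε : DyadicInterval → 𝕜) {α : Fin m → Fin 2} (hα : sigma0 α ≠ 0)
    (f : Fin m → ℝ → 𝕜) (I : DyadicInterval) (p : ℝ≥0∞) :
    MemLp (fun x => ε I * paraproductTerm α f I x) p volume := by
  simp_rw [term_eq]
  exact (memLp_sgn_pow p I hα).const_mul _

theorem memLp_haarSum (ε : DyadicInterval → 𝕜) {α : Fin m → Fin 2} (hα : sigma0 α ≠ 0)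
    (f : Fin m → ℝ → 𝕜) (F : Finset DyadicInterval) (p : ℝ≥0∞) :
    MemLp (haarSum ε α f F) p volume :=
  memLp_finsetSum F fun I _ => memLp_term ε hα f I p

theorem mul_haarSum (ε : DyadicInterval → 𝕜) (α : Fin m → Fin 2) (f : Fin m → ℝ → 𝕜)
    (F : Finset DyadicInterval) (g : ℝ → 𝕜) (x : ℝ) : g x * haarSum ε α f F x =
      ∑ I ∈ F, ε I * (∏ j, ncoef (f j) I (α j)) * (g x * (I.sgn x : 𝕜) ^ sigma0 α) := by
  rw [haarSum, Finset.mul_sum]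
  refine Finset.sum_congr rfl fun I _ => ?_
  rw [term_eq]; ring

theorem integral_mul_haarSum (ε : DyadicInterval → 𝕜) {α : Fin m → Fin 2} (hα : sigma0 α ≠ 0)
    (f : Fin m → ℝ → 𝕜) (F : Finset DyadicInterval) {g : ℝ → 𝕜}
    (hg : LocallyIntegrable g volume) : ∫ x, g x * haarSum ε α f F x =
      ∑ I ∈ F, ε I * (∏ j, ncoef (f j) I (α j)) *
        ((I.length : 𝕜) * ncoef g I (parity (sigma0 α))) := by
  simp_rw [mul_haarSum]
  rw [integral_finsetSum F fun I _ => (integrable_mul_sgn_pow hg I hα).const_mul _]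
  refine Finset.sum_congr rfl fun I _ => ?_
  rw [integral_const_mul, integral_mul_sgn_pow g I hα, RCLike.real_smul_eq_coe_mul]

theorem integrable_mul_haarSum (ε : DyadicInterval → 𝕜) {α : Fin m → Fin 2} (hα : sigma0 α ≠ 0)
    (f : Fin m → ℝ → 𝕜) (F : Finset DyadicInterval) {g : ℝ → 𝕜}
    (hg : LocallyIntegrable g volume) : Integrable (fun x => g x * haarSum ε α f F x) volume := by
  simp_rw [mul_haarSum]
  exact integrable_finsetSum F fun I _ => (integrable_mul_sgn_pow hg I hα).const_mul _

theorem sigma0_ne_zero {α : Fin m → Fin 2} (hα : α ∈ indexSetU m) : sigma0 α ≠ 0 := by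
  intro h
  refine hα (funext fun j => ?_)
  rw [sigma0, Finset.card_eq_zero, Finset.filter_eq_empty_iff] at h
  have := h (Finset.mem_univ j)
  omega

/-- The types of the coefficients in the dual form. -/
def formType (α : Fin m → Fin 2) : Option (Fin m) → Fin 2
  | none => parity (sigma0 α)
  | some j => α j

/-- If only one function has a Haar coefficient, the output factor is `h_I` to the first power, so
the dual function supplies the second. -/
theorem exists_two_zeros {α : Fin m → Fin 2} (hα : sigma0 α ≠ 0) :
    ∃ k l : Option (Fin m), k ≠ l ∧ formType α k = 0 ∧ formType α l = 0 := by
  rcases Nat.lt_or_ge 1 (sigma0 α) with h | h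
  · obtain ⟨k, hk, l, hl, hkl⟩ := Finset.one_lt_card.1 h
    exact ⟨some k, some l, by simpa using hkl, (Finset.mem_filter.1 hk).2,
      (Finset.mem_filter.1 hl).2⟩
  · have h1 : sigma0 α = 1 := by omega
    obtain ⟨j, hj⟩ := Finset.card_pos.1 (Nat.pos_of_ne_zero hα)
    exact ⟨none, some j, by simp, by simp [formType, h1, parity], (Finset.mem_filter.1 hj).2⟩

end Sums

/-! ### Bounds for the dual forms -/

section Forms

variable {ι : Type*} [Fintype ι]

theorem SupControlled.mono {N C C' : ℝ≥0∞} {a c : DyadicInterval → ℝ≥0∞}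
    (h : SupControlled N C a c) (hC : C ≤ C') : SupControlled N C' a c := by
  intro Q
  obtain ⟨B, h1, h2, h3⟩ := h Q
  exact ⟨B, h1, h2, fun I hI hB => (h3 I hI hB).trans (by gcongr)⟩

theorem SqControlled.mono {N C C' : ℝ≥0∞} {a c : DyadicInterval → ℝ≥0∞}
    (h : SqControlled N C a c) (hC : C ≤ C') : SqControlled N C' a c := by
  intro Q
  obtain ⟨B, h1, h2, h3⟩ := h Q
  exact ⟨B, h1, h2, fun t ht => (h3 t ht).trans (by gcongr)⟩

theorem exists_tsum_prod_le {s : ℝ} (hs : 0 < s) {p : ι → ℝ} (hp : ∀ j, s < p j)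
    (hsum : ∑ j, 1 / p j = 1) {k l : ι} (hkl : k ≠ l) {C : ℝ≥0∞} (hC : C ≠ ∞) :
    ∃ K : ℝ≥0∞, K ≠ ∞ ∧ ∀ (f : ι → ℝ → 𝕜) (a : ι → DyadicInterval → ℝ≥0∞),
      (∀ j, AEStronglyMeasurable (f j) volume) →
      (∀ j, SupControlled (2 * Fintype.card ι) C (a j) (smean s fun x => ‖f j x‖ₑ)) →
      SqControlled (2 * Fintype.card ι) C (a k) (smean s fun x => ‖f k x‖ₑ) →
      SqControlled (2 * Fintype.card ι) C (a l) (smean s fun x => ‖f l x‖ₑ) →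
      ∑' I : DyadicInterval, volume I.toSet * ∏ j, a j I ≤
        K * ∏ j, eLpNorm (f j) (ENNReal.ofReal (p j)) volume := by
  refine ⟨2 * C ^ Fintype.card ι * ∏ j, maximalConst (p j / s) ^ (1 / p j), ?_, ?_⟩
  · refine ENNReal.mul_ne_top (ENNReal.mul_ne_top (by simp) (ENNReal.pow_ne_top hC)) ?_
    refine ENNReal.prod_ne_top fun j _ => ENNReal.rpow_ne_top_of_nonneg ?_
      (maximalConst_ne_top ((one_lt_div hs).2 (hp j)))
    have := hs.trans (hp j)
    positivity
  · intro f a hf hsup hk hl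
    refine (tsum_volume_mul_prod_le hkl hk hl (fun j _ _ => hsup j)
      (fun j Q x hx => smean_le_smaximal hs _ hx)).trans ?_
    refine (mul_le_mul_right ?_ _).trans_eq (mul_assoc _ _ _).symm
    refine (lintegral_prod_smaximal_le hs hp hsum fun j => (hf j).enorm).trans_eq ?_
    congr 1
    exact Finset.prod_congr rfl fun j _ => (eLpNorm_ofReal_eq _ (hs.trans (hp j))).symm

theorem locallyIntegrable_of_memLp {f : ℝ → 𝕜} {p : ℝ} (hp : 1 < p)
    (hf : MemLp f (ENNReal.ofReal p) volume) : LocallyIntegrable f volume :=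
  hf.locallyIntegrable (by rw [← ENNReal.ofReal_one]; exact ENNReal.ofReal_le_ofReal hp.le)

theorem one_le_two_mul_card (k : ι) : (1 : ℝ≥0∞) ≤ 2 * Fintype.card ι := by
  have : Nonempty ι := ⟨k⟩
  have h : 1 ≤ 2 * Fintype.card ι := by have := Fintype.card_pos (α := ι); omega
  exact_mod_cast h

theorem two_mul_card_ne_top : (2 * Fintype.card ι : ℝ≥0∞) ≠ ∞ :=
  ENNReal.mul_ne_top (by simp) (by simp)

theorem supControlled_ncoef {f : ℝ → 𝕜} (hf : AEStronglyMeasurable f volume) {s : ℝ}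
    (hs : 1 ≤ s) {N : ℝ≥0∞} (hN : 1 ≤ N) (hN' : N ≠ ∞) (a : Fin 2) :
    SupControlled N N (fun I => ‖ncoef f I a‖ₑ) (smean s fun x => ‖f x‖ₑ) := by
  have h := SupControlled.of_le_smean (a := fun I => ‖ncoef f I a‖ₑ) (φ := fun x => ‖f x‖ₑ) hs
    (K := 1) hN hN' fun I => by
      rw [one_mul]
      exact (ncoef_enorm_le f I a).trans (lavg_le_smean hs hf.enorm I)
  rwa [mul_one] at h

theorem exists_tsum_ncoef_le (β : ι → Fin 2) {k l : ι} (hkl : k ≠ l) (hk : β k = 0)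
    (hl : β l = 0) {p : ι → ℝ} (hp : ∀ j, 1 < p j) (hsum : ∑ j, 1 / p j = 1) :
    ∃ K : ℝ≥0∞, K ≠ ∞ ∧ ∀ f : ι → ℝ → 𝕜, (∀ j, MemLp (f j) (ENNReal.ofReal (p j)) volume) →
      ∑' I : DyadicInterval, volume I.toSet * ∏ j, ‖ncoef (f j) I (β j)‖ₑ ≤
        K * ∏ j, eLpNorm (f j) (ENNReal.ofReal (p j)) volume := by
  have hN := one_le_two_mul_card k
  have hN' := two_mul_card_ne_top (ι := ι)
  obtain ⟨K, hK, h⟩ := exists_tsum_prod_le (𝕜 := 𝕜) one_pos hp hsum hkl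
    (C := 2 * (2 * Fintype.card ι)) (ENNReal.mul_ne_top (by simp) hN')
  refine ⟨K, hK, fun f hf => h f _ (fun j => (hf j).1) (fun j => ?_) ?_ ?_⟩
  · refine (supControlled_ncoef (hf j).1 le_rfl hN hN' (β j)).mono ?_
    nth_rw 2 [two_mul]
    exact le_self_add
  · rw [hk]
    exact sqControlled_ncoef (locallyIntegrable_of_memLp (hp k) (hf k)) le_rfl hN hN'
  · rw [hl]
    exact sqControlled_ncoef (locallyIntegrable_of_memLp (hp l) (hf l)) le_rfl hN hN'

theorem exists_tsum_ncoef_sub_mul_le [DecidableEq ι] (β : ι → Fin 2) {k l : ι} (hkl : k ≠ l)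
    (hk : β k = 0) (hl : β l = 0) {p : ι → ℝ} (hsum : ∑ j, 1 / p j = 1) {b : ℝ → 𝕜}
    (hb : LocallyIntegrable b volume) {L : ℝ≥0∞} (hL0 : L ≠ 0) (hL : L ≠ ∞)
    (hbL : ∀ I, lavg (fun x => ‖b x - dyadicAverage b I‖ₑ) I ≤ L) {t : ℕ} {s : ℝ}
    (hts : (t : ℝ).HolderConjugate s) (hp : ∀ j, s < p j)
    (hbf : ∀ j, ∀ f : ℝ → 𝕜, MemLp f (ENNReal.ofReal (p j)) volume →
      LocallyIntegrable (fun x => b x * f x) volume) :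
    ∃ K : ℝ≥0∞, K ≠ ∞ ∧ ∀ (i : ι) (f : ι → ℝ → 𝕜),
      (∀ j, MemLp (f j) (ENNReal.ofReal (p j)) volume) →
      ∑' I : DyadicInterval, volume I.toSet * ∏ j, ‖if j = i then
        ncoef (fun x => (b x - dyadicAverage b I) * f j x) I (β j) else ncoef (f j) I (β j)‖ₑ ≤
        K * ∏ j, eLpNorm (f j) (ENNReal.ofReal (p j)) volume := by
  have hN := one_le_two_mul_card k
  have hN' := two_mul_card_ne_top (ι := ι)
  have hs : 1 < s := hts.symm.lt
  have hp1 : ∀ j, 1 < p j := fun j => hs.trans (hp j)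
  set N : ℝ≥0∞ := 2 * Fintype.card ι with hNdef
  set J := jnConst L t ^ (1 / (t : ℝ)) with hJ
  have hJtop : J ≠ ∞ := ENNReal.rpow_ne_top_of_nonneg (by positivity) (jnConst_ne_top hL t)
  set C1 : ℝ≥0∞ := 2 * (2 * (3 * N * J) + 3 * N * L * (2 * (3 * N))) with hC1
  have hC1top : C1 ≠ ∞ := by
    have h3 : 3 * N ≠ ∞ := ENNReal.mul_ne_top (by simp) hN'
    refine ENNReal.mul_ne_top (by simp) (ENNReal.add_ne_top.2 ⟨?_, ?_⟩)
    · exact ENNReal.mul_ne_top (by simp) (ENNReal.mul_ne_top h3 hJtop)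
    · exact ENNReal.mul_ne_top (ENNReal.mul_ne_top h3 hL) (ENNReal.mul_ne_top (by simp) h3)
  -- The constant is a sum so that it dominates each of those arising for the different kinds of
  -- slot.
  obtain ⟨K, hK, h⟩ := exists_tsum_prod_le (𝕜 := 𝕜) (one_pos.trans hs) hp hsum hkl
    (C := 2 * N + N * J + C1) (ENNReal.add_ne_top.2 ⟨ENNReal.add_ne_top.2
      ⟨ENNReal.mul_ne_top (by simp) hN', ENNReal.mul_ne_top hN' hJtop⟩, hC1top⟩)
  have hsq : ∀ (i j : ι) (f : ι → ℝ → 𝕜), (∀ j, MemLp (f j) (ENNReal.ofReal (p j)) volume) →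
      β j = 0 → SqControlled N (2 * N + N * J + C1) (fun I => ‖if j = i then
        ncoef (fun x => (b x - dyadicAverage b I) * f j x) I (β j) else ncoef (f j) I (β j)‖ₑ)
        (smean s fun x => ‖f j x‖ₑ) := by
    intro i j f hf hβ
    have hloc := locallyIntegrable_of_memLp (hp1 j) (hf j)
    rw [hβ]
    by_cases hji : j = i
    · simp only [if_pos hji]
      exact (sqControlled_ncoef_sub_mul hb hloc (hbf j _ (hf j)) hs.le hN hN' hbL
        (lavg_sub_mul_le hb (hf j).1 hL0 hL hbL hts)).mono le_add_self
    · simp only [if_neg hji]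
      refine (sqControlled_ncoef hloc hs.le hN hN').mono ?_
      rw [add_assoc]; exact le_self_add
  refine ⟨K, hK, fun i f hf => h f _ (fun j => (hf j).1) (fun j => ?_) (hsq i k f hf hk)
    (hsq i l f hf hl)⟩
  by_cases hji : j = i
  · simp only [if_pos hji]
    refine (supControlled_ncoef_sub_mul hs.le hN hN'
      (lavg_sub_mul_le hb (hf j).1 hL0 hL hbL hts) (β j)).mono ?_
    rw [add_right_comm]; exact le_add_self
  · simp only [if_neg hji]
    refine (supControlled_ncoef (hf j).1 hs.le hN hN' (β j)).mono ?_
    rw [two_mul, add_assoc, add_assoc]; exact le_self_add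

end Forms

end

section

variable {𝕜 : Type*} [RCLike 𝕜]

/-! ### Bounds for the multiplier series -/

theorem enorm_finset_prod {ι : Type*} (s : Finset ι) (c : ι → 𝕜) :
    ‖∏ j ∈ s, c j‖ₑ = ∏ j ∈ s, ‖c j‖ₑ := by
  simp only [enorm_eq_nnnorm, nnnorm_prod, ENNReal.ofNNReal_finsetProd]

theorem enorm_sum_mul_le {M : ℝ≥0∞} {ε : DyadicInterval → 𝕜} (hε : ∀ I, ‖ε I‖ₑ ≤ M)
    (c : DyadicInterval → 𝕜) (F : Finset DyadicInterval) :
    ‖∑ I ∈ F, ε I * ((I.length : 𝕜) * c I)‖ₑ ≤ M * ∑' I, volume I.toSet * ‖c I‖ₑ := by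
  refine (enorm_sum_le _ _).trans ?_
  rw [← ENNReal.tsum_mul_left]
  refine le_trans (Finset.sum_le_sum fun I _ => ?_) (ENNReal.sum_le_tsum F)
  have h : ‖(I.length : 𝕜)‖ₑ = volume I.toSet := by
    rw [volume_toSet, ← ofReal_norm, RCLike.norm_ofReal, abs_of_pos I.length_pos]
  rw [enorm_mul, enorm_mul, h]
  exact mul_le_mul_left (hε I) _

section Sums

variable {m : ℕ}

/-- The exponents of the dual form. -/
def formExponent (p : Fin m → ℝ) (r : ℝ) : Option (Fin m) → ℝ
  | none => r.conjExponent
  | some j => p j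

/-- The functions of the dual form. -/
def formArg (f : Fin m → ℝ → 𝕜) (g : ℝ → 𝕜) : Option (Fin m) → ℝ → 𝕜
  | none => g
  | some j => f j

theorem one_lt_formExponent {p : Fin m → ℝ} {r : ℝ} (hp : ∀ j, 1 < p j) (hr : 1 < r) :
    ∀ k, 1 < formExponent p r k
  | none => (Real.HolderConjugate.conjExponent hr).symm.lt
  | some j => hp j

theorem sum_formExponent {p : Fin m → ℝ} {r : ℝ} (hr : 1 < r) (hpr : ∑ j, 1 / p j = 1 / r) :
    ∑ k, 1 / formExponent p r k = 1 := by
  rw [Fintype.sum_option]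
  change 1 / r.conjExponent + ∑ j, 1 / p j = 1
  rw [hpr, one_div, one_div, add_comm]
  exact (Real.HolderConjugate.conjExponent hr).inv_add_inv_eq_one

theorem memLp_formArg {p : Fin m → ℝ} {r : ℝ} {f : Fin m → ℝ → 𝕜} {g : ℝ → 𝕜}
    (hf : ∀ j, MemLp (f j) (ENNReal.ofReal (p j)) volume)
    (hg : MemLp g (ENNReal.ofReal r.conjExponent) volume) :
    ∀ k, MemLp (formArg f g k) (ENNReal.ofReal (formExponent p r k)) volume
  | none => hg
  | some j => hf j

theorem prod_formArg (p : Fin m → ℝ) (r : ℝ) (f : Fin m → ℝ → 𝕜) (g : ℝ → 𝕜) :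
    ∏ k, eLpNorm (formArg f g k) (ENNReal.ofReal (formExponent p r k)) volume =
      (∏ j, eLpNorm (f j) (ENNReal.ofReal (p j)) volume) *
        eLpNorm g (ENNReal.ofReal r.conjExponent) volume := by
  rw [Fintype.prod_option, mul_comm]
  rfl

theorem exists_eLpNorm_haarSum_le {α : Fin m → Fin 2} (hα : sigma0 α ≠ 0) {p : Fin m → ℝ} {r : ℝ}
    (hp : ∀ j, 1 < p j) (hr : 1 < r) (hpr : ∑ j, 1 / p j = 1 / r) {M : ℝ≥0∞} (hM : M ≠ ∞) :
    ∃ K : ℝ≥0∞, K ≠ ∞ ∧ ∀ ε : DyadicInterval → 𝕜, (∀ I, ‖ε I‖ₑ ≤ M) → ∀ f : Fin m → ℝ → 𝕜,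
      (∀ j, MemLp (f j) (ENNReal.ofReal (p j)) volume) → ∀ F : Finset DyadicInterval,
      eLpNorm (haarSum ε α f F) (ENNReal.ofReal r) volume ≤
        K * ∏ j, eLpNorm (f j) (ENNReal.ofReal (p j)) volume := by
  obtain ⟨k, l, hkl, hk, hl⟩ := exists_two_zeros hα
  obtain ⟨K, hK, h⟩ := exists_tsum_ncoef_le (𝕜 := 𝕜) (formType α) hkl hk hl
    (one_lt_formExponent hp hr) (sum_formExponent hr hpr)
  refine ⟨M * K, ENNReal.mul_ne_top hM hK, fun ε hε f hf F => ?_⟩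
  refine eLpNorm_le_of_forall_integral_mul_le (Real.HolderConjugate.conjExponent hr)
    (memLp_haarSum ε hα f F _) fun g hg => ?_
  have hgl := locallyIntegrable_of_memLp (Real.HolderConjugate.conjExponent hr).symm.lt hg
  simp_rw [mul_comm (haarSum ε α f F _)]
  rw [integral_mul_haarSum ε hα f F hgl]
  have h1 := enorm_sum_mul_le hε
    (fun I => ∏ k, ncoef (formArg f g k) I (formType α k)) F
  have h2 := h _ (memLp_formArg hf hg)
  rw [prod_formArg] at h2
  simp_rw [enorm_finset_prod] at h1
  have h3 := h1.trans (mul_le_mul_right h2 M)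
  rw [mul_assoc M, mul_assoc M, mul_assoc K]
  refine le_trans (le_of_eq ?_) h3
  congr 1
  refine Finset.sum_congr rfl fun I _ => ?_
  rw [Fintype.prod_option]
  simp only [formArg, formType]
  ring

theorem haarSum_congr (ε : DyadicInterval → 𝕜) (α : Fin m → Fin 2) {f g : Fin m → ℝ → 𝕜}
    {F : Finset DyadicInterval} (h : ∀ I ∈ F, ∀ j, ncoef (f j) I (α j) = ncoef (g j) I (α j)) :
    haarSum ε α f F = haarSum ε α g F := by
  funext x
  refine Finset.sum_congr rfl fun I hI => ?_
  rw [paraproductTerm_eq, paraproductTerm_eq, Finset.prod_congr rfl fun j _ => h I hI j]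

/-- The Cauchy criterion in `L^r`. For intervals outside `box n`, subtracting from `f_{j₀}` its
expansion over `box n` does not change its Haar coefficients when `α_{j₀} = 0`; the uniform bound
then has the small norm of the remainder as a factor. Convergence in `L^r` implies convergence in
measure. -/
theorem exists_hasDyadicSum {α : Fin m → Fin 2} (hα : sigma0 α ≠ 0) {p : Fin m → ℝ} {r : ℝ}
    (hp : ∀ j, 1 < p j) (hr : 1 < r) (hpr : ∑ j, 1 / p j = 1 / r) {M : ℝ≥0∞} (hM : M ≠ ∞)
    {ε : DyadicInterval → 𝕜} (hε : ∀ I, ‖ε I‖ₑ ≤ M) {f : Fin m → ℝ → 𝕜}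
    (hf : ∀ j, MemLp (f j) (ENNReal.ofReal (p j)) volume) :
    ∃ u, HasDyadicSum (fun I x => ε I * paraproductTerm α f I x) u := by
  classical
  obtain ⟨K, hK, hbound⟩ := exists_eLpNorm_haarSum_le (𝕜 := 𝕜) hα hp hr hpr hM
  have : Fact (1 ≤ ENNReal.ofReal r) :=
    ⟨by rw [← ENNReal.ofReal_one]; exact ENNReal.ofReal_le_ofReal hr.le⟩
  let T : DyadicInterval → Lp 𝕜 (ENNReal.ofReal r) (volume : Measure ℝ) := fun I =>
    (memLp_term ε hα f I _).toLp
  have hT : ∀ F : Finset DyadicInterval, (∑ I ∈ F, T I : Lp 𝕜 (ENNReal.ofReal r) volume) =ᵐ[volume]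
      haarSum ε α f F := by
    intro F
    have h1 : ∀ᵐ x, ∀ I, T I x = ε I * paraproductTerm α f I x :=
      ae_all_iff.2 fun I => (memLp_term ε hα f I _).coeFn_toLp
    filter_upwards [Lp.coeFn_finsetSum F T, h1] with x hx hx1
    rw [hx, Finset.sum_apply, haarSum]
    exact Finset.sum_congr rfl fun I _ => hx1 I
  have hsum : Summable T := by
    rw [summable_iff_vanishing_norm]
    intro δ hδ
    obtain ⟨j₀, hj₀⟩ := Finset.card_pos.1 (Nat.pos_of_ne_zero hα)
    replace hj₀ := (Finset.mem_filter.1 hj₀).2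
    have hlim := tendsto_eLpNorm_sub_sum_box (hp j₀) (hf j₀)
    set D : ℕ → ℝ → 𝕜 := fun n x => f j₀ x - ∑ I ∈ box n, haarPart (f j₀) I x with hD
    set A : ℝ≥0∞ := K * ∏ j ∈ Finset.univ.erase j₀, eLpNorm (f j) (ENNReal.ofReal (p j)) volume
    have hA : A ≠ ∞ := ENNReal.mul_ne_top hK (ENNReal.prod_ne_top fun j _ => (hf j).2.ne)
    have hlim2 : Tendsto (fun n => A * eLpNorm (D n) (ENNReal.ofReal (p j₀)) volume) atTop
        (𝓝 0) := by
      have := ENNReal.Tendsto.const_mul (a := A) hlim (Or.inr hA)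
      rwa [mul_zero] at this
    -- The second condition, finiteness of the norm, puts the remainder in `L^{p_{j₀}}`.
    obtain ⟨n, hn, hn'⟩ := ((hlim2.eventually (gt_mem_nhds (ENNReal.ofReal_pos.2 hδ))).and
      (hlim.eventually (gt_mem_nhds ENNReal.zero_lt_top))).exists
    refine ⟨box n, fun t ht => ?_⟩
    have hDn : MemLp (D n) (ENNReal.ofReal (p j₀)) volume :=
      ⟨(hf j₀).1.sub (aestronglyMeasurable_sum_haarPart _ _), hn'⟩
    have hb := hbound ε hε (Function.update f j₀ (D n)) (fun j => by
      by_cases hj : j = j₀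
      · subst hj; simpa using hDn
      · simpa [Function.update_of_ne hj] using hf j) t
    rw [← haarSum_congr ε α (f := f), ← Finset.mul_prod_erase _ _ (Finset.mem_univ j₀),
      Function.update_self, Finset.prod_congr rfl (g := fun j =>
        eLpNorm (f j) (ENNReal.ofReal (p j)) volume), mul_left_comm, mul_comm] at hb
    · rw [Lp.norm_def, eLpNorm_congr_ae (hT t)]
      exact ENNReal.toReal_lt_of_lt_ofReal (hb.trans_lt hn)
    · intro j hj
      rw [Function.update_of_ne (Finset.ne_of_mem_erase hj)]
    · intro I hI j
      by_cases hj : j = j₀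
      · subst hj
        rw [Function.update_self, hj₀]
        exact (ncoef_sub_sum_haarPart (locallyIntegrable_of_memLp (hp j) (hf j))
          (Finset.disjoint_left.1 ht hI)).symm
      · rw [Function.update_of_ne hj]
  obtain ⟨U, hU⟩ := hsum
  refine ⟨U, Lp.aestronglyMeasurable U, ?_⟩
  refine TendstoInMeasure.congr_left hT (tendstoInMeasure_of_tendsto_Lp ?_)
  simpa [HasSum] using hU

/-! ### Bounds for the commutators -/

/-- A finite partial sum of the series of the commutator. -/
def commSum (b : ℝ → 𝕜) (ε : DyadicInterval → 𝕜) (α : Fin m → Fin 2) (i : Fin m)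
    (f : Fin m → ℝ → 𝕜) (F : Finset DyadicInterval) (x : ℝ) : 𝕜 :=
  b x * haarSum ε α f F x - haarSum ε α (Function.update f i fun y => b y * f i y) F x

theorem ncoef_mul_eq {b f : ℝ → 𝕜} (hf : LocallyIntegrable f volume)
    (hbf : LocallyIntegrable (fun x => b x * f x) volume) (c : 𝕜) (I : DyadicInterval)
    (a : Fin 2) :
    ncoef (fun x => b x * f x) I a = ncoef (fun x => (b x - c) * f x) I a + c * ncoef f I a := by
  have h : ncoef (fun x => b x * f x - c * f x) I a = _ := ncoef_sub hbf (hf.smul c) I a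
  simp_rw [sub_mul]
  rw [h, ← ncoef_const_mul]
  exact (sub_add_cancel _ _).symm

theorem memLp_commSum {b : ℝ → 𝕜} {ε : DyadicInterval → 𝕜} {α : Fin m → Fin 2}
    (hα : sigma0 α ≠ 0) (i : Fin m) (f : Fin m → ℝ → 𝕜) (F : Finset DyadicInterval)
    {p t : ℝ≥0∞} (hpt : p ≤ t) (hb : MemLp b t volume) :
    MemLp (commSum b ε α i f F) p volume := by
  refine MemLp.sub ?_ (memLp_haarSum ε hα _ F p)
  simp_rw [mul_haarSum]
  refine memLp_finsetSum F fun I _ => MemLp.const_mul (memLp_mul_sgn_pow ?_ hb.1 hα) _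
  have : IsFiniteMeasure (volume.restrict I.toSet) :=
    ⟨by rw [Measure.restrict_apply_univ]; exact I.volume_ne_top.lt_top⟩
  exact (hb.restrict I.toSet).mono_exponent hpt

/-- By duality the commutator becomes a difference of two forms, with `b - ⟨b⟩_I` on the dual
function and on `f_i` respectively; each contributes one `K`. -/
theorem exists_eLpNorm_commSum_le {α : Fin m → Fin 2} (hα : sigma0 α ≠ 0) {p : Fin m → ℝ} {r : ℝ}
    (hr : 1 < r) (hpr : ∑ j, 1 / p j = 1 / r) {M : ℝ≥0∞} (hM : M ≠ ∞) {b : ℝ → 𝕜}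
    (hb : LocallyIntegrable b volume) {L : ℝ≥0∞} (hL0 : L ≠ 0) (hL : L ≠ ∞)
    (hbL : ∀ I, lavg (fun x => ‖b x - dyadicAverage b I‖ₑ) I ≤ L) {t : ℕ} {s : ℝ}
    (hts : (t : ℝ).HolderConjugate s) (hp : ∀ k, s < formExponent p r k) (hrt : r ≤ t)
    (hbt : MemLp b t volume)
    (hbf : ∀ k, ∀ f : ℝ → 𝕜, MemLp f (ENNReal.ofReal (formExponent p r k)) volume →
      LocallyIntegrable (fun x => b x * f x) volume) :
    ∃ K : ℝ≥0∞, K ≠ ∞ ∧ ∀ ε : DyadicInterval → 𝕜, (∀ I, ‖ε I‖ₑ ≤ M) → ∀ (i : Fin m)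
      (f : Fin m → ℝ → 𝕜), (∀ j, MemLp (f j) (ENNReal.ofReal (p j)) volume) →
      ∀ F : Finset DyadicInterval, eLpNorm (commSum b ε α i f F) (ENNReal.ofReal r) volume ≤
        K * ∏ j, eLpNorm (f j) (ENNReal.ofReal (p j)) volume := by
  classical
  obtain ⟨k, l, hkl, hk, hl⟩ := exists_two_zeros hα
  obtain ⟨K, hK, h⟩ := exists_tsum_ncoef_sub_mul_le (formType α) hkl hk hl
    (sum_formExponent hr hpr) hb hL0 hL hbL hts hp hbf
  refine ⟨M * (K + K), ENNReal.mul_ne_top hM (ENNReal.add_ne_top.2 ⟨hK, hK⟩),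
    fun ε hε i f hf F => ?_⟩
  have hs := hts.symm.lt
  refine eLpNorm_le_of_forall_integral_mul_le (Real.HolderConjugate.conjExponent hr)
    (memLp_commSum hα i f F (t := t) ?_ hbt) fun g hg => ?_
  · rw [← ENNReal.ofReal_natCast]; exact ENNReal.ofReal_le_ofReal hrt
  have hgl : LocallyIntegrable g volume := locallyIntegrable_of_memLp (hs.trans (hp none)) hg
  have hbg : LocallyIntegrable (fun x => b x * g x) volume := hbf none g hg
  have hfl : ∀ j, LocallyIntegrable (f j) volume := fun j =>
    locallyIntegrable_of_memLp (hs.trans (hp (some j))) (hf j)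
  have hbfi : LocallyIntegrable (fun x => b x * f i x) volume := hbf (some i) _ (hf i)
  set G := formArg f g with hG
  have hGm := memLp_formArg hf hg
  set c : Option (Fin m) → DyadicInterval → 𝕜 := fun k₀ I => ∏ k, if k = k₀ then
    ncoef (fun x => (b x - dyadicAverage b I) * G k x) I (formType α k)
      else ncoef (G k) I (formType α k) with hc
  -- Splitting `b` as `(b - ⟨b⟩_I) + ⟨b⟩_I` in both terms, the parts with the constant `⟨b⟩_I`
  -- cancel.
  have key : ∫ x, commSum b ε α i f F x * g x =
      ∑ I ∈ F, ε I * ((I.length : 𝕜) * c none I) -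
        ∑ I ∈ F, ε I * ((I.length : 𝕜) * c (some i) I) := by
    have h1 : ∀ x, commSum b ε α i f F x * g x = (b x * g x) * haarSum ε α f F x -
        g x * haarSum ε α (Function.update f i fun y => b y * f i y) F x := fun x => by
      rw [commSum]; ring
    simp_rw [h1]
    rw [integral_sub (integrable_mul_haarSum ε hα f F hbg) (integrable_mul_haarSum ε hα _ F hgl),
      integral_mul_haarSum ε hα f F hbg, integral_mul_haarSum ε hα _ F hgl,
      ← Finset.sum_sub_distrib, ← Finset.sum_sub_distrib]
    refine Finset.sum_congr rfl fun I _ => ?_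
    have hupd : ∏ j, ncoef (Function.update f i (fun y => b y * f i y) j) I (α j) =
        ncoef (fun y => b y * f i y) I (α i) *
          ∏ j ∈ Finset.univ.erase i, ncoef (f j) I (α j) := by
      rw [← Finset.mul_prod_erase _ _ (Finset.mem_univ i), Function.update_self]
      congr 1
      exact Finset.prod_congr rfl fun j hj => by
        rw [Function.update_of_ne (Finset.ne_of_mem_erase hj)]
    have hn : c none I = ncoef (fun x => (b x - dyadicAverage b I) * g x) I (parity (sigma0 α)) *
        (ncoef (f i) I (α i) * ∏ j ∈ Finset.univ.erase i, ncoef (f j) I (α j)) := by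
      rw [hc, Finset.mul_prod_erase _ (fun j => ncoef (f j) I (α j)) (Finset.mem_univ i)]
      simp only [Fintype.prod_option, if_true, reduceCtorEq, if_false]
      rfl
    have hs : c (some i) I = ncoef g I (parity (sigma0 α)) *
        (ncoef (fun x => (b x - dyadicAverage b I) * f i x) I (α i) *
          ∏ j ∈ Finset.univ.erase i, ncoef (f j) I (α j)) := by
      rw [hc]
      simp only [Fintype.prod_option, reduceCtorEq, if_false, Option.some_inj]
      rw [← Finset.mul_prod_erase _ _ (Finset.mem_univ i), if_pos rfl]
      congr 2
      exact Finset.prod_congr rfl fun j hj => by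
        rw [if_neg (Finset.ne_of_mem_erase hj)]; rfl
    rw [hupd, hn, hs, ← Finset.mul_prod_erase _ _ (Finset.mem_univ i),
      ncoef_mul_eq hgl hbg (dyadicAverage b I), ncoef_mul_eq (hfl i) hbfi (dyadicAverage b I)]
    generalize ncoef (fun x => (b x - dyadicAverage b I) * g x) I (parity (sigma0 α)) = X
    generalize ncoef (fun x => (b x - dyadicAverage b I) * f i x) I (α i) = Y
    ring
  rw [key]
  have hk : ∀ k₀, ‖∑ I ∈ F, ε I * ((I.length : 𝕜) * c k₀ I)‖ₑ ≤
      M * (K * ((∏ j, eLpNorm (f j) (ENNReal.ofReal (p j)) volume) *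
        eLpNorm g (ENNReal.ofReal r.conjExponent) volume)) := by
    intro k₀
    refine (enorm_sum_mul_le hε (c k₀) F).trans (mul_le_mul_right ?_ M)
    have h2 := h k₀ G hGm
    rw [hG, prod_formArg] at h2
    simp_rw [hc, enorm_finset_prod]
    exact h2
  refine (enorm_sub_le).trans ((add_le_add (hk _) (hk _)).trans_eq ?_)
  ring

end Sums

end

section

variable {𝕜 : Type*} [RCLike 𝕜]

/-! ### Membership in the values of the operators -/

theorem hasDyadicSum_of_mem {U : DyadicInterval → ℝ → 𝕜} {g : ℝ → 𝕜} (hg : g ∈ dyadicSum U) :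
    HasDyadicSum U g := by
  obtain ⟨h, rfl⟩ := hg
  exact h.choose_spec

theorem exists_mem_dyadicSum {U : DyadicInterval → ℝ → 𝕜} {g : ℝ → 𝕜} (hg : HasDyadicSum U g) :
    ∃ u, u ∈ dyadicSum U :=
  ⟨_, Part.get_mem (o := dyadicSum U) ⟨g, hg⟩⟩

theorem mem_haarMultiplier_iff {m : ℕ} {ε : DyadicInterval → 𝕜} {α : Fin m → Fin 2}
    {f : Fin m → ℝ → 𝕜} {g : ℝ → 𝕜} : g ∈ haarMultiplier ε α f ↔
      (∀ j, LocallyIntegrable (f j) volume) ∧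
        g ∈ dyadicSum fun I x => ε I * paraproductTerm α f I x := by
  rw [haarMultiplier, Part.mem_assert_iff, exists_prop]

theorem paraproduct_eq_haarMultiplier {m : ℕ} (α : Fin m → Fin 2) :
    (paraproduct α : PartialOperator 𝕜 m) = haarMultiplier (fun _ => 1) α := by
  funext f
  simp only [paraproduct, haarMultiplier, one_mul]

theorem mem_dyadicCommutator_iff {m : ℕ} {b : ℝ → 𝕜} {T : PartialOperator 𝕜 m} {i : Fin m}
    {f : Fin m → ℝ → 𝕜} {g : ℝ → 𝕜} : g ∈ dyadicCommutator b T i f ↔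
      ∃ u ∈ T f, ∃ v ∈ T (Function.update f i fun x => b x * f i x),
        (fun x => b x * u x - v x) = g := by
  rw [dyadicCommutator, Part.mem_bind_iff]
  simp_rw [Part.mem_map_iff]

/-- The boxes replace the net of finite sets by a sequence, so that a common almost everywhere
convergent subsequence can be extracted. -/
theorem exists_box_tendsto_ae {U V : DyadicInterval → ℝ → 𝕜} {u v : ℝ → 𝕜}
    (hu : HasDyadicSum U u) (hv : HasDyadicSum V v) :
    ∃ ns : ℕ → ℕ, Tendsto ns atTop atTop ∧ ∀ᵐ x,
      Tendsto (fun n => ∑ I ∈ box (ns n), U I x) atTop (𝓝 (u x)) ∧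
      Tendsto (fun n => ∑ I ∈ box (ns n), V I x) atTop (𝓝 (v x)) := by
  have hu' : TendstoInMeasure volume (fun n x => ∑ I ∈ box n, U I x) atTop u := fun δ hδ =>
    (hu.2 δ hδ).comp tendsto_box
  obtain ⟨ns, hns, h1⟩ := hu'.exists_seq_tendsto_ae
  have hv' : TendstoInMeasure volume (fun n x => ∑ I ∈ box (ns n), V I x) atTop v := fun δ hδ =>
    (hv.2 δ hδ).comp (tendsto_box.comp hns.tendsto_atTop)
  obtain ⟨ms, hms, h2⟩ := hv'.exists_seq_tendsto_ae
  refine ⟨ns ∘ ms, hns.tendsto_atTop.comp hms.tendsto_atTop, ?_⟩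
  filter_upwards [h1, h2] with x hx1 hx2
  exact ⟨hx1.comp hms.tendsto_atTop, hx2⟩

/-! ### Sufficiency -/

theorem _root_.MemDyadicBMO.exists_lavg_le {b : ℝ → 𝕜} (hb : MemDyadicBMO b) :
    ∃ L : ℝ≥0∞, L ≠ 0 ∧ L ≠ ∞ ∧ ∀ I, lavg (fun x => ‖b x - dyadicAverage b I‖ₑ) I ≤ L := by
  obtain ⟨hloc, C, hC⟩ := hb
  -- The maximum with `1` keeps the John–Nirenberg step size nonzero.
  refine ⟨ENNReal.ofReal (max C 1), by simp, by simp, fun I => ?_⟩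
  have h := hC ⟨I, rfl⟩
  simp only at h
  have hint : IntegrableOn (fun x => b x - dyadicAverage b I) I.toSet volume :=
    (locallyIntegrable_sub_const hloc _).integrableOn_toSet I
  rw [lavg_le_iff, volume_toSet, mul_comm, ← ofReal_integral_norm_eq_lintegral_enorm hint,
    ← ENNReal.ofReal_mul I.length_pos.le]
  refine ENNReal.ofReal_le_ofReal ?_
  rw [inv_mul_le_iff₀ I.length_pos] at h
  exact h.trans (mul_le_mul_of_nonneg_left (le_max_left _ _) I.length_pos.le)

theorem memLp_mul_of_one_div_add {b f : ℝ → 𝕜} {t p x : ℝ} (ht : 0 < t) (hp : 0 < p)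
    (hx : 0 < x) (h : 1 / t + 1 / p = 1 / x) (hb : MemLp b (ENNReal.ofReal t) volume)
    (hf : MemLp f (ENNReal.ofReal p) volume) :
    MemLp (fun y => b y * f y) (ENNReal.ofReal x) volume := by
  have : ENNReal.HolderTriple (ENNReal.ofReal t) (ENNReal.ofReal p) (ENNReal.ofReal x) := ⟨by
    rw [← ENNReal.ofReal_inv_of_pos ht, ← ENNReal.ofReal_inv_of_pos hp,
      ← ENNReal.ofReal_inv_of_pos hx, ← ENNReal.ofReal_add (by positivity) (by positivity)]
    congr 1
    simpa using h⟩
  exact hf.mul' hb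

theorem exists_exponent_mul {t p : ℝ} (ht : 1 < t) (hp : 1 < p) (h : p.conjExponent < t) :
    ∃ x, 1 < x ∧ 1 / t + 1 / p = 1 / x := by
  have hc := Real.HolderConjugate.conjExponent hp
  have hc0 := hc.symm.pos
  have h1 := hc.inv_add_inv_eq_one
  have h2 : t⁻¹ < p.conjExponent⁻¹ := inv_strictAnti₀ hc0 h
  have h3 : t⁻¹ + p⁻¹ < 1 := by linarith
  have h4 : 0 < t⁻¹ + p⁻¹ := by positivity
  exact ⟨(t⁻¹ + p⁻¹)⁻¹, (one_lt_inv₀ h4).2 h3, by simp⟩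

theorem conjExponent_lt {t p : ℝ} (ht : 1 < t) (hp : 1 < p) (h : p.conjExponent < t) :
    t.conjExponent < p := by
  have hp' := (Real.HolderConjugate.conjExponent hp).inv_add_inv_eq_one
  have ht' := (Real.HolderConjugate.conjExponent ht).inv_add_inv_eq_one
  have h2 : t⁻¹ < p.conjExponent⁻¹ :=
    inv_strictAnti₀ (Real.HolderConjugate.conjExponent hp).symm.pos h
  rw [← inv_lt_inv₀ (by linarith) (Real.HolderConjugate.conjExponent ht).symm.pos]
  linarith

variable {m : ℕ}

/-- The two series converge separately, possibly in different Lebesgue spaces; only their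
combination is bounded in `L^r`, by passing to the limit in the bound for finite sums. -/
theorem isBoundedOperator_commutator {α : Fin m → Fin 2} (hα : sigma0 α ≠ 0) (i : Fin m)
    {p : Fin m → ℝ} {r : ℝ} (hp : ∀ j, 1 < p j) (hr : 1 < r) (hpr : ∑ j, 1 / p j = 1 / r)
    {b : ℝ → 𝕜} {q : ℝ} (hq : 1 < q) (hbq : MemLp b (ENNReal.ofReal q) volume)
    (hb : MemDyadicBMO b) {ε : DyadicInterval → 𝕜} {M : ℝ} (hε : ∀ I, ‖ε I‖ ≤ M) :
    IsBoundedOperator (dyadicCommutator b (haarMultiplier ε α) i) p r := by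
  obtain ⟨L, hL0, hL, hbL⟩ := hb.exists_lavg_le
  have hε' : ∀ I, ‖ε I‖ₑ ≤ ENNReal.ofReal M := fun I => by
    rw [← ofReal_norm]; exact ENNReal.ofReal_le_ofReal (hε I)
  have hP := one_lt_formExponent hp hr
  -- A large `t` keeps `b` in `L^t`, makes the conjugate `s` of `t` smaller than every exponent of
  -- the form, and makes the Hölder exponents of products with `b` exceed `1`.
  obtain ⟨t, htq, htr, ht2, htr', htP⟩ : ∃ t : ℕ, q ≤ t ∧ r ≤ t ∧ (1 : ℝ) < t ∧
      r.conjExponent < t ∧ ∀ k, (formExponent p r k).conjExponent < t := by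
    have hlt : ∀ c : ℝ, ∀ᶠ t : ℕ in atTop, c < t := fun c =>
      tendsto_natCast_atTop_atTop.eventually_gt_atTop c
    have := (hlt q).and ((hlt r).and ((hlt 1).and ((hlt r.conjExponent).and
      (eventually_all.2 fun k => hlt (formExponent p r k).conjExponent))))
    obtain ⟨t, h1, h2, h3, h4, h5⟩ := this.exists
    exact ⟨t, h1.le, h2.le, h3, h4, h5⟩
  have ht0 : (0 : ℝ) < t := by linarith
  have hbt := memLp_of_memLp_of_oscillation hq.le hbq hL0 hL hbL htq
  have hbt' : MemLp b (ENNReal.ofReal t) volume := by rwa [ENNReal.ofReal_natCast]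
  have hbf : ∀ k, ∀ f : ℝ → 𝕜, MemLp f (ENNReal.ofReal (formExponent p r k)) volume →
      LocallyIntegrable (fun x => b x * f x) volume := fun k f hf => by
    obtain ⟨x, hx1, hx⟩ := exists_exponent_mul ht2 (hP k) (htP k)
    exact locallyIntegrable_of_memLp hx1 (memLp_mul_of_one_div_add ht0
      (one_pos.trans (hP k)) (one_pos.trans hx1) hx hbt' hf)
  obtain ⟨K, hK, hbound⟩ := exists_eLpNorm_commSum_le hα hr hpr (M := ENNReal.ofReal M) (by simp)
    hb.1 hL0 hL hbL (Real.HolderConjugate.conjExponent ht2)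
    (fun k => conjExponent_lt ht2 (hP k) (htP k)) htr hbt hbf
  refine ⟨K.toNNReal, fun f hf => ?_⟩
  have hfl : ∀ j, LocallyIntegrable (f j) volume := fun j =>
    locallyIntegrable_of_memLp (hp j) (hf j)
  obtain ⟨u₀, hu₀⟩ := exists_hasDyadicSum hα hp hr hpr (M := ENNReal.ofReal M) (by simp) hε' hf
  obtain ⟨u, hu⟩ := exists_mem_dyadicSum hu₀
  have hfbl : ∀ j, LocallyIntegrable (Function.update f i (fun x => b x * f i x) j) volume := by
    intro j
    by_cases hj : j = i
    · subst hj; rw [Function.update_self]; exact hbf (some j) _ (hf j)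
    · rw [Function.update_of_ne hj]; exact hfl j
  obtain ⟨x, hx1, hx⟩ := exists_exponent_mul ht2 (hp i) (htP (some i))
  obtain ⟨y, hy1, hy⟩ := exists_exponent_mul ht2 hr htr'
  -- Multiplying `f_i` by `b ∈ L^t` adds `1 / t` to the reciprocal of its exponent, hence also to
  -- that of the target: `1 / y = 1 / t + 1 / r`.
  obtain ⟨v₀, hv₀⟩ := exists_hasDyadicSum (p := Function.update p i x) (r := y) hα (fun j => by
      by_cases hj : j = i
      · subst hj; rwa [Function.update_self]
      · rw [Function.update_of_ne hj]; exact hp j) hy1 (by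
      rw [← hy, ← hpr, ← Finset.add_sum_erase _ _ (Finset.mem_univ i),
        ← Finset.add_sum_erase _ (fun j => 1 / p j) (Finset.mem_univ i), Function.update_self,
        ← hx, add_assoc]
      congr 2
      exact Finset.sum_congr rfl fun j hj => by
        rw [Function.update_of_ne (Finset.ne_of_mem_erase hj)]) (M := ENNReal.ofReal M) (by simp)
    hε' (f := Function.update f i fun x => b x * f i x) (fun j => by
      by_cases hj : j = i
      · subst hj
        rw [Function.update_self, Function.update_self]
        exact memLp_mul_of_one_div_add ht0 (one_pos.trans (hp j)) (one_pos.trans hx1) hx hbt' (hf j)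
      · rw [Function.update_of_ne hj, Function.update_of_ne hj]; exact hf j)
  obtain ⟨v, hv⟩ := exists_mem_dyadicSum hv₀
  have hU := hasDyadicSum_of_mem hu
  have hV := hasDyadicSum_of_mem hv
  have hle : eLpNorm (fun x => b x * u x - v x) (ENNReal.ofReal r) volume ≤
      K * ∏ j, eLpNorm (f j) (ENNReal.ofReal (p j)) volume := by
    obtain ⟨ns, -, hns⟩ := exists_box_tendsto_ae hU hV
    refine Lp.eLpNorm_le_of_ae_tendsto (u := atTop) (f := fun n => commSum b ε α i f (box (ns n)))
      (Eventually.of_forall fun n => hbound ε hε' i f hf _)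
      (fun n => (memLp_commSum hα i f (box (ns n)) le_rfl hbt).1) ?_
    filter_upwards [hns] with x hx
    exact (hx.1.const_mul (b x)).sub hx.2
  refine ⟨_, mem_dyadicCommutator_iff.2 ⟨u, mem_haarMultiplier_iff.2 ⟨hfl, hu⟩, v,
    mem_haarMultiplier_iff.2 ⟨hfbl, hv⟩, rfl⟩, ⟨(hbq.1.mul hU.1).sub hV.1, hle.trans_lt ?_⟩, ?_⟩
  · exact ENNReal.mul_lt_top hK.lt_top (ENNReal.prod_ne_top fun j _ => (hf j).2.ne).lt_top
  · rwa [ENNReal.coe_toNNReal hK]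

end

section

variable {𝕜 : Type*} [RCLike 𝕜]

/-! ### Necessity -/

theorem memDyadicBMO_of_lavg_le {b : ℝ → 𝕜} (hb : LocallyIntegrable b volume) {L : ℝ≥0∞}
    (hL : L ≠ ∞) (h : ∀ I, lavg (fun x => ‖b x - dyadicAverage b I‖ₑ) I ≤ L) :
    MemDyadicBMO b := by
  refine ⟨hb, L.toReal, ?_⟩
  rintro _ ⟨I, rfl⟩
  have hint : IntegrableOn (fun x => b x - dyadicAverage b I) I.toSet volume :=
    (locallyIntegrable_sub_const hb _).integrableOn_toSet I
  have h1 := lavg_le_iff.1 (h I)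
  rw [volume_toSet, mul_comm, ← ofReal_integral_norm_eq_lintegral_enorm hint,
    ← ENNReal.ofReal_toReal hL, ← ENNReal.ofReal_mul I.length_pos.le,
    ENNReal.ofReal_le_ofReal_iff (mul_nonneg I.length_pos.le ENNReal.toReal_nonneg)] at h1
  simp only
  rwa [inv_mul_le_iff₀ I.length_pos]

/-- Jensen turns an `L^r` bound of size `V ^ (1 / r)` into a bound for the average. The factor `2`
in `V ≤ 2 |J|` allows the test interval to be the parent of `J`. -/
theorem lavg_le_of_eLpNorm_le {h g : ℝ → 𝕜} (hh : AEStronglyMeasurable h volume)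
    {J : DyadicInterval} (hg : ∀ᵐ x, x ∈ J.toSet → ‖h x‖ₑ ≤ ‖g x‖ₑ) {r : ℝ} (hr : 1 < r)
    {C V : ℝ≥0∞} (hV : V ≤ 2 * volume J.toSet)
    (hgC : eLpNorm g (ENNReal.ofReal r) volume ≤ C * V ^ (1 / r)) :
    lavg (fun x => ‖h x‖ₑ) J ≤ 2 * C := by
  have hr0 : 0 < r := by linarith
  rw [eLpNorm_ofReal_eq g hr0] at hgC
  have h1 : ∫⁻ x, ‖g x‖ₑ ^ r ≤ C ^ r * V := by
    have := ENNReal.rpow_le_rpow hgC hr0.le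
    rwa [ENNReal.mul_rpow_of_nonneg _ _ hr0.le, ← ENNReal.rpow_mul, ← ENNReal.rpow_mul,
      one_div_mul_cancel hr0.ne', ENNReal.rpow_one, ENNReal.rpow_one] at this
  refine (lavg_le_smean hr.le hh.enorm J).trans ?_
  have h2 : lavg (fun x => ‖h x‖ₑ ^ r) J ≤ 2 * C ^ r := by
    rw [lavg_le_iff]
    calc ∫⁻ x in J.toSet, ‖h x‖ₑ ^ r ≤ ∫⁻ x in J.toSet, ‖g x‖ₑ ^ r := by
          refine lintegral_mono_ae ((ae_restrict_iff' J.measurableSet_toSet).2 ?_)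
          filter_upwards [hg] with x hx hxJ
          exact ENNReal.rpow_le_rpow (hx hxJ) hr0.le
      _ ≤ ∫⁻ x, ‖g x‖ₑ ^ r := setLIntegral_le_lintegral _ _
      _ ≤ C ^ r * (2 * volume J.toSet) := h1.trans (mul_le_mul_right hV _)
      _ = 2 * C ^ r * volume J.toSet := by ring
  calc smean r (fun x => ‖h x‖ₑ) J ≤ (2 * C ^ r) ^ (1 / r) :=
        ENNReal.rpow_le_rpow h2 (by positivity)
    _ = 2 ^ (1 / r) * C := by
        rw [ENNReal.mul_rpow_of_nonneg _ _ (by positivity), ← ENNReal.rpow_mul,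
          mul_one_div_cancel hr0.ne', ENNReal.rpow_one]
    _ ≤ 2 ^ (1 : ℝ) * C := by
        refine mul_le_mul_left (ENNReal.rpow_le_rpow_of_exponent_le (by norm_num) ?_) _
        rw [div_le_one hr0]; exact hr.le
    _ = 2 * C := by rw [ENNReal.rpow_one]

theorem eLpNorm_sgn_pow_le (I : DyadicInterval) {n : ℕ} (hn : n ≠ 0) {p : ℝ} (hp : 0 < p) :
    eLpNorm (fun x => (I.sgn x : 𝕜) ^ n) (ENNReal.ofReal p) volume ≤
      volume I.toSet ^ (1 / p) := by
  rw [eLpNorm_ofReal_eq _ hp]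
  refine ENNReal.rpow_le_rpow ?_ (by positivity)
  rw [← lintegral_indicator_one I.measurableSet_toSet]
  refine lintegral_mono fun x => ?_
  by_cases hx : x ∈ I.toSet
  · rw [Set.indicator_of_mem hx, Pi.one_apply, ← ENNReal.one_rpow p]
    refine ENNReal.rpow_le_rpow ?_ hp.le
    rw [← ofReal_norm, ← ENNReal.ofReal_one]
    exact ENNReal.ofReal_le_ofReal (norm_sgn_pow_le I n x)
  · simp only
    rw [← RCLike.ofReal_pow, sgn_pow_of_notMem hn hx]
    simp [hp]

theorem prod_rpow_eq {ι : Type*} (s : Finset ι) (a : ι → ℝ) {x : ℝ≥0∞} (hx : x ≠ 0)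
    (hx' : x ≠ ∞) : ∏ j ∈ s, x ^ a j = x ^ ∑ j ∈ s, a j := by
  classical
  induction s using Finset.induction_on with
  | empty => simp
  | insert j s hj ih => rw [Finset.prod_insert hj, Finset.sum_insert hj, ENNReal.rpow_add _ _ hx hx',
      ih]

theorem dyadicAverage_sgn_eq_zero {I J : DyadicInterval} (h : J.toSet ⊆ I.toSet) :
    dyadicAverage (fun x => (J.sgn x : 𝕜)) I = 0 := by
  have h1 : ∫ x in I.toSet, (J.sgn x : 𝕜) = ∫ x, (1 : 𝕜) * (J.sgn x : 𝕜) := by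
    simp_rw [one_mul]
    refine setIntegral_eq_integral_of_forall_compl_eq_zero fun x hx => ?_
    rw [sgn_of_notMem fun hJ => hx (h hJ), RCLike.ofReal_zero]
  rw [dyadicAverage, h1, integral_mul_sgn (fun _ => (1 : 𝕜)),
    ncoef_zero_eq_children (locallyIntegrable_const 1), dyadicAverage_const, dyadicAverage_const,
    sub_self, smul_zero, smul_zero, smul_zero]

theorem ncoef_sgn_pow_self (b : ℝ → 𝕜) (I : DyadicInterval) (a : Fin 2) :
    ncoef (fun x => b x * (I.sgn x : 𝕜) ^ (if a = 0 then 1 else 2)) I a = dyadicAverage b I := by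
  rw [ncoef]
  split_ifs
  · refine dyadicAverage_congr fun x hx => ?_
    rw [pow_one, mul_assoc, ← RCLike.ofReal_mul, ← sq, sgn_sq_of_mem hx, RCLike.ofReal_one, mul_one]
  · refine dyadicAverage_congr fun x hx => ?_
    rw [← RCLike.ofReal_pow, sgn_sq_of_mem hx, RCLike.ofReal_one, mul_one]

variable {m : ℕ}

/-- A bounded commutator, tested on functions of modulus `1` on an interval. -/
theorem exists_eLpNorm_test_le {α : Fin m → Fin 2} {i : Fin m}
    {p : Fin m → ℝ} {r : ℝ} (hp : ∀ j, 1 < p j) (hpr : ∑ j, 1 / p j = 1 / r)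
    {b : ℝ → 𝕜} (H : IsBoundedOperator (dyadicCommutator b (paraproduct α) i) p r) :
    ∃ C : ℝ≥0∞, C ≠ ∞ ∧ ∀ (Q : DyadicInterval) (e : Fin m → ℕ), (∀ j, e j ≠ 0) →
      ∃ u v : ℝ → 𝕜,
        eLpNorm (fun x => b x * u x - v x) (ENNReal.ofReal r) volume ≤
          C * volume Q.toSet ^ (1 / r) ∧
        ∃ ns : ℕ → ℕ, Tendsto ns atTop atTop ∧ ∀ᵐ x,
          Tendsto (fun n => ∑ I ∈ box (ns n), paraproductTerm α
            (fun j y => (Q.sgn y : 𝕜) ^ e j) I x) atTop (𝓝 (u x)) ∧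
          Tendsto (fun n => ∑ I ∈ box (ns n), paraproductTerm α
            (Function.update (fun j y => (Q.sgn y : 𝕜) ^ e j) i
              fun y => b y * (Q.sgn y : 𝕜) ^ e i) I x) atTop (𝓝 (v x)) := by
  obtain ⟨C, hC⟩ := H
  refine ⟨C, by simp, fun Q e he => ?_⟩
  obtain ⟨g, hg, -, hle⟩ := hC (fun j y => (Q.sgn y : 𝕜) ^ e j)
    fun j => memLp_sgn_pow _ Q (he j)
  rw [paraproduct_eq_haarMultiplier, mem_dyadicCommutator_iff] at hg
  obtain ⟨u, hu, v, hv, rfl⟩ := hg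
  obtain ⟨ns, hns, h⟩ := exists_box_tendsto_ae
    (hasDyadicSum_of_mem (mem_haarMultiplier_iff.1 hu).2)
    (hasDyadicSum_of_mem (mem_haarMultiplier_iff.1 hv).2)
  refine ⟨u, v, hle.trans (mul_le_mul_right ?_ _), ns, hns, by simpa only [one_mul] using h⟩
  rw [← hpr, ← prod_rpow_eq _ _ Q.volume_ne_zero Q.volume_ne_top]
  exact Finset.prod_le_prod' fun j _ => eLpNorm_sgn_pow_le Q (he j) (one_pos.trans (hp j))

/-- Slot `k` holds `sgn_Q` in both series, untouched by `b`, so orthogonality leaves only `I = Q`.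
There every test coefficient is `1`, and the one with `b` is `⟨b⟩_Q`. -/
theorem lavg_le_of_exists_zero_ne {α : Fin m → Fin 2} {i k : Fin m}
    (hk : k ≠ i) (hαk : α k = 0) {r : ℝ} (hr : 1 < r) {b : ℝ → 𝕜}
    (hb : LocallyIntegrable b volume) (Q : DyadicInterval) {C : ℝ≥0∞} {u v : ℝ → 𝕜}
    (hC : eLpNorm (fun x => b x * u x - v x) (ENNReal.ofReal r) volume ≤
      C * volume Q.toSet ^ (1 / r)) {ns : ℕ → ℕ} (hns : Tendsto ns atTop atTop)
    (h : ∀ᵐ x, Tendsto (fun n => ∑ I ∈ box (ns n), paraproductTerm α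
        (fun j y => (Q.sgn y : 𝕜) ^ (if α j = 0 then 1 else 2)) I x) atTop (𝓝 (u x)) ∧
      Tendsto (fun n => ∑ I ∈ box (ns n), paraproductTerm α
        (Function.update (fun j y => (Q.sgn y : 𝕜) ^ (if α j = 0 then 1 else 2)) i
          fun y => b y * (Q.sgn y : 𝕜) ^ (if α i = 0 then 1 else 2)) I x) atTop (𝓝 (v x))) :
    lavg (fun x => ‖b x - dyadicAverage b Q‖ₑ) Q ≤ 2 * C := by
  have hlim : ∀ {f : Fin m → ℝ → 𝕜} {c w : 𝕜} {x : ℝ},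
      (f k = fun y => (Q.sgn y : 𝕜)) → (∏ j, ncoef (f j) Q (α j) = c) →
      Tendsto (fun n => ∑ I ∈ box (ns n), paraproductTerm α f I x) atTop (𝓝 w) →
      w = c * (Q.sgn x : 𝕜) ^ sigma0 α := by
    intro f c w x hfk hc hw
    refine tendsto_nhds_unique hw (tendsto_const_nhds.congr' ?_)
    filter_upwards [hns.eventually (eventually_mem_box Q)] with n hn
    rw [Finset.sum_eq_single Q, paraproductTerm_eq, hc]
    · intro I _ hI
      rw [paraproductTerm_eq, Finset.prod_eq_zero (Finset.mem_univ k), zero_mul]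
      rw [hfk, hαk]
      exact ncoef_sgn_of_ne hI
    · exact fun h => absurd hn h
  have h1 : ∀ j, ncoef (fun y => (Q.sgn y : 𝕜) ^ (if α j = 0 then 1 else 2)) Q (α j) = 1 :=
    fun j => by
      have := ncoef_sgn_pow_self (fun _ => (1 : 𝕜)) Q (α j)
      simpa only [one_mul, dyadicAverage_const] using this
  refine lavg_le_of_eLpNorm_le (locallyIntegrable_sub_const hb _).aestronglyMeasurable ?_ hr
    (by rw [two_mul]; exact le_self_add) hC
  filter_upwards [h] with x ⟨hx1, hx2⟩ hxQ
  rw [hlim (by simp [hαk]) (Finset.prod_eq_one fun j _ => h1 j) hx1,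
    hlim (c := dyadicAverage b Q) (by rw [Function.update_of_ne hk]; simp [hαk]) ?_ hx2,
    one_mul, ← sub_mul, enorm_mul, ← RCLike.ofReal_pow, ← ofReal_norm ((_ : ℝ) : 𝕜),
    RCLike.norm_ofReal, abs_pow, abs_sgn_of_mem hxQ, one_pow, ENNReal.ofReal_one, mul_one]
  rw [← Finset.mul_prod_erase _ _ (Finset.mem_univ i), Function.update_self, ncoef_sgn_pow_self,
    Finset.prod_eq_one, mul_one]
  intro j hj
  rw [Function.update_of_ne (Finset.ne_of_mem_erase hj)]
  exact h1 j

/-- No dyadic interval lies strictly between a child and its parent. -/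
theorem subset_of_mem_child {Q J I : DyadicInterval} (hJ : J = Q.lchild ∨ J = Q.rchild) {x : ℝ}
    (hxJ : x ∈ J.toSet) (hxI : x ∈ I.toSet) (hIJ : ¬ I.toSet ⊆ J.toSet) :
    Q.toSet ⊆ I.toSet := by
  have hxQ : x ∈ Q.toSet := by
    rcases hJ with rfl | rfl
    · exact Q.lchild_subset hxJ
    · exact Q.rchild_subset hxJ
  rcases le_total I.scale Q.scale with h | h
  · exact (disjoint_or_subset h).resolve_left fun hd => Set.disjoint_left.1 hd hxQ hxI
  · have hs : I.toSet ⊆ Q.toSet :=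
      (disjoint_or_subset h).resolve_left fun hd => Set.disjoint_left.1 hd hxI hxQ
    by_cases hIQ : I = Q
    · rw [hIQ]
    · exfalso
      have hd : x ∈ Q.lchild.toSet → x ∉ Q.rchild.toSet := fun h =>
        Set.disjoint_left.1 Q.disjoint_children h
      rcases hJ with rfl | rfl <;> rcases subset_child hs hIQ with h' | h'
      · exact hIJ h'
      · exact hd hxJ (h' hxI)
      · exact hd (h' hxI) hxJ
      · exact hIJ h'

/-- The only Haar slot is the one `b` enters, so slot `k` has to localise through an average:
`⟨sgn_Q⟩_I = 0` kills every `I ⊇ Q`, while inside a half `J` of `Q` the two factors `sgn_Q` multiply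
to `1` and the Haar expansion of `b` below `J` remains. -/
theorem lavg_le_of_unique_zero {α : Fin m → Fin 2} {i k : Fin m} (hk : k ≠ i) (hαi : α i = 0)
    (hα1 : ∀ j, j ≠ i → α j = 1) {r : ℝ} (hr : 1 < r) {b : ℝ → 𝕜}
    (hb : LocallyIntegrable b volume) {Q J : DyadicInterval} (hJ : J = Q.lchild ∨ J = Q.rchild)
    {C : ℝ≥0∞} {u v : ℝ → 𝕜}
    (hC : eLpNorm (fun x => b x * u x - v x) (ENNReal.ofReal r) volume ≤
      C * volume Q.toSet ^ (1 / r)) {ns : ℕ → ℕ} (hns : Tendsto ns atTop atTop)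
    (h : ∀ᵐ x, Tendsto (fun n => ∑ I ∈ box (ns n), paraproductTerm α
        (fun j y => (Q.sgn y : 𝕜) ^ (if j = i ∨ j = k then 1 else 2)) I x) atTop (𝓝 (u x)) ∧
      Tendsto (fun n => ∑ I ∈ box (ns n), paraproductTerm α
        (Function.update (fun j y => (Q.sgn y : 𝕜) ^ (if j = i ∨ j = k then 1 else 2)) i
          fun y => b y * (Q.sgn y : 𝕜) ^ (if i = i ∨ i = k then 1 else 2)) I x)
        atTop (𝓝 (v x))) :
    lavg (fun x => ‖b x - dyadicAverage b J‖ₑ) J ≤ 2 * C := by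
  classical
  have hσ : sigma0 α = 1 := by
    rw [sigma0, Finset.card_eq_one]
    refine ⟨i, Finset.ext fun j => ?_⟩
    simp only [Finset.mem_filter, Finset.mem_univ, true_and, Finset.mem_singleton]
    refine ⟨fun h => ?_, fun h => h ▸ hαi⟩
    by_contra hj
    rw [hα1 j hj] at h
    exact absurd h (by decide)
  have hscale : J.scale = Q.scale + 1 := by rcases hJ with rfl | rfl <;> simp
  obtain ⟨c, hc1, hcJ⟩ : ∃ c : 𝕜, c * c = 1 ∧ ∀ x ∈ J.toSet, (Q.sgn x : 𝕜) = c := by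
    rcases hJ with rfl | rfl
    · exact ⟨-1, by simp, fun x hx => by rw [sgn_of_mem_lchild hx]; simp⟩
    · exact ⟨1, by simp, fun x hx => by rw [sgn_of_mem_rchild hx]; simp⟩
  have hkv : ∀ I : DyadicInterval, Q.toSet ⊆ I.toSet →
      ncoef (fun y => (Q.sgn y : 𝕜) ^ (if k = i ∨ k = k then 1 else 2)) I (α k) = 0 := by
    intro I hI
    rw [hα1 k hk, ncoef_one]
    simp only [or_true, if_true, pow_one]
    exact dyadicAverage_sgn_eq_zero hI
  -- Slot `k` kills `I = Q`, and orthogonality in slot `i` kills every other interval.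
  have hu0 : ∀ (I : DyadicInterval) (x : ℝ), paraproductTerm α
      (fun j y => (Q.sgn y : 𝕜) ^ (if j = i ∨ j = k then 1 else 2)) I x = 0 := by
    intro I x
    rw [paraproductTerm_eq]
    by_cases hI : I = Q
    · rw [Finset.prod_eq_zero (Finset.mem_univ k) (hkv I (by rw [hI])), zero_mul]
    · rw [Finset.prod_eq_zero (Finset.mem_univ i), zero_mul]
      rw [hαi]
      simpa using ncoef_sgn_of_ne (𝕜 := 𝕜) hI
  have hv0 : ∀ I : DyadicInterval, ∀ x ∈ J.toSet, paraproductTerm α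
      (Function.update (fun j y => (Q.sgn y : 𝕜) ^ (if j = i ∨ j = k then 1 else 2)) i
          fun y => b y * (Q.sgn y : 𝕜) ^ (if i = i ∨ i = k then 1 else 2)) I x =
      if I.toSet ⊆ J.toSet then haarPart b I x else 0 := by
    intro I x hxJ
    rw [paraproductTerm_eq, hσ, pow_one]
    by_cases hIJ : I.toSet ⊆ J.toSet
    · rw [if_pos hIJ, ← Finset.mul_prod_erase _ _ (Finset.mem_univ i), Function.update_self, hαi,
        ← Finset.mul_prod_erase _ _ (Finset.mem_erase.2 ⟨hk, Finset.mem_univ k⟩),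
        Function.update_of_ne hk, hα1 k hk, Finset.prod_eq_one, mul_one, haarPart]
      · congr 1
        have hi : ncoef (fun y => b y * (Q.sgn y : 𝕜) ^ (if i = i ∨ i = k then 1 else 2)) I 0 =
            c * ncoef b I 0 := by
          rw [← ncoef_const_mul]
          exact ncoef_congr (fun y hy => by simp [hcJ y (hIJ hy), mul_comm]) _
        have hk' : ncoef (fun y => (Q.sgn y : 𝕜) ^ (if k = i ∨ k = k then 1 else 2)) I 1 = c := by
          rw [ncoef_one, ← dyadicAverage_const c I]
          exact dyadicAverage_congr fun y hy => by simp [hcJ y (hIJ hy)]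
        rw [hi, hk', mul_right_comm, hc1, one_mul]
      · intro j hj
        obtain ⟨hjk, hj⟩ := Finset.mem_erase.1 hj
        have hji := Finset.ne_of_mem_erase hj
        rw [Function.update_of_ne hji, hα1 j hji, ncoef_one,
          dyadicAverage_congr (g := fun _ => (1 : 𝕜)), dyadicAverage_const]
        intro y hy
        simp only [hji, hjk, or_self, if_false]
        rw [hcJ y (hIJ hy), sq, hc1]
    · rw [if_neg hIJ]
      by_cases hxI : x ∈ I.toSet
      · rw [Finset.prod_eq_zero (Finset.mem_univ k), zero_mul]
        rw [Function.update_of_ne hk]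
        exact hkv I (subset_of_mem_child hJ hxJ hxI hIJ)
      · rw [sgn_of_notMem hxI, RCLike.ofReal_zero, mul_zero]
  refine lavg_le_of_eLpNorm_le (locallyIntegrable_sub_const hb _).aestronglyMeasurable ?_ hr
    (volume_of_scale_eq hscale).le hC
  filter_upwards [h, ae_tendsto_dyadicAverage hb] with x ⟨hx1, hx2⟩ hxb hxJ
  have hux : u x = 0 := by
    refine tendsto_nhds_unique hx1 ?_
    simp only [hu0, Finset.sum_const_zero]
    exact tendsto_const_nhds
  -- On `J` the surviving partial sums telescope to `⟨b⟩` over the interval of scale `ns n`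
  -- containing `x`, minus `⟨b⟩_J`; Lebesgue differentiation gives the limit.
  have hvx : v x = b x - dyadicAverage b J := by
    refine tendsto_nhds_unique hx2 (((hxb.comp hns).sub tendsto_const_nhds).congr' ?_)
    filter_upwards [hns.eventually (eventually_mem_box J)] with n hn
    rw [Finset.sum_congr rfl fun I _ => hv0 I x hxJ, ← Finset.sum_filter]
    rw [mem_box] at hn
    have hd : (ns n : ℤ) = J.scale + ((ns n : ℤ) - J.scale).toNat := by omega
    have hF : (box (ns n)).filter (fun I => I.toSet ⊆ J.toSet) =
        tree ((ns n : ℤ) - J.scale).toNat J := by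
      ext I
      rw [Finset.mem_filter, mem_box, mem_tree, ← hd]
      exact ⟨fun h => ⟨h.2, h.1.2⟩,
        fun h => ⟨⟨hn.1.imp (h.1.trans ·) (h.1.trans ·), h.2⟩, h.1⟩⟩
    rw [hF, sum_tree_haarPart hb _ hxJ, ← hd]
    rfl
  rw [hux, hvx, mul_zero, zero_sub, enorm_neg]

theorem memDyadicBMO_of_isBoundedOperator (hm : 2 ≤ m) {α : Fin m → Fin 2} (hα : sigma0 α ≠ 0)
    {i : Fin m} {p : Fin m → ℝ} {r : ℝ} (hp : ∀ j, 1 < p j) (hr : 1 < r)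
    (hpr : ∑ j, 1 / p j = 1 / r) {b : ℝ → 𝕜} (hb : LocallyIntegrable b volume)
    (H : IsBoundedOperator (dyadicCommutator b (paraproduct α) i) p r) : MemDyadicBMO b := by
  obtain ⟨C, hC, h⟩ := exists_eLpNorm_test_le hp hpr H
  refine memDyadicBMO_of_lavg_le hb (L := 2 * C) (ENNReal.mul_ne_top (by simp) hC) fun J => ?_
  by_cases hk : ∃ k, k ≠ i ∧ α k = 0
  · obtain ⟨k, hk, hαk⟩ := hk
    obtain ⟨u, v, hle, ns, hns, hae⟩ := h J (fun j => if α j = 0 then 1 else 2)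
      fun j => by split_ifs <;> norm_num
    exact lavg_le_of_exists_zero_ne hk hαk hr hb J hle hns hae
  · push Not at hk
    have hα1 : ∀ j, j ≠ i → α j = 1 := fun j hj => by have := hk j hj; omega
    have hαi : α i = 0 := by
      obtain ⟨j, hj⟩ := Finset.card_pos.1 (Nat.pos_of_ne_zero hα)
      have hj0 := (Finset.mem_filter.1 hj).2
      by_cases hji : j = i
      · exact hji ▸ hj0
      · exact absurd hj0 (hk j hji)
    have : Nontrivial (Fin m) := Fin.nontrivial_iff_two_le.2 hm
    obtain ⟨k, hki⟩ := exists_ne i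
    -- Testing on the parent suffices, since every dyadic interval is a half of another.
    obtain ⟨u, v, hle, ns, hns, hae⟩ := h J.parent (fun j => if j = i ∨ j = k then 1 else 2)
      fun j => by split_ifs <;> norm_num
    exact lavg_le_of_unique_zero hki hαi hα1 hr hb J.eq_child_parent hle hns hae

end

end DyadicInterval

end

/-! ### The two equivalences. -/

theorem theorem4p4 {𝕜 : Type*} [RCLike 𝕜] (m : ℕ) (hm : 2 ≤ m)
    (α : Fin m → Fin 2) (hα : α ∈ indexSetU m) (i : Fin m)
    (p : Fin m → ℝ) (r : ℝ) (hp : ∀ j, 1 < p j) (hr : 1 < r)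
    (hpr : ∑ j, 1 / p j = 1 / r)
    (b : ℝ → 𝕜) (q : ℝ) (hq : 1 < q) (hb : MemLp b (ENNReal.ofReal q) volume) :
    (MemDyadicBMO b ↔
      ∀ ε : DyadicInterval → 𝕜, (∃ M : ℝ, ∀ I, ‖ε I‖ ≤ M) →
        IsBoundedOperator (dyadicCommutator b (haarMultiplier ε α) i) p r) ∧
    (MemDyadicBMO b ↔
      IsBoundedOperator (dyadicCommutator b (paraproduct α) i) p r) := by
  have hσ := DyadicInterval.sigma0_ne_zero hα
  have hloc := DyadicInterval.locallyIntegrable_of_memLp hq hb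
  have h1 : MemDyadicBMO b → ∀ ε : DyadicInterval → 𝕜, (∃ M : ℝ, ∀ I, ‖ε I‖ ≤ M) →
      IsBoundedOperator (dyadicCommutator b (haarMultiplier ε α) i) p r := fun h ε ⟨_, hM⟩ =>
    DyadicInterval.isBoundedOperator_commutator hσ i hp hr hpr hq hb h hM
  -- The paraproduct is the multiplier with `ε = 1`, which closes the cycle of implications between
  -- all three statements.
  have h2 : (∀ ε : DyadicInterval → 𝕜, (∃ M : ℝ, ∀ I, ‖ε I‖ ≤ M) →
      IsBoundedOperator (dyadicCommutator b (haarMultiplier ε α) i) p r) →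
      IsBoundedOperator (dyadicCommutator b (paraproduct α) i) p r := fun h => by
    rw [DyadicInterval.paraproduct_eq_haarMultiplier]
    exact h _ ⟨1, fun _ => by simp⟩
  have h3 : IsBoundedOperator (dyadicCommutator b (paraproduct α) i) p r → MemDyadicBMO b :=
    DyadicInterval.memDyadicBMO_of_isBoundedOperator hm hσ hp hr hpr hloc
  exact ⟨⟨h1, fun h => h3 (h2 h)⟩, ⟨fun h => h2 (h1 h), h3⟩⟩
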